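/- Let $\bar M$ be a smooth compact $(n+1)$-dimensional manifold with boundary, $n\ge 1$, with interior $M$, and let $\rho\colon\bar M\to[0,\infty)$ be a smooth defining function: $\rho^{-1}(0)=\partial M$ and $d\rho\ne0$ on $\partial M$. Hölder spaces. Let $B_r$ be the ball of radius $r$ about $(0,\dots,0,1)$ in the upper half-space model of hyperbolic space. Fix finitely many background coordinate charts $(\theta,\rho)$ of $\bar M$ near $\partial M$, and a countable collection of parametrizations $\Phi_i\colon B_2\to M$ consisting of Möbius parametrizations $\Phi(x,y)=(\theta_0+\rho_0x,\rho_0y)$ in background coordinates (with image in a fixed compact subset of the range of the respective background chart) and finitely many parametrizations given by inverses of smooth charts whose range contains the closed ball $\overline{B_2}$, such that the sets $\Phi_i(B_1)$ cover $M$ and the sets $\Phi_i(B_2)$ are uniformly locally finite. For $\alpha\in[0,1)$, $C^{k,\alpha}(M)$ is the space of tensor fields $u$ on $M$ with $\sup_i\|\Phi_i^*u\|_{C^{k,\alpha}(B_2)}<\infty$, and $C^{k,\alpha}_\delta(M)=\rho^\delta C^{k,\alpha}(M)$. Curvature. $\mathrm{Riem}[g]$ denotes the curvature operator on $\Lambda^2TM$,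 viewed as a $(2,2)$ tensor, with the sign for which a metric of constant sectional curvature $K$ has $\mathrm{Riem}=K\,\mathrm{Id}$, where $\mathrm{Id}_{ij}^{kl}=\delta_i^k\delta_j^l-\delta_i^l\delta_j^k$; $\mathrm{Ric}[g]_i^k=\mathrm{Riem}_{ij}^{kj}$ is the Ricci operator, viewed as a $(1,1)$ tensor; $\mathrm R[g]=\mathrm{Ric}_i^i$ is the scalar curvature; $\delta$ is the identity of $TM$, and ${}^g\nabla$ is the Levi-Civita connection of $g$. Let $k\ge2$ and $\alpha\in[0,1)$. Let $g$ be a weakly $C^{k,\alpha}$ asymptotically hyperbolic metric on $M$, that is, $g\in\mathscr M_{\rm weak}^{k,\alpha;1}$: $g$ is a Riemannian metric on $M$ such that $\bar g=\rho^2g$ extends continuously to a non-degenerate metric on $\bar M$, $\bar g\in C^{k,\alpha}_2(M)$, $\mathcal L_X\bar g\in C^{k-1,\alpha}_2(M)$ for every smooth vector field $X$ on $\bar M$, and $\mathrm{Riem}[g]\to-\mathrm{Id}$ as $\rho\to0$. Then: 1. $\mathrm{Riem}[g]+\mathrm{Id}\in C^{k-2,\alpha}_1(M)$; 2. $\mathrm{Ric}[g]+n\delta\in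 C^{k-2,\alpha}_1(M)$; 3. $\mathrm R[g]+n(n+1)\in C^{k-2,\alpha}_1(M)$; 4. $|d\rho|^2_{\bar g}-1\in C^{k,\alpha}_1(M)$; 5. for all $1\le j\le k-2$, the tensor field $\rho^j({}^g\nabla)^j\mathrm{Riem}[g]$ extends continuously to $\bar M$, and it is $O(\rho)$ as $\rho\to0$, in the sense that its components in any smooth chart of $\bar M$ are $O(\rho)$ near each boundary point (equivalently, its norm with respect to a smooth metric on $\bar M$ is $O(\rho)$). -/

import Mathlib

open scoped Manifold ContDiff Topology
open Set Filter

noncomputable section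

namespace WAH

/-- Coordinate space `ℝ^{n+1}`. The coordinate with index `0` is the one that is nonnegative on the
model half-space. -/
abbrev V (n : ℕ) : Type := EuclideanSpace ℝ (Fin (n + 1))

/-- The coordinate vectors of `ℝ^{n+1}`. -/
def coordVec (n : ℕ) (i : Fin (n + 1)) : V n := EuclideanSpace.single i 1

/-- Coordinate charts of an `(n+1)`-dimensional manifold with boundary. -/
abbrev Chart (n : ℕ) (Mbar : Type*) [TopologicalSpace Mbar] : Type _ :=
  OpenPartialHomeomorph Mbar (EuclideanHalfSpace (n + 1))

section Charts

variable {n : ℕ} {Mbar : Type*} [TopologicalSpace Mbar]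

/-- The point of `Mbar` with coordinates `x` in the chart `e`. -/
def pt (e : Chart n Mbar) (x : V n) : Mbar := (e.extend (𝓡∂ (n + 1))).symm x

/-- The set of coordinate values of the chart `e`, boundary points included. -/
def domBar (e : Chart n Mbar) : Set (V n) := (e.extend (𝓡∂ (n + 1))).target

variable [ChartedSpace (EuclideanHalfSpace (n + 1)) Mbar]

/-- The coordinate values in the chart `e` of the interior points of `Mbar`. -/
def dom (e : Chart n Mbar) : Set (V n) :=
  {x ∈ domBar e | pt e x ∈ (𝓡∂ (n + 1)).interior Mbar}

/-- The coordinate values in the chart `e` of the boundary points of `Mbar`. -/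
def domBdry (e : Chart n Mbar) : Set (V n) :=
  {x ∈ domBar e | pt e x ∈ (𝓡∂ (n + 1)).boundary Mbar}

/-- A field of bilinear forms on the tangent spaces. -/
abbrev BilinField (n : ℕ) (Mbar : Type*) [TopologicalSpace Mbar]
    [ChartedSpace (EuclideanHalfSpace (n + 1)) Mbar] : Type _ :=
  (p : Mbar) → TangentSpace (𝓡∂ (n + 1)) p →L[ℝ] TangentSpace (𝓡∂ (n + 1)) p →L[ℝ] ℝ

/-- The coordinate vector field `∂_i` of the chart `e`, at the point with coordinates `x`. -/
def frame (e : Chart n Mbar) (x : V n) (i : Fin (n + 1)) :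
    TangentSpace (𝓡∂ (n + 1)) (pt e x) :=
  mfderivWithin 𝓘(ℝ, V n) (𝓡∂ (n + 1)) (e.extend (𝓡∂ (n + 1))).symm (range (𝓡∂ (n + 1))) x
    (coordVec n i)

/-- The component `X^i` of a vector field in the chart `e`, at the point with coordinates `x`. -/
def vecComp (X : (p : Mbar) → TangentSpace (𝓡∂ (n + 1)) p) (e : Chart n Mbar) (x : V n)
    (i : Fin (n + 1)) : ℝ :=
  let v : V n := mfderiv (𝓡∂ (n + 1)) 𝓘(ℝ, V n) (e.extend (𝓡∂ (n + 1))) (pt e x) (X (pt e x))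
  v i

end Charts

/-! ### Tensor fields through their components in charts -/

/-- A tensor field of covariant rank `r` and contravariant rank `s` on the interior, given in the
classical way by its components in every chart: `T e x I J` is the component
`T_{I 0 … I (r-1)}^{J 0 … J (s-1)}` in the chart `e`, at the point with coordinates `x`.
Only the values for `x ∈ dom e` are meaningful. -/
abbrev ChartTensor (n : ℕ) (Mbar : Type*) [TopologicalSpace Mbar] (r s : ℕ) : Type _ :=
  Chart n Mbar → V n → (Fin r → Fin (n + 1)) → (Fin s → Fin (n + 1)) → ℝ

section Tensors

variable {n : ℕ} {Mbar : Type*} [TopologicalSpace Mbar]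

/-- The product of a function and a tensor field. -/
def fmul (f : Mbar → ℝ) {r s : ℕ} (T : ChartTensor n Mbar r s) : ChartTensor n Mbar r s :=
  fun e x I J => f (pt e x) * T e x I J

/-- A constant function, as a tensor field of rank zero. -/
def constTensor (c : ℝ) : ChartTensor n Mbar 0 0 := fun _ _ _ _ => c

/-- Kronecker's delta. -/
def kron (i j : Fin (n + 1)) : ℝ := if i = j then 1 else 0

/-- The identity `δ` of the tangent bundle, as a `(1,1)` tensor. -/
def deltaTensor : ChartTensor n Mbar 1 1 := fun _ _ I J => kron (I 0) (J 0)

/-- The identity of `Λ²` of the tangent bundle, as a `(2,2)` tensor: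
`Id_{ij}^{kl} = δ_i^k δ_j^l - δ_i^l δ_j^k`. -/
def idTensor : ChartTensor n Mbar 2 2 := fun _ _ I J =>
  kron (I 0) (J 0) * kron (I 1) (J 1) - kron (I 0) (J 1) * kron (I 1) (J 0)

/-- The Lie derivative of a tensor field along a vector field:
`X^b ∂_b T_I^J + ∑ T_{…b…}^J ∂_{i_m} X^b - ∑ T_I^{…b…} ∂_b X^{j_m}`. -/
def lieDeriv [ChartedSpace (EuclideanHalfSpace (n + 1)) Mbar]
    (X : (p : Mbar) → TangentSpace (𝓡∂ (n + 1)) p) {r s : ℕ}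
    (T : ChartTensor n Mbar r s) : ChartTensor n Mbar r s :=
  fun e x I J =>
    (∑ b, vecComp X e x b * fderiv ℝ (fun y => T e y I J) x (coordVec n b))
    + (∑ m, ∑ b, T e x (Function.update I m b) J *
        fderiv ℝ (fun y => vecComp X e y b) x (coordVec n (I m)))
    - (∑ m, ∑ b, T e x I (Function.update J m b) *
        fderiv ℝ (fun y => vecComp X e y (J m)) x (coordVec n b))

/-- The `(2,0)` tensor field of a field of bilinear forms, `g_{ij} = g(∂_i, ∂_j)`. -/
def metricTensor [ChartedSpace (EuclideanHalfSpace (n + 1)) Mbar] (g : BilinField n Mbar) :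
    ChartTensor n Mbar 2 0 :=
  fun e x I _ => g (pt e x) (frame e x (I 0)) (frame e x (I 1))

/-! ### The Levi-Civita connection and the curvature

In the definitions below, `g` is the component family of a Riemannian metric. -/

/-- The components `g^{ij}` of the inverse metric. -/
def invMetric (g : ChartTensor n Mbar 2 0) (e : Chart n Mbar) (x : V n) (i j : Fin (n + 1)) : ℝ :=
  (Matrix.of fun a b => g e x ![a, b] ![])⁻¹ i j

/-- The partial derivative `∂_a g_{bc}`. -/
def dMetric (g : ChartTensor n Mbar 2 0) (e : Chart n Mbar) (x : V n) (a b c : Fin (n + 1)) : ℝ :=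
  fderiv ℝ (fun y => g e y ![b, c] ![]) x (coordVec n a)

/-- The Christoffel symbol
`Γ^c_{ab} = (1/2) g^{cd} (∂_a g_{bd} + ∂_b g_{ad} - ∂_d g_{ab})`. -/
def christoffel (g : ChartTensor n Mbar 2 0) (e : Chart n Mbar) (x : V n)
    (c a b : Fin (n + 1)) : ℝ :=
  (1 / 2) * ∑ d, invMetric g e x c d *
    (dMetric g e x a b d + dMetric g e x b a d - dMetric g e x d a b)

/-- The covariant derivative `∇T` of a tensor field for the Levi-Civita connection of `g`; the new
covariant index is the first one. -/
def covDeriv (g : ChartTensor n Mbar 2 0) {r s : ℕ} (T : ChartTensor n Mbar r s) :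
    ChartTensor n Mbar (r + 1) s :=
  fun e x I J =>
    fderiv ℝ (fun y => T e y (Fin.tail I) J) x (coordVec n (I 0))
    - (∑ m : Fin r, ∑ b, christoffel g e x b (I 0) (I m.succ) *
        T e x (Function.update (Fin.tail I) m b) J)
    + (∑ m : Fin s, ∑ b, christoffel g e x (J m) (I 0) b *
        T e x (Fin.tail I) (Function.update J m b))

/-- The iterated covariant derivative `∇^j T`. -/
def covDerivIter (g : ChartTensor n Mbar 2 0) {r s : ℕ} (T : ChartTensor n Mbar r s) :
    (j : ℕ) → ChartTensor n Mbar (r + j) s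
  | 0 => T
  | j + 1 => covDeriv g (covDerivIter g T j)

/-- The components `R_{ijm}^k` of the curvature, `R(∂_i, ∂_j) ∂_m = R_{ijm}^k ∂_k` with
`R(X, Y) = ∇_X ∇_Y - ∇_Y ∇_X - ∇_{[X, Y]}`. -/
def curvComp (g : ChartTensor n Mbar 2 0) (e : Chart n Mbar) (x : V n)
    (i j m k : Fin (n + 1)) : ℝ :=
  fderiv ℝ (fun y => christoffel g e y k j m) x (coordVec n i)
  - fderiv ℝ (fun y => christoffel g e y k i m) x (coordVec n j)
  + ∑ a, (christoffel g e x k i a * christoffel g e x a j m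
      - christoffel g e x k j a * christoffel g e x a i m)

/-- The Riemann curvature operator on `Λ²` of the tangent bundle, as a `(2,2)` tensor:
`Riem_{ij}^{kl} = g^{lm} R_{ijm}^k`. It is `K · Id` for a metric of constant curvature `K`. -/
def riem (g : ChartTensor n Mbar 2 0) : ChartTensor n Mbar 2 2 :=
  fun e x I J => ∑ m, invMetric g e x (J 1) m * curvComp g e x (I 0) (I 1) m (J 0)

/-- The Ricci operator, as a `(1,1)` tensor: `Ric_i^k = Riem_{ij}^{kj}`. -/
def ric (g : ChartTensor n Mbar 2 0) : ChartTensor n Mbar 1 1 :=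
  fun e x I J => ∑ j, riem g e x ![I 0, j] ![J 0, j]

/-- The scalar curvature. -/
def scal (g : ChartTensor n Mbar 2 0) : ChartTensor n Mbar 0 0 :=
  fun e x _ _ => ∑ i, ric g e x ![i] ![i]

/-- The function `|df|²_g = g^{ij} ∂_i f ∂_j f`. -/
def gradNormSq (g : ChartTensor n Mbar 2 0) (f : Mbar → ℝ) : ChartTensor n Mbar 0 0 :=
  fun e x _ _ => ∑ i, ∑ j, invMetric g e x i j *
    fderiv ℝ (fun y => f (pt e y)) x (coordVec n i) *
    fderiv ℝ (fun y => f (pt e y)) x (coordVec n j)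

end Tensors

/-! ### Behaviour at the boundary -/

section Boundary

variable {n : ℕ} {Mbar : Type*} [TopologicalSpace Mbar]
  [ChartedSpace (EuclideanHalfSpace (n + 1)) Mbar] {r s : ℕ}

/-- The tensor field tends to zero at the boundary: all its components, in every smooth chart,
tend to zero at every boundary point. -/
def TendsToZeroAtBoundary (T : ChartTensor n Mbar r s) : Prop :=
  ∀ e ∈ IsManifold.maximalAtlas (𝓡∂ (n + 1)) ∞ Mbar, ∀ x ∈ domBdry e, ∀ I J,
    Tendsto (fun y => T e y I J) (𝓝[dom e] x) (𝓝 0)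

/-- The tensor field on the interior extends continuously to the manifold with boundary: in every
smooth chart, its components extend continuously up to the boundary. -/
def ExtendsContinuously (T : ChartTensor n Mbar r s) : Prop :=
  ∀ e ∈ IsManifold.maximalAtlas (𝓡∂ (n + 1)) ∞ Mbar, ∀ I J,
    ∃ F : V n → ℝ, ContinuousOn F (domBar e) ∧ ∀ x ∈ dom e, F x = T e x I J

/-- The tensor field is `O(f)` at the boundary: all its components, in every smooth chart, are
`O(f)` near every boundary point. -/
def IsBigOAtBoundary (T : ChartTensor n Mbar r s) (f : Mbar → ℝ) : Prop :=
  ∀ e ∈ IsManifold.maximalAtlas (𝓡∂ (n + 1)) ∞ Mbar, ∀ x ∈ domBdry e, ∀ I J,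
    (fun y => T e y I J) =O[𝓝[dom e] x] (fun y => f (pt e y))

/-- A smooth defining function `ρ : Mbar → [0,∞)` of the boundary. -/
structure IsDefiningFunction (n : ℕ) {Mbar : Type*} [TopologicalSpace Mbar]
    [ChartedSpace (EuclideanHalfSpace (n + 1)) Mbar] (ρ : Mbar → ℝ) : Prop where
  smooth : ContMDiff (𝓡∂ (n + 1)) 𝓘(ℝ, ℝ) ∞ ρ
  nonneg : ∀ p, 0 ≤ ρ p
  zero_iff : ∀ p, ρ p = 0 ↔ p ∈ (𝓡∂ (n + 1)).boundary Mbar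
  deriv_ne : ∀ p ∈ (𝓡∂ (n + 1)).boundary Mbar, mfderiv (𝓡∂ (n + 1)) 𝓘(ℝ, ℝ) ρ p ≠ 0

end Boundary

/-! ### Möbius parametrizations and intrinsic Hölder spaces -/

/-- The distance of the upper half-space model of hyperbolic space; the height is the coordinate
with index `0`. -/
def hypDist {n : ℕ} (x y : V n) : ℝ := 2 * Real.arsinh (dist x y / (2 * √(x 0 * y 0)))

/-- The open hyperbolic ball `B_R` of radius `R` about the point of height `1` over the origin. -/
def hypBall (n : ℕ) (R : ℝ) : Set (V n) := {x | 0 < x 0 ∧ hypDist x (coordVec n 0) < R}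

/-- The closed hyperbolic ball with the same centre. -/
def hypClosedBall (n : ℕ) (R : ℝ) : Set (V n) := {x | 0 < x 0 ∧ hypDist x (coordVec n 0) ≤ R}

/-- A parametrization `x ↦ e⁻¹(scale · x + shift)` by way of the chart `e`. -/
structure Param (n : ℕ) (Mbar : Type*) [TopologicalSpace Mbar] where
  chart : Chart n Mbar
  scale : ℝ
  shift : V n

namespace Param

variable {n : ℕ} {Mbar : Type*} [TopologicalSpace Mbar]

/-- The map `x ↦ e⁻¹(scale · x + shift)`. -/
def map (Φ : Param n Mbar) (x : V n) : Mbar := pt Φ.chart (Φ.scale • x + Φ.shift)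

/-- The components of the pulled-back tensor field `Φ^* T`. Every covariant index contributes a
factor `scale`, every contravariant index a factor `scale⁻¹`. -/
def pullback (Φ : Param n Mbar) {r s : ℕ} (T : ChartTensor n Mbar r s) (x : V n)
    (I : Fin r → Fin (n + 1)) (J : Fin s → Fin (n + 1)) : ℝ :=
  Φ.scale ^ r * (Φ.scale⁻¹) ^ s * T Φ.chart (Φ.scale • x + Φ.shift) I J

/-- The Möbius parametrization `Φ(θ, y) = e⁻¹(θ₀ + ρ₀ θ, ρ₀ y)` centred at the point with
coordinates `c = (θ₀, ρ₀)` in the background chart `e`; here `ρ₀ = c 0`. -/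
def mobius (e : Chart n Mbar) (c : V n) : Param n Mbar where
  chart := e
  scale := c 0
  shift := c - c 0 • coordVec n 0

/-- The inverse of a chart, as a parametrization. -/
def ofChart (e : Chart n Mbar) : Param n Mbar where
  chart := e
  scale := 1
  shift := 0

end Param

/-- The parametrizations by which the Hölder spaces are defined: finitely many background charts
near the boundary, whose coordinate with index `0` is `ρ`, each with a compact subset of its range
in which the parametrizations have to take their values; countably many Möbius parametrizations
`B₂ → M` by way of these charts; and finitely many parametrizations `B₂ → M` by interior charts that
are defined on a neighbourhood of the closed ball. -/
structure MobiusFamily (n : ℕ) {Mbar : Type*} [TopologicalSpace Mbar]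
    [ChartedSpace (EuclideanHalfSpace (n + 1)) Mbar] (ρ : Mbar → ℝ) where
  bgIdx : Type
  bg_finite : Finite bgIdx
  bgChart : bgIdx → Chart n Mbar
  bgChart_mem : ∀ i, bgChart i ∈ IsManifold.maximalAtlas (𝓡∂ (n + 1)) ∞ Mbar
  bgChart_coord : ∀ i, ∀ p ∈ (bgChart i).source, (bgChart i).extend (𝓡∂ (n + 1)) p 0 = ρ p
  bgCore : bgIdx → Set (V n)
  bgCore_compact : ∀ i, IsCompact (bgCore i)
  bgCore_subset : ∀ i, bgCore i ⊆ domBar (bgChart i)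
  mobIdx : Type
  mob_countable : Countable mobIdx
  mobBg : mobIdx → bgIdx
  mobCentre : mobIdx → V n
  mobCentre_pos : ∀ a, 0 < mobCentre a 0
  mob_ball : ∀ a, ∀ x ∈ hypBall n 2,
    mobCentre a 0 • x + (mobCentre a - mobCentre a 0 • coordVec n 0) ∈ bgCore (mobBg a)
  intIdx : Type
  int_finite : Finite intIdx
  intChart : intIdx → Chart n Mbar
  intChart_mem : ∀ i, intChart i ∈ IsManifold.maximalAtlas (𝓡∂ (n + 1)) ∞ Mbar
  intChart_ball : ∀ i, hypClosedBall n 2 ⊆ domBar (intChart i)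

/-- All parametrizations of the family. -/
def MobiusFamily.param {n : ℕ} {Mbar : Type*} [TopologicalSpace Mbar]
    [ChartedSpace (EuclideanHalfSpace (n + 1)) Mbar] {ρ : Mbar → ℝ} (𝒜 : MobiusFamily n ρ) :
    𝒜.mobIdx ⊕ 𝒜.intIdx → Param n Mbar
  | .inl a => Param.mobius (𝒜.bgChart (𝒜.mobBg a)) (𝒜.mobCentre a)
  | .inr i => Param.ofChart (𝒜.intChart i)

/-- A family of parametrizations such that the images of `B₁` cover the interior `M` and the images
of `B₂` are uniformly locally finite. -/
structure MobiusCover (n : ℕ) {Mbar : Type*} [TopologicalSpace Mbar]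
    [ChartedSpace (EuclideanHalfSpace (n + 1)) Mbar] (ρ : Mbar → ℝ) extends
    MobiusFamily n ρ where
  covers : ∀ p ∈ (𝓡∂ (n + 1)).interior Mbar,
    ∃ a, p ∈ (toMobiusFamily.param a).map '' hypBall n 1
  locallyFinite : ∃ N : ℕ, ∀ a,
    {b | ((toMobiusFamily.param a).map '' hypBall n 2 ∩
      (toMobiusFamily.param b).map '' hypBall n 2).Nonempty}.encard ≤ N

/-- The `C^{k,α}(U)` norm of `f` is controlled by `C`, for an open set `U`: the function is `C^k`
there, its derivatives up to order `k` are bounded by `C`, and the derivative of order `k` has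
`α`-Hölder seminorm at most `C` (no condition beyond boundedness if `α = 0`). -/
def HolderBoundOn {n : ℕ} (k : ℕ) (α : ℝ) (U : Set (V n)) (C : ℝ) (f : V n → ℝ) : Prop :=
  ContDiffOn ℝ k f U ∧
  (∀ m ≤ k, ∀ x ∈ U, ‖iteratedFDeriv ℝ m f x‖ ≤ C) ∧
  ∀ x ∈ U, ∀ y ∈ U, ‖iteratedFDeriv ℝ k f x - iteratedFDeriv ℝ k f y‖ ≤ C * dist x y ^ α

section Holder

variable {n : ℕ} {Mbar : Type*} [TopologicalSpace Mbar]
  [ChartedSpace (EuclideanHalfSpace (n + 1)) Mbar] {ρ : Mbar → ℝ} {r s : ℕ}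

/-- Membership in `C^{k,α}(M)`: the pullbacks `Φ_a^* T` are bounded in `C^{k,α}(B₂)`. -/
def MemHolder (𝒜 : MobiusCover n ρ) (k : ℕ) (α : ℝ) (T : ChartTensor n Mbar r s) : Prop :=
  ∃ C : ℝ, ∀ a, ∀ I J,
    HolderBoundOn k α (hypBall n 2) C (fun x => (𝒜.param a).pullback T x I J)

/-- Membership in `C^{k,α}_δ(M) = ρ^δ C^{k,α}(M)`. -/
def MemWHolder (𝒜 : MobiusCover n ρ) (k : ℕ) (α δ : ℝ) (T : ChartTensor n Mbar r s) : Prop :=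
  MemHolder 𝒜 k α (fmul (fun p => ρ p ^ (-δ)) T)

end Holder

/-! ### Weakly asymptotically hyperbolic metrics -/

section Metrics

variable {n : ℕ} {Mbar : Type*} [TopologicalSpace Mbar]
  [ChartedSpace (EuclideanHalfSpace (n + 1)) Mbar] [IsManifold (𝓡∂ (n + 1)) ∞ Mbar]

/-- A (rough) Riemannian metric on the interior; the values at boundary points are irrelevant. -/
structure IsMetricOnInterior (g : BilinField n Mbar) : Prop where
  symm : ∀ p ∈ (𝓡∂ (n + 1)).interior Mbar, ∀ v w, g p v w = g p w v
  pos : ∀ p ∈ (𝓡∂ (n + 1)).interior Mbar, ∀ v, v ≠ 0 → 0 < g p v v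

/-- `g` is conformally compact: `ρ² g` extends to a continuous Riemannian metric on `Mbar`. -/
def IsConformallyCompact (ρ : Mbar → ℝ) (g : BilinField n Mbar) : Prop :=
  ∃ gbar : Bundle.ContinuousRiemannianMetric (V n)
      (fun p : Mbar => TangentSpace (𝓡∂ (n + 1)) p),
    ∀ p ∈ (𝓡∂ (n + 1)).interior Mbar, ∀ v w, gbar.inner p v w = ρ p ^ 2 * g p v w

/-- The tensor field `ρ² g` on the interior. -/
def gBar (ρ : Mbar → ℝ) (g : BilinField n Mbar) : ChartTensor n Mbar 2 0 :=
  fmul (fun p => ρ p ^ 2) (metricTensor g)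

/-- Membership in the class `𝓜_weak^{k,α;1}` of weakly `C^{k,α}` asymptotically hyperbolic
metrics. -/
structure IsWeaklyAH {ρ : Mbar → ℝ} (𝒜 : MobiusCover n ρ) (k : ℕ) (α : ℝ)
    (g : BilinField n Mbar) : Prop where
  metric : IsMetricOnInterior g
  conformallyCompact : IsConformallyCompact ρ g
  gBar_mem : MemWHolder 𝒜 k α 2 (gBar ρ g)
  lie_gBar_mem : ∀ X : Cₛ^∞⟮𝓡∂ (n + 1); V n, (fun p : Mbar => TangentSpace (𝓡∂ (n + 1)) p)⟯,
    MemWHolder 𝒜 (k - 1) α 2 (lieDeriv (fun p => X p) (gBar ρ g))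
  riem_tendsto : TendsToZeroAtBoundary (riem (metricTensor g) + idTensor)

end Metrics

end WAH

end

noncomputable section

namespace WAH

/-! ### Weighted regularity of families of functions -/

/-! Write `g = ρ⁻² ḡ`. In every chart `Γ[g] = Γ̄ - ρ⁻¹ P` with `P^c_{ab} = δ^c_a ∂_bρ + δ^c_b ∂_aρ -
ḡ_{ab} ∇̄^cρ`. Substituting this in the curvature and sorting by powers of `ρ` gives `Riem + Id = (1
- |dρ|²) Id + ρ E` (`riem_add_id_eq`), where the norm is that of `ḡ` and `E` contains `∂Γ̄` only
with a factor `ρ`, and besides this `Γ̄`, `P` and `∂P`.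

Möbius parametrizations rescale coordinates by a number comparable to `ρ`. The intrinsic Hölder
spaces therefore amount to control of the iterated derivatives `ρ∂` in fixed charts of the manifold
with boundary (`Gauge.Reg`, `reg_of_holderBoundOn`, `holderBoundOn_of_reg`). The hypothesis on Lie
derivatives, for vector fields that extend coordinate fields, says that the unweighted `∂ḡ` has
order `k - 1` (`Gauge.CReg`, `adapted_pieceGauge`). Since `P` contains no derivative of `ḡ`, it
follows that `E` has order `k - 2`.

It remains to treat `|dρ|² - 1`. As `ρ E → 0`, the limit `Riem → -Id` forces `|dρ|² → 1` at the
boundary; this needs two distinct indices, so `n ≥ 1`. The first partial derivatives of `|dρ|²` are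
bounded, so it is Lipschitz on half-balls, and `|dρ|² - 1` is bounded by the height, which is `O(ρ)`
(`gradNormSq_sub_one_le`). For `f = O(ρ)` the identity `ρ ∂(f/ρ) = ∂f - ∂ρ (f/ρ)` bootstraps the
regularity of `f/ρ` (`CReg.div_r`). This gives the fourth claim, then the first, and by traces the
second and the third.

For the last claim, `Id` is parallel and `ρΓ[g]` is regular, so `ρ∇` acts like `ρ∂`: `ρ^j ∇^j Riem`
is `ρ` times a bounded continuous tensor (`reg_covDerivIter_riem`). This claim and the Lipschitz
argument concern half-balls in arbitrary charts. The regularity is carried there by smooth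
coordinate changes that preserve `ρ` (`exists_adapted_ballGauge`). -/

/-- The partial derivative `∂_i f`. -/
def pd {n : ℕ} (i : Fin (n + 1)) (f : V n → ℝ) : V n → ℝ := fun x => fderiv ℝ f x (coordVec n i)

section PartialDerivatives

variable {n : ℕ}

theorem eq_sum_coordVec (v : V n) : v = ∑ i, v i • coordVec n i := by
  ext j
  simp [coordVec, Pi.single_apply]

theorem clm_eq_sum (L : V n →L[ℝ] ℝ) (v : V n) : L v = ∑ i, v i * L (coordVec n i) := by
  conv_lhs => rw [eq_sum_coordVec v]
  simp

theorem norm_clm_le {L : V n →L[ℝ] ℝ} {C : ℝ} (hC : ∀ i, |L (coordVec n i)| ≤ C) :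
    ‖L‖ ≤ (n + 1) * C := by
  have hC0 : 0 ≤ C := (abs_nonneg _).trans (hC 0)
  refine L.opNorm_le_bound (by positivity) fun v => ?_
  rw [clm_eq_sum]
  calc ‖∑ i, v i * L (coordVec n i)‖ ≤ ∑ i : Fin (n + 1), ‖v i * L (coordVec n i)‖ :=
        norm_sum_le _ _
    _ ≤ ∑ _i : Fin (n + 1), ‖v‖ * C := by
        refine Finset.sum_le_sum fun i _ => ?_
        rw [norm_mul]
        exact mul_le_mul (PiLp.norm_apply_le v i) (hC i) (norm_nonneg _) (norm_nonneg _)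
    _ = (n + 1) * C * ‖v‖ := by simp; ring

theorem pd_congr {U : Set (V n)} (hU : IsOpen U) {f g : V n → ℝ} (h : ∀ x ∈ U, f x = g x)
    (i : Fin (n + 1)) : ∀ x ∈ U, pd i f x = pd i g x := by
  intro x hx
  have : f =ᶠ[𝓝 x] g := by filter_upwards [hU.mem_nhds hx] with y hy using h y hy
  simp [pd, this.fderiv_eq]

theorem pd_add {f g : V n → ℝ} {x : V n} (hf : DifferentiableAt ℝ f x)
    (hg : DifferentiableAt ℝ g x) (i : Fin (n + 1)) :
    pd i (fun y => f y + g y) x = pd i f x + pd i g x := by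
  simp [pd, fderiv_fun_add hf hg]

theorem pd_sub {f g : V n → ℝ} {x : V n} (hf : DifferentiableAt ℝ f x)
    (hg : DifferentiableAt ℝ g x) (i : Fin (n + 1)) :
    pd i (fun y => f y - g y) x = pd i f x - pd i g x := by
  simp [pd, fderiv_fun_sub hf hg]

theorem pd_mul {f g : V n → ℝ} {x : V n} (hf : DifferentiableAt ℝ f x)
    (hg : DifferentiableAt ℝ g x) (i : Fin (n + 1)) :
    pd i (fun y => f y * g y) x = f x * pd i g x + g x * pd i f x := by
  simp [pd, fderiv_fun_mul hf hg]

theorem pd_inv {f : V n → ℝ} {x : V n} (hf : DifferentiableAt ℝ f x) (h0 : f x ≠ 0)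
    (i : Fin (n + 1)) : pd i (fun y => (f y)⁻¹) x = -((f x)⁻¹ * (f x)⁻¹ * pd i f x) := by
  have := (hasDerivAt_inv h0).comp_hasFDerivAt x hf.hasFDerivAt
  have h2 : fderiv ℝ (fun y => (f y)⁻¹) x = _ := this.fderiv
  simp only [pd, h2]
  simp [pow_two]

@[simp] theorem pd_const (c : ℝ) (i : Fin (n + 1)) (x : V n) : pd i (fun _ => c) x = 0 := by
  simp [pd]

end PartialDerivatives

/-- Data by which functions of weighted Hölder regularity are defined: open sets `W a` in a compact
subset `K` of the domain `D`, a weight `r`, and a relation that tells for which pairs of points of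
`W a` which Hölder gauge is imposed. -/
structure Gauge (n : ℕ) (ι : Type) where
  D : Set (V n)
  uniq : UniqueDiffOn ℝ D
  K : Set (V n)
  compact : IsCompact K
  K_sub : K ⊆ D
  W : ι → Set (V n)
  isOpen : ∀ a, IsOpen (W a)
  W_sub : ∀ a, W a ⊆ K
  r : V n → ℝ
  r_smooth : ContDiffOn ℝ ∞ r D
  r_pos : ∀ a, ∀ x ∈ W a, 0 < r x
  P : ι → V n → V n → ℝ → Prop
  -- This comparison turns a bound on `r ∂f` into a Hölder bound on `f` by the mean value inequality
  -- along the segment.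
  lip : ∃ L, 0 ≤ L ∧ ∀ a p q d, P a p q d → 0 ≤ d ∧ segment ℝ p q ⊆ W a ∧
    ∀ z ∈ segment ℝ p q, dist p q ≤ L * d * r z

namespace Gauge

variable {n : ℕ} {ι : Type} (G : Gauge n ι)

/-- Boundedness of the family on the sets `W a`. -/
def Bdd (f : ι → V n → ℝ) : Prop := ∃ C, ∀ a, ∀ x ∈ G.W a, |f a x| ≤ C

/-- Continuity, boundedness and the Hölder condition. -/
structure Reg0 (f : ι → V n → ℝ) : Prop where
  cont : ∀ a, ContinuousOn (f a) (G.W a)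
  bdd : G.Bdd f
  hol : ∃ C, ∀ a p q d, G.P a p q d → |f a p - f a q| ≤ C * d

/-- Weighted regularity of order `m`: the functions `f`, `r ∂_i f`, `r ∂_i (r ∂_j f)`, … with up to
`m` derivatives satisfy `Reg0`. -/
def Reg : ℕ → (ι → V n → ℝ) → Prop
  | 0, f => G.Reg0 f
  | m + 1, f => G.Reg0 f ∧ (∀ a, DifferentiableOn ℝ (f a) (G.W a)) ∧
      ∀ i, Reg m (fun a x => G.r x * pd i (f a) x)

variable {G}

theorem Bdd.exists_nonneg {f : ι → V n → ℝ} (h : G.Bdd f) :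
    ∃ C, 0 ≤ C ∧ ∀ a, ∀ x ∈ G.W a, |f a x| ≤ C := by
  obtain ⟨C, hC⟩ := h
  exact ⟨|C|, abs_nonneg _, fun a x hx => (hC a x hx).trans (le_abs_self _)⟩

theorem Bdd.mul {f g : ι → V n → ℝ} (hf : G.Bdd f) (hg : G.Bdd g) :
    G.Bdd (fun a x => f a x * g a x) := by
  obtain ⟨A, hA0, hA⟩ := hf.exists_nonneg
  obtain ⟨B, -, hB⟩ := hg.exists_nonneg
  refine ⟨A * B, fun a x hx => ?_⟩
  rw [abs_mul]
  exact mul_le_mul (hA a x hx) (hB a x hx) (abs_nonneg _) hA0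

theorem Bdd.sub {f g : ι → V n → ℝ} (hf : G.Bdd f) (hg : G.Bdd g) :
    G.Bdd (fun a x => f a x - g a x) := by
  obtain ⟨A, hA⟩ := hf
  obtain ⟨B, hB⟩ := hg
  exact ⟨A + B, fun a x hx => (abs_sub _ _).trans (add_le_add (hA a x hx) (hB a x hx))⟩

theorem mem_of_P {a : ι} {p q : V n} {d : ℝ} (h : G.P a p q d) :
    p ∈ G.W a ∧ q ∈ G.W a ∧ 0 ≤ d := by
  obtain ⟨L, -, hL⟩ := G.lip
  obtain ⟨h1, h2, -⟩ := hL a p q d h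
  exact ⟨h2 (left_mem_segment ℝ p q), h2 (right_mem_segment ℝ p q), h1⟩

theorem Reg0.exists_hol {f : ι → V n → ℝ} (h : G.Reg0 f) :
    ∃ C, 0 ≤ C ∧ ∀ a p q d, G.P a p q d → |f a p - f a q| ≤ C * d := by
  obtain ⟨C, hC⟩ := h.hol
  refine ⟨|C|, abs_nonneg _, fun a p q d hd => (hC a p q d hd).trans ?_⟩
  exact mul_le_mul_of_nonneg_right (le_abs_self _) (mem_of_P hd).2.2

theorem Reg0.congr {f g : ι → V n → ℝ} (hf : G.Reg0 f) (h : ∀ a, ∀ x ∈ G.W a, f a x = g a x) :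
    G.Reg0 g where
  cont a := (hf.cont a).congr fun x hx => (h a x hx).symm
  bdd := by
    obtain ⟨C, hC⟩ := hf.bdd
    exact ⟨C, fun a x hx => h a x hx ▸ hC a x hx⟩
  hol := by
    obtain ⟨C, hC⟩ := hf.hol
    refine ⟨C, fun a p q d hd => ?_⟩
    rw [← h a p (mem_of_P hd).1, ← h a q (mem_of_P hd).2.1]
    exact hC a p q d hd

theorem Reg0.add {f g : ι → V n → ℝ} (hf : G.Reg0 f) (hg : G.Reg0 g) :
    G.Reg0 (fun a x => f a x + g a x) where
  cont a := (hf.cont a).add (hg.cont a)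
  bdd := by
    obtain ⟨A, hA⟩ := hf.bdd
    obtain ⟨B, hB⟩ := hg.bdd
    exact ⟨A + B, fun a x hx => (abs_add_le _ _).trans (add_le_add (hA a x hx) (hB a x hx))⟩
  hol := by
    obtain ⟨A, hA⟩ := hf.hol
    obtain ⟨B, hB⟩ := hg.hol
    refine ⟨A + B, fun a p q d hd => ?_⟩
    have h1 := abs_add_le (f a p - f a q) (g a p - g a q)
    have h2 := hA a p q d hd
    have h3 := hB a p q d hd
    rw [show f a p + g a p - (f a q + g a q) = (f a p - f a q) + (g a p - g a q) by ring]
    linarith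

theorem Reg0.mul {f g : ι → V n → ℝ} (hf : G.Reg0 f) (hg : G.Reg0 g) :
    G.Reg0 (fun a x => f a x * g a x) where
  cont a := (hf.cont a).mul (hg.cont a)
  bdd := hf.bdd.mul hg.bdd
  hol := by
    obtain ⟨A, hA0, hA⟩ := hf.exists_hol
    obtain ⟨B, hB0, hB⟩ := hg.exists_hol
    obtain ⟨A', hA0', hA'⟩ := hf.bdd.exists_nonneg
    obtain ⟨B', hB0', hB'⟩ := hg.bdd.exists_nonneg
    refine ⟨A' * B + A * B', fun a p q d hd => ?_⟩
    obtain ⟨hp, hq, hd0⟩ := mem_of_P hd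
    rw [show f a p * g a p - f a q * g a q
      = f a p * (g a p - g a q) + (f a p - f a q) * g a q by ring]
    refine (abs_add_le _ _).trans ?_
    rw [abs_mul, abs_mul]
    have h1 := mul_le_mul (hA' a p hp) (hB a p q d hd) (abs_nonneg _) hA0'
    have h2 := mul_le_mul (hA a p q d hd) (hB' a q hq) (abs_nonneg _) (by positivity)
    linarith

theorem Reg0.inv {f : ι → V n → ℝ} (hf : G.Reg0 f) {c : ℝ} (hc : 0 < c)
    (h : ∀ a, ∀ x ∈ G.W a, c ≤ |f a x|) : G.Reg0 (fun a x => (f a x)⁻¹) where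
  cont a := (hf.cont a).inv₀ fun x hx => abs_pos.1 (hc.trans_le (h a x hx))
  bdd := by
    refine ⟨c⁻¹, fun a x hx => ?_⟩
    rw [abs_inv]
    exact inv_anti₀ hc (h a x hx)
  hol := by
    obtain ⟨A, hA0, hA⟩ := hf.exists_hol
    refine ⟨A * (c⁻¹ * c⁻¹), fun a p q d hd => ?_⟩
    obtain ⟨hp, hq, hd0⟩ := mem_of_P hd
    have hp0 : f a p ≠ 0 := abs_pos.1 (hc.trans_le (h a p hp))
    have hq0 : f a q ≠ 0 := abs_pos.1 (hc.trans_le (h a q hq))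
    rw [show (f a p)⁻¹ - (f a q)⁻¹ = -(f a p - f a q) * ((f a p)⁻¹ * (f a q)⁻¹) by
      field_simp; ring]
    rw [abs_mul, abs_neg, abs_mul, abs_inv, abs_inv]
    have h1 := inv_anti₀ hc (h a p hp)
    have h2 := inv_anti₀ hc (h a q hq)
    have h3 : |f a p|⁻¹ * |f a q|⁻¹ ≤ c⁻¹ * c⁻¹ :=
      mul_le_mul h1 h2 (by positivity) (by positivity)
    have := mul_le_mul (hA a p q d hd) h3 (by positivity) (by positivity)
    linarith

/-- A bounded family with bounded weighted first derivatives satisfies `Reg0`. -/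
theorem reg0_of_bdd {f : ι → V n → ℝ} (hf : ∀ a, DifferentiableOn ℝ (f a) (G.W a))
    (hb : G.Bdd f) (hd : ∀ i, G.Bdd (fun a x => G.r x * pd i (f a) x)) : G.Reg0 f where
  cont a := (hf a).continuousOn
  bdd := hb
  hol := by
    obtain ⟨L, hL0, hL⟩ := G.lip
    choose C hC0 hC using fun i => (hd i).exists_nonneg
    set B := ∑ i, C i
    have hB : ∀ i, C i ≤ B := fun i =>
      Finset.single_le_sum (fun j _ => hC0 j) (Finset.mem_univ i)
    have hB0 : 0 ≤ B := Finset.sum_nonneg fun j _ => hC0 j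
    refine ⟨(n + 1) * B * L, fun a p q d hP => ?_⟩
    obtain ⟨hd0, hseg, hz⟩ := hL a p q d hP
    rcases eq_or_ne p q with rfl | hpq
    · simp only [sub_self, abs_zero]; positivity
    have hdist : 0 < dist p q := dist_pos.2 hpq
    -- The weighted bound gives `‖df‖ ≤ (n + 1) B / r z`, and `lip` bounds `1 / r z` by `L d / dist
    -- p q`. The mean value inequality then cancels `dist p q`.
    have key : ∀ z ∈ segment ℝ p q, ‖fderiv ℝ (f a) z‖ ≤ (n + 1) * B * L * d / dist p q := by
      intro z hzs
      have hrz : 0 < G.r z := G.r_pos a z (hseg hzs)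
      have h1 : ‖fderiv ℝ (f a) z‖ ≤ (n + 1) * (B / G.r z) := by
        refine norm_clm_le fun i => ?_
        rw [le_div_iff₀ hrz]
        have := (hC i a z (hseg hzs)).trans (hB i)
        rw [abs_mul, abs_of_pos hrz] at this
        simp only [pd] at this
        linarith
      refine h1.trans ?_
      rw [le_div_iff₀ hdist, mul_div_assoc', div_mul_eq_mul_div, div_le_iff₀ hrz]
      have := mul_le_mul_of_nonneg_left (hz z hzs) (show 0 ≤ (n + 1) * B by positivity)
      linarith
    have := (convex_segment p q).norm_image_sub_le_of_norm_hasFDerivWithin_le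
      (fun z hz => ((hf a z (hseg hz)).differentiableAt
        ((G.isOpen a).mem_nhds (hseg hz))).hasFDerivAt.hasFDerivWithinAt) key
      (right_mem_segment ℝ p q) (left_mem_segment ℝ p q)
    rw [← dist_eq_norm p q, div_mul_cancel₀ _ hdist.ne'] at this
    simpa using this

theorem Reg.reg0 {m : ℕ} {f : ι → V n → ℝ} (h : G.Reg m f) : G.Reg0 f := by
  cases m with
  | zero => exact h
  | succ m => exact h.1

theorem Reg.bdd {m : ℕ} {f : ι → V n → ℝ} (h : G.Reg m f) : G.Bdd f := h.reg0.bdd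

theorem Reg.diff {m : ℕ} {f : ι → V n → ℝ} (h : G.Reg (m + 1) f) (a : ι) {x : V n}
    (hx : x ∈ G.W a) : DifferentiableAt ℝ (f a) x :=
  (h.2.1 a).differentiableAt ((G.isOpen a).mem_nhds hx)

theorem Reg.of_succ {m : ℕ} {f : ι → V n → ℝ} (h : G.Reg (m + 1) f) : G.Reg m f := by
  induction m generalizing f with
  | zero => exact h.1
  | succ m ih => exact ⟨h.1, h.2.1, fun i => ih (h.2.2 i)⟩

theorem Reg.mono {m l : ℕ} {f : ι → V n → ℝ} (h : G.Reg m f) (hl : l ≤ m) : G.Reg l f := by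
  induction hl with
  | refl => exact h
  | step _ ih => exact ih h.of_succ

theorem Reg.congr {m : ℕ} {f g : ι → V n → ℝ} (hf : G.Reg m f)
    (h : ∀ a, ∀ x ∈ G.W a, f a x = g a x) : G.Reg m g := by
  induction m generalizing f g with
  | zero => exact Reg0.congr hf h
  | succ m ih =>
    refine ⟨hf.1.congr h, fun a => (hf.2.1 a).congr fun x hx => (h a x hx).symm, fun i => ?_⟩
    refine ih (hf.2.2 i) fun a x hx => ?_
    rw [pd_congr (G.isOpen a) (h a) i x hx]

/-- The Hölder condition on `f` itself is automatic once the weighted first derivatives are bounded,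
so only the derivatives of top order carry Hölder information. -/
theorem reg_succ_of_bdd {m : ℕ} {f : ι → V n → ℝ} (hb : G.Bdd f)
    (hf : ∀ a, DifferentiableOn ℝ (f a) (G.W a))
    (h : ∀ i, G.Reg m (fun a x => G.r x * pd i (f a) x)) : G.Reg (m + 1) f :=
  ⟨reg0_of_bdd hf hb fun i => (h i).bdd, hf, h⟩

theorem reg_const_family {c : ι → ℝ} (hc : ∃ C, ∀ a, |c a| ≤ C) (m : ℕ) :
    G.Reg m (fun a _ => c a) := by
  induction m generalizing c with
  | zero =>
    obtain ⟨C, hC⟩ := hc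
    exact ⟨fun a => continuousOn_const, ⟨C, fun a x _ => hC a⟩, ⟨0, fun a p q d _ => by simp⟩⟩
  | succ m ih =>
    refine ⟨(ih hc).reg0, fun a => differentiableOn_const _, fun i => ?_⟩
    simpa using ih (c := fun _ => 0) ⟨0, by simp⟩

theorem reg_const (c : ℝ) (m : ℕ) : G.Reg m (fun _ _ => c) :=
  reg_const_family ⟨|c|, fun _ => le_rfl⟩ m

theorem Reg.add {m : ℕ} {f g : ι → V n → ℝ} (hf : G.Reg m f) (hg : G.Reg m g) :
    G.Reg m (fun a x => f a x + g a x) := by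
  induction m generalizing f g with
  | zero => exact Reg0.add hf hg
  | succ m ih =>
    refine ⟨hf.1.add hg.1, fun a => (hf.2.1 a).add (hg.2.1 a), fun i => ?_⟩
    refine (ih (hf.2.2 i) (hg.2.2 i)).congr fun a x hx => ?_
    rw [pd_add (hf.diff a hx) (hg.diff a hx)]
    ring

theorem Reg.mul {m : ℕ} {f g : ι → V n → ℝ} (hf : G.Reg m f) (hg : G.Reg m g) :
    G.Reg m (fun a x => f a x * g a x) := by
  induction m generalizing f g with
  | zero => exact Reg0.mul hf hg
  | succ m ih =>
    refine ⟨hf.1.mul hg.1, fun a => (hf.2.1 a).mul (hg.2.1 a), fun i => ?_⟩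
    refine ((ih hf.of_succ (hg.2.2 i)).add (ih hg.of_succ (hf.2.2 i))).congr fun a x hx => ?_
    rw [pd_mul (hf.diff a hx) (hg.diff a hx)]
    ring

theorem Reg.const_mul {m : ℕ} {f : ι → V n → ℝ} (hf : G.Reg m f) (c : ℝ) :
    G.Reg m (fun a x => c * f a x) := (reg_const c m).mul hf

theorem Reg.neg {m : ℕ} {f : ι → V n → ℝ} (hf : G.Reg m f) : G.Reg m (fun a x => -f a x) :=
  (hf.const_mul (-1)).congr fun a x _ => by ring

theorem Reg.sub {m : ℕ} {f g : ι → V n → ℝ} (hf : G.Reg m f) (hg : G.Reg m g) :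
    G.Reg m (fun a x => f a x - g a x) :=
  (hf.add hg.neg).congr fun a x _ => by ring

theorem Reg.sum {m : ℕ} {κ : Type*} {s : Finset κ} {f : κ → ι → V n → ℝ}
    (hf : ∀ j ∈ s, G.Reg m (f j)) : G.Reg m (fun a x => ∑ j ∈ s, f j a x) := by
  classical
  induction s using Finset.induction_on with
  | empty => simpa using reg_const 0 m
  | insert j s hj ih =>
    refine ((hf j (Finset.mem_insert_self j s)).add
      (ih fun l hl => hf l (Finset.mem_insert_of_mem hl))).congr fun a x _ => ?_
    rw [Finset.sum_insert hj]

theorem Reg.inv {m : ℕ} {f : ι → V n → ℝ} (hf : G.Reg m f) {c : ℝ} (hc : 0 < c)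
    (h : ∀ a, ∀ x ∈ G.W a, c ≤ |f a x|) : G.Reg m (fun a x => (f a x)⁻¹) := by
  have h0 : ∀ a, ∀ x ∈ G.W a, f a x ≠ 0 := fun a x hx => abs_pos.1 (hc.trans_le (h a x hx))
  induction m with
  | zero => exact Reg0.inv hf hc h
  | succ m ih =>
    refine ⟨hf.1.inv hc h, fun a => (hf.2.1 a).inv (h0 a), fun i => ?_⟩
    -- The derivative of `1/f` is `-(1/f)² ∂f`, which involves the inverse of the same `f` to one
    -- order less.
    have h1 := ih hf.of_succ
    refine ((h1.mul h1).mul (hf.2.2 i)).neg.congr fun a x hx => ?_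
    rw [pd_inv (hf.diff a hx) (h0 a x hx)]
    ring

/-- Functions that are smooth on the domain of the gauge, boundary points included, are regular of
every order. -/
theorem reg_of_contDiffOn {h : V n → ℝ} (hh : ContDiffOn ℝ ∞ h G.D) (m : ℕ) :
    G.Reg m (fun _ => h) := by
  have hbd : ∀ {u : V n → ℝ}, ContDiffOn ℝ ∞ u G.D → G.Bdd (fun _ => u) := by
    intro u hu
    obtain ⟨C, hC⟩ := G.compact.exists_bound_of_continuousOn (hu.continuousOn.mono G.K_sub)
    exact ⟨C, fun a x hx => hC x (G.W_sub a hx)⟩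
  have hnhds : ∀ a, ∀ x ∈ G.W a, G.D ∈ 𝓝 x := fun a x hx =>
    mem_of_superset ((G.isOpen a).mem_nhds hx) ((G.W_sub a).trans G.K_sub)
  -- The derivative within `D` is smooth on `D`, boundary points included, and agrees with the
  -- ordinary derivative on the open sets `W a`. Smoothness thus persists under `r ∂_i`, and
  -- compactness of `K` gives the bounds.
  have hder : ∀ {u : V n → ℝ}, ContDiffOn ℝ ∞ u G.D → ∀ i, ∃ v, ContDiffOn ℝ ∞ v G.D ∧
      ∀ a, ∀ x ∈ G.W a, v x = G.r x * pd i u x := by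
    intro u hu i
    refine ⟨fun x => G.r x * fderivWithin ℝ u G.D x (coordVec n i), ?_, fun a x hx => ?_⟩
    · exact G.r_smooth.mul ((hu.fderivWithin G.uniq (m := ∞) (by simp)).clm_apply contDiffOn_const)
    · simp only [fderivWithin_of_mem_nhds (hnhds a x hx), pd]
  have hdiff : ∀ {u : V n → ℝ}, ContDiffOn ℝ ∞ u G.D → ∀ a, DifferentiableOn ℝ u (G.W a) :=
    fun hu a => (hu.differentiableOn (by simp)).mono ((G.W_sub a).trans G.K_sub)
  induction m generalizing h with
  | zero =>
    refine reg0_of_bdd (hdiff hh) (hbd hh) fun i => ?_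
    obtain ⟨v, hv, hv'⟩ := hder hh i
    obtain ⟨C, hC⟩ := hbd hv
    exact ⟨C, fun a x hx => (congrArg abs (hv' a x hx)).ge.trans (hC a x hx)⟩
  | succ m ih =>
    refine reg_succ_of_bdd (hbd hh) (hdiff hh) fun i => ?_
    obtain ⟨v, hv, hv'⟩ := hder hh i
    exact (ih hv).congr hv'

theorem reg_r (m : ℕ) : G.Reg m (fun _ => G.r) := reg_of_contDiffOn G.r_smooth m

/-- No weight is needed on the derivative, because it is the restriction of a function smooth on all
of `D`. -/
theorem reg_pd_of_contDiffOn {h : V n → ℝ} (hh : ContDiffOn ℝ ∞ h G.D) (i : Fin (n + 1)) (m : ℕ) :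
    G.Reg m (fun _ => pd i h) := by
  have : ContDiffOn ℝ ∞ (fun x => fderivWithin ℝ h G.D x (coordVec n i)) G.D :=
    (hh.fderivWithin G.uniq (m := ∞) (by simp)).clm_apply contDiffOn_const
  refine (reg_of_contDiffOn this m).congr fun a x hx => ?_
  rw [fderivWithin_of_mem_nhds, pd]
  exact mem_of_superset ((G.isOpen a).mem_nhds hx) ((G.W_sub a).trans G.K_sub)

theorem reg_pd_r (i : Fin (n + 1)) (m : ℕ) : G.Reg m (fun _ => pd i G.r) :=
  reg_pd_of_contDiffOn G.r_smooth i m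

/-! ### Families with one derivative free of weight -/

variable (G) in
/-- Regularity of order `m` of the first derivatives, without a weight. -/
structure CReg (m : ℕ) (f : ι → V n → ℝ) : Prop where
  bdd : G.Bdd f
  diff : ∀ a, DifferentiableOn ℝ (f a) (G.W a)
  pd : ∀ i, G.Reg m (fun a => pd i (f a))

theorem CReg.reg {m : ℕ} {f : ι → V n → ℝ} (h : G.CReg m f) : G.Reg (m + 1) f :=
  reg_succ_of_bdd h.bdd h.diff fun i => (reg_r m).mul (h.pd i)

theorem CReg.diffAt {m : ℕ} {f : ι → V n → ℝ} (h : G.CReg m f) (a : ι) {x : V n}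
    (hx : x ∈ G.W a) : DifferentiableAt ℝ (f a) x :=
  (h.diff a).differentiableAt ((G.isOpen a).mem_nhds hx)

theorem CReg.congr {m : ℕ} {f g : ι → V n → ℝ} (hf : G.CReg m f)
    (h : ∀ a, ∀ x ∈ G.W a, f a x = g a x) : G.CReg m g where
  bdd := (hf.reg.congr h).bdd
  diff := (hf.reg.congr h).2.1
  pd i := (hf.pd i).congr fun a => pd_congr (G.isOpen a) (h a) i

theorem creg_of_contDiffOn {h : V n → ℝ} (hh : ContDiffOn ℝ ∞ h G.D) (m : ℕ) :
    G.CReg m (fun _ => h) where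
  bdd := (reg_of_contDiffOn hh 0).bdd
  diff := (reg_of_contDiffOn hh 1).2.1
  pd i := reg_pd_of_contDiffOn hh i m

theorem creg_const (c : ℝ) (m : ℕ) : G.CReg m (fun _ _ => c) :=
  creg_of_contDiffOn contDiffOn_const m

theorem creg_pd_of_contDiffOn {h : V n → ℝ} (hh : ContDiffOn ℝ ∞ h G.D) (i : Fin (n + 1))
    (m : ℕ) : G.CReg m (fun _ => WAH.pd i h) := by
  have : ContDiffOn ℝ ∞ (fun x => fderivWithin ℝ h G.D x (coordVec n i)) G.D :=
    (hh.fderivWithin G.uniq (m := ∞) (by simp)).clm_apply contDiffOn_const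
  refine (creg_of_contDiffOn this m).congr fun a x hx => ?_
  rw [fderivWithin_of_mem_nhds, WAH.pd]
  exact mem_of_superset ((G.isOpen a).mem_nhds hx) ((G.W_sub a).trans G.K_sub)

theorem creg_pd_r (i : Fin (n + 1)) (m : ℕ) : G.CReg m (fun _ => WAH.pd i G.r) :=
  creg_pd_of_contDiffOn G.r_smooth i m

theorem CReg.add {m : ℕ} {f g : ι → V n → ℝ} (hf : G.CReg m f) (hg : G.CReg m g) :
    G.CReg m (fun a x => f a x + g a x) where
  bdd := (hf.reg.add hg.reg).bdd
  diff := (hf.reg.add hg.reg).2.1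
  pd i := ((hf.pd i).add (hg.pd i)).congr fun a _ hx =>
    (pd_add (hf.diffAt a hx) (hg.diffAt a hx) i).symm

theorem CReg.mul {m : ℕ} {f g : ι → V n → ℝ} (hf : G.CReg m f) (hg : G.CReg m g) :
    G.CReg m (fun a x => f a x * g a x) where
  bdd := (hf.reg.mul hg.reg).bdd
  diff := (hf.reg.mul hg.reg).2.1
  pd i := ((hf.reg.of_succ.mul (hg.pd i)).add (hg.reg.of_succ.mul (hf.pd i))).congr
    fun a _ hx => (pd_mul (hf.diffAt a hx) (hg.diffAt a hx) i).symm

theorem CReg.const_mul {m : ℕ} {f : ι → V n → ℝ} (hf : G.CReg m f) (c : ℝ) :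
    G.CReg m (fun a x => c * f a x) := (creg_const c m).mul hf

theorem CReg.sub {m : ℕ} {f g : ι → V n → ℝ} (hf : G.CReg m f) (hg : G.CReg m g) :
    G.CReg m (fun a x => f a x - g a x) :=
  (hf.add (hg.const_mul (-1))).congr fun a x _ => by ring

theorem CReg.sum {m : ℕ} {κ : Type*} {s : Finset κ} {f : κ → ι → V n → ℝ}
    (hf : ∀ j ∈ s, G.CReg m (f j)) : G.CReg m (fun a x => ∑ j ∈ s, f j a x) := by
  classical
  induction s using Finset.induction_on with
  | empty => simpa using creg_const 0 m
  | insert j s hj ih =>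
    refine ((hf j (Finset.mem_insert_self j s)).add
      (ih fun l hl => hf l (Finset.mem_insert_of_mem hl))).congr fun a x _ => ?_
    rw [Finset.sum_insert hj]

theorem CReg.prod {m : ℕ} {κ : Type*} {s : Finset κ} {f : κ → ι → V n → ℝ}
    (hf : ∀ j ∈ s, G.CReg m (f j)) : G.CReg m (fun a x => ∏ j ∈ s, f j a x) := by
  classical
  induction s using Finset.induction_on with
  | empty => simpa using creg_const 1 m
  | insert j s hj ih =>
    refine ((hf j (Finset.mem_insert_self j s)).mul
      (ih fun l hl => hf l (Finset.mem_insert_of_mem hl))).congr fun a x _ => ?_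
    rw [Finset.prod_insert hj]

theorem CReg.inv {m : ℕ} {f : ι → V n → ℝ} (hf : G.CReg m f) {c : ℝ} (hc : 0 < c)
    (h : ∀ a, ∀ x ∈ G.W a, c ≤ |f a x|) : G.CReg m (fun a x => (f a x)⁻¹) where
  bdd := (hf.reg.inv hc h).bdd
  diff := (hf.reg.inv hc h).2.1
  pd i := by
    have h1 := hf.reg.of_succ.inv hc h
    refine ((h1.mul h1).mul (hf.pd i)).neg.congr fun a x hx => ?_
    exact (pd_inv (hf.diffAt a hx) (abs_pos.1 (hc.trans_le (h a x hx))) i).symm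

/-- The determinant of a matrix with regular entries. -/
theorem CReg.det {m N : ℕ} {A : ι → V n → Matrix (Fin N) (Fin N) ℝ}
    (hA : ∀ i j, G.CReg m (fun a x => A a x i j)) : G.CReg m (fun a x => (A a x).det) := by
  refine (CReg.sum (s := Finset.univ) (f := fun (σ : Equiv.Perm (Fin N)) a x =>
    ((Equiv.Perm.sign σ : ℤ) : ℝ) * ∏ i, A a x (σ i) i) fun σ _ =>
      (CReg.prod fun i _ => hA (σ i) i).const_mul _).congr fun a x _ => ?_
  rw [Matrix.det_apply']

/-- The entries of the inverse of a matrix with regular entries, if the determinant is bounded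
below. -/
theorem CReg.matrix_inv {m N : ℕ} {A : ι → V n → Matrix (Fin N) (Fin N) ℝ}
    (hA : ∀ i j, G.CReg m (fun a x => A a x i j)) {c : ℝ} (hc : 0 < c)
    (h : ∀ a, ∀ x ∈ G.W a, c ≤ |(A a x).det|) (i j : Fin N) :
    G.CReg m (fun a x => (A a x)⁻¹ i j) := by
  have h1 : G.CReg m (fun a x => (A a x).adjugate i j) := by
    -- Cramer's rule: an entry of the adjugate is the determinant of the matrix with row `j`
    -- replaced by a coordinate vector, so its entries are regular or constant.
    simp only [Matrix.adjugate_apply]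
    refine CReg.det fun k l => ?_
    by_cases hk : k = j
    · subst hk
      simpa using creg_const _ m
    · simpa [Matrix.updateRow_ne hk] using hA k l
  refine (((CReg.det hA).inv hc h).mul h1).congr fun a x _ => ?_
  rw [Matrix.inv_def, Ring.inverse_eq_inv', Matrix.smul_apply, smul_eq_mul]

/-- Division by the weight of a family that is `O(r)`. -/
theorem CReg.div_r {m : ℕ} {f : ι → V n → ℝ} (hf : G.CReg m f)
    (hO : ∃ C, ∀ a, ∀ x ∈ G.W a, |f a x| ≤ C * G.r x) :
    G.Reg (m + 1) (fun a x => (G.r x)⁻¹ * f a x) := by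
  obtain ⟨C, hC⟩ := hO
  have hr : ∀ a, ∀ x ∈ G.W a, G.r x ≠ 0 := fun a x hx => (G.r_pos a x hx).ne'
  have hrd : ∀ a, ∀ x ∈ G.W a, DifferentiableAt ℝ G.r x := fun a x hx =>
    (reg_r (G := G) 1).diff a hx
  have hb : G.Bdd (fun a x => (G.r x)⁻¹ * f a x) := by
    refine ⟨C, fun a x hx => ?_⟩
    have h0 := G.r_pos a x hx
    rw [abs_mul, abs_inv, abs_of_pos h0, inv_mul_le_iff₀ h0, mul_comm]
    exact hC a x hx
  have hd : ∀ a, DifferentiableOn ℝ (fun x => (G.r x)⁻¹ * f a x) (G.W a) := fun a x hx =>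
    (((hrd a x hx).inv (hr a x hx)).mul (hf.diffAt a hx)).differentiableWithinAt
  -- The weighted derivative of the quotient contains the quotient only undifferentiated, multiplied
  -- by a smooth function.
  have hp : ∀ i a, ∀ x ∈ G.W a, WAH.pd i (f a) x - WAH.pd i G.r x * ((G.r x)⁻¹ * f a x)
      = G.r x * WAH.pd i (fun x => (G.r x)⁻¹ * f a x) x := by
    intro i a x hx
    rw [pd_mul (f := fun x => (G.r x)⁻¹) ((hrd a x hx).inv (hr a x hx)) (hf.diffAt a hx),
      pd_inv (hrd a x hx) (hr a x hx)]
    have := hr a x hx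
    field_simp
    ring
  -- By the identity `hp`, order `l` of the quotient yields order `l + 1` as long as `∂f` has order
  -- `l`, that is, up to order `m + 1`.
  have main : ∀ l ≤ m + 1, G.Reg l (fun a x => (G.r x)⁻¹ * f a x) := by
    intro l
    induction l with
    | zero =>
      intro _
      refine reg0_of_bdd hd hb fun i => ?_
      obtain ⟨B, hB⟩ := ((hf.pd i).bdd).sub ((reg_pd_r (G := G) i 0).bdd.mul hb)
      exact ⟨B, fun a x hx => (congrArg abs (hp i a x hx)).ge.trans (hB a x hx)⟩
    | succ l ih =>
      intro hl
      refine reg_succ_of_bdd hb hd fun i => ?_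
      exact (((hf.pd i).mono (by omega)).sub ((reg_pd_r i l).mul (ih (by omega)))).congr (hp i)
  exact main _ le_rfl

end Gauge

/-! ### The curvature of a conformally rescaled metric -/

/-! ### Pointwise algebra of a conformal change -/

section Algebra

variable {n : ℕ}

theorem sum_kron_mul (k : Fin (n + 1)) (f : Fin (n + 1) → ℝ) : ∑ a, kron k a * f a = f k := by
  simp [kron]

theorem sum_kron_mul' (k : Fin (n + 1)) (f : Fin (n + 1) → ℝ) : ∑ a, kron a k * f a = f k := by
  simp [kron]

theorem kron_comm (i j : Fin (n + 1)) : kron i j = kron j i := by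
  simp [kron, eq_comm]

/-- The tensor `P^c_{ab} = δ^c_a v_b + δ^c_b v_a - h_{ab} v^c` by which the Christoffel symbols of
conformal metrics differ. -/
def confTensor (h H : Fin (n + 1) → Fin (n + 1) → ℝ) (v : Fin (n + 1) → ℝ)
    (c a b : Fin (n + 1)) : ℝ :=
  kron c a * v b + kron c b * v a - h a b * ∑ d, H c d * v d

variable {h H : Fin (n + 1) → Fin (n + 1) → ℝ} {v : Fin (n + 1) → ℝ}

theorem sum_mul_raise (hH : ∀ i j, ∑ d, h i d * H d j = kron i j)
    (i : Fin (n + 1)) : ∑ a, h i a * ∑ d, H a d * v d = v i := by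
  have : ∀ a, h i a * ∑ d, H a d * v d = ∑ d, h i a * H a d * v d := fun a => by
    rw [Finset.mul_sum]; exact Finset.sum_congr rfl fun d _ => by ring
  simp_rw [this]
  rw [Finset.sum_comm]
  simp_rw [← Finset.sum_mul, hH, sum_kron_mul]

/-- This bracket is the coefficient of `r⁻²` in the curvature of a connection `Γ̄ - r⁻¹ P` with `v =
dr`: differentiating `r⁻¹` gives the terms `v P`, and the quadratic part of the curvature gives the
terms `P P`. Antisymmetry in `i` and `j` cancels everything except the multiples of `|v|²`. -/
theorem confTensor_bracket (hs : ∀ i j, h i j = h j i)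
    (hH : ∀ i j, ∑ d, h i d * H d j = kron i j) (i j m k : Fin (n + 1)) :
    v i * confTensor h H v k j m - v j * confTensor h H v k i m
      + ∑ a, (confTensor h H v k i a * confTensor h H v a j m
        - confTensor h H v k j a * confTensor h H v a i m)
    = -(∑ i, ∑ j, H i j * v i * v j) * (kron k i * h j m - kron k j * h i m) := by
  set w : Fin (n + 1) → ℝ := fun c => ∑ d, H c d * v d with hw
  set N := ∑ i, ∑ j, H i j * v i * v j with hN
  have hP : ∀ c a b, confTensor h H v c a b = kron c a * v b + kron c b * v a - h a b * w c :=
    fun _ _ _ => rfl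
  have hvw : ∑ a, v a * w a = N := by
    simp only [hw, hN, Finset.mul_sum]
    exact Finset.sum_congr rfl fun a _ => Finset.sum_congr rfl fun d _ => by ring
  have s1 : ∀ j m, ∑ a, v a * confTensor h H v a j m = 2 * v j * v m - h j m * N := by
    intro j m
    have : ∀ a, v a * confTensor h H v a j m
        = kron a j * (v a * v m) + kron a m * (v a * v j) - h j m * (v a * w a) := fun a => by
      rw [hP]; ring
    simp_rw [this, Finset.sum_sub_distrib, Finset.sum_add_distrib, ← Finset.mul_sum, hvw]
    rw [sum_kron_mul' j (fun a => v a * v m), sum_kron_mul' m (fun a => v a * v j)]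
    ring
  have s2 : ∀ i j m, ∑ a, h i a * confTensor h H v a j m
      = h i j * v m + h i m * v j - h j m * v i := by
    intro i j m
    have : ∀ a, h i a * confTensor h H v a j m
        = kron a j * (h i a * v m) + kron a m * (h i a * v j) - h j m * (h i a * w a) := fun a => by
      rw [hP]; ring
    simp_rw [this, Finset.sum_sub_distrib, Finset.sum_add_distrib, ← Finset.mul_sum]
    rw [sum_kron_mul' j (fun a => h i a * v m), sum_kron_mul' m (fun a => h i a * v j),
      sum_mul_raise hH]
  -- Only the first factor is expanded, which reduces the product to the contractions `s1` and `s2`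
  -- and a single copy of the tensor.
  have s3 : ∀ i j m, ∑ a, confTensor h H v k i a * confTensor h H v a j m
      = kron k i * (2 * v j * v m - h j m * N) + v i * confTensor h H v k j m
        - w k * (h i j * v m + h i m * v j - h j m * v i) := by
    intro i j m
    have : ∀ a, confTensor h H v k i a * confTensor h H v a j m
        = kron k i * (v a * confTensor h H v a j m)
          + kron k a * (v i * confTensor h H v a j m)
          - w k * (h i a * confTensor h H v a j m) := fun a => by
      rw [hP k i a]; ring
    simp_rw [this, Finset.sum_sub_distrib, Finset.sum_add_distrib, ← Finset.mul_sum]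
    rw [s1, s2, sum_kron_mul k (fun a => v i * confTensor h H v a j m)]
  rw [Finset.sum_sub_distrib, s3, s3, hP, hP, hs j i]
  ring

/-- Raising the index `m` turns `h` into Kronecker deltas: the leading part of the curvature
operator is `-|v|²` times the identity of `Λ²`. -/
theorem contract_bracket (hs : ∀ i j, h i j = h j i) (hH' : ∀ i j, ∑ d, H i d * h d j = kron i j)
    (hH : ∀ i j, ∑ d, h i d * H d j = kron i j) (i j l k : Fin (n + 1)) :
    ∑ m, H l m * (v i * confTensor h H v k j m - v j * confTensor h H v k i m
      + ∑ a, (confTensor h H v k i a * confTensor h H v a j m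
        - confTensor h H v k j a * confTensor h H v a i m))
    = -(∑ i, ∑ j, H i j * v i * v j) * (kron i k * kron j l - kron i l * kron j k) := by
  simp_rw [confTensor_bracket hs hH]
  set N := ∑ i, ∑ j, H i j * v i * v j
  have : ∀ m, H l m * (-N * (kron k i * h j m - kron k j * h i m))
      = -N * kron k i * (H l m * h m j) + N * kron k j * (H l m * h m i) := fun m => by
    rw [hs j m, hs i m]; ring
  simp_rw [this, Finset.sum_add_distrib, ← Finset.mul_sum, hH']
  rw [kron_comm k i, kron_comm k j, kron_comm l j, kron_comm l i]
  ring

end Algebra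

/-! ### Christoffel symbols and curvature of a metric and its rescaling -/

section Conformal

variable {n : ℕ} {Mbar : Type*} [TopologicalSpace Mbar] {ι : Type}

/-- The tensor field `ρ² T`. -/
def bar (ρ : Mbar → ℝ) (T : ChartTensor n Mbar 2 0) : ChartTensor n Mbar 2 0 :=
  fmul (fun p => ρ p ^ 2) T

/-- The metric `T`, in the chart `e`, is the quotient by `r²` of a nondegenerate metric whose
first derivatives have weighted regularity of order `m` for the gauge `G`. -/
structure Adapted (G : Gauge n ι) (e : Chart n Mbar) (ρ : Mbar → ℝ) (T : ChartTensor n Mbar 2 0)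
    (m : ℕ) : Prop where
  r_eq : ∀ a, ∀ x ∈ G.W a, G.r x = ρ (pt e x)
  symm : ∀ a, ∀ x ∈ G.W a, ∀ i j, T e x ![i, j] ![] = T e x ![j, i] ![]
  reg : ∀ i j, G.CReg m (fun _ x => bar ρ T e x ![i, j] ![])
  det : ∃ c, 0 < c ∧ ∀ a, ∀ x ∈ G.W a,
    c ≤ |(Matrix.of fun i j => bar ρ T e x ![i, j] ![]).det|

namespace Adapted

variable {G : Gauge n ι} {e : Chart n Mbar} {ρ : Mbar → ℝ} {T : ChartTensor n Mbar 2 0} {m : ℕ}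

theorem r_ne (_hT : Adapted G e ρ T m) {a : ι} {x : V n} (hx : x ∈ G.W a) : G.r x ≠ 0 :=
  (G.r_pos a x hx).ne'

theorem r_diff {a : ι} {x : V n} (hx : x ∈ G.W a) : DifferentiableAt ℝ G.r x :=
  (Gauge.reg_r (G := G) 1).diff a hx

theorem creg_inv (hT : Adapted G e ρ T m) (i j : Fin (n + 1)) :
    G.CReg m (fun _ x => invMetric (bar ρ T) e x i j) := by
  obtain ⟨c, hc, h⟩ := hT.det
  exact Gauge.CReg.matrix_inv (A := fun _ x => Matrix.of fun i j => bar ρ T e x ![i, j] ![])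
    hT.reg hc h i j

theorem isUnit_det (hT : Adapted G e ρ T m) {a : ι} {x : V n} (hx : x ∈ G.W a) :
    IsUnit (Matrix.of fun i j => bar ρ T e x ![i, j] ![]).det := by
  obtain ⟨c, hc, h⟩ := hT.det
  exact isUnit_iff_ne_zero.2 (abs_pos.1 (hc.trans_le (h a x hx)))

theorem inv_mul (hT : Adapted G e ρ T m) {a : ι} {x : V n} (hx : x ∈ G.W a) (i j : Fin (n + 1)) :
    ∑ d, invMetric (bar ρ T) e x i d * bar ρ T e x ![d, j] ![] = kron i j := by
  have := congrFun (congrFun (Matrix.nonsing_inv_mul _ (hT.isUnit_det hx)) i) j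
  rwa [Matrix.mul_apply, Matrix.one_apply] at this

theorem mul_inv (hT : Adapted G e ρ T m) {a : ι} {x : V n} (hx : x ∈ G.W a) (i j : Fin (n + 1)) :
    ∑ d, bar ρ T e x ![i, d] ![] * invMetric (bar ρ T) e x d j = kron i j := by
  have := congrFun (congrFun (Matrix.mul_nonsing_inv _ (hT.isUnit_det hx)) i) j
  rwa [Matrix.mul_apply, Matrix.one_apply] at this

theorem bar_symm (hT : Adapted G e ρ T m) {a : ι} {x : V n} (hx : x ∈ G.W a)
    (i j : Fin (n + 1)) : bar ρ T e x ![i, j] ![] = bar ρ T e x ![j, i] ![] := by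
  simp only [bar, fmul, hT.symm a x hx i j]

theorem bar_eq (hT : Adapted G e ρ T m) {a : ι} {x : V n} (hx : x ∈ G.W a) (I J) :
    bar ρ T e x I J = G.r x ^ 2 * T e x I J := by
  simp only [bar, fmul, hT.r_eq a x hx]

theorem eq_bar (hT : Adapted G e ρ T m) {a : ι} {x : V n} (hx : x ∈ G.W a) (I J) :
    T e x I J = (G.r x)⁻¹ * (G.r x)⁻¹ * bar ρ T e x I J := by
  have := hT.r_ne hx
  rw [hT.bar_eq hx]
  field_simp

theorem invMetric_eq (hT : Adapted G e ρ T m) {a : ι} {x : V n} (hx : x ∈ G.W a)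
    (i j : Fin (n + 1)) :
    invMetric T e x i j = G.r x ^ 2 * invMetric (bar ρ T) e x i j := by
  have h0 := hT.r_ne hx
  have h1 : (Matrix.of fun i j => T e x ![i, j] ![])
      * (G.r x ^ 2 • (Matrix.of fun i j => bar ρ T e x ![i, j] ![])⁻¹) = 1 := by
    have : (Matrix.of fun i j => T e x ![i, j] ![])
        = (G.r x ^ 2)⁻¹ • (Matrix.of fun i j => bar ρ T e x ![i, j] ![]) := by
      ext i j
      simp only [Matrix.of_apply, Matrix.smul_apply, smul_eq_mul, hT.bar_eq hx]
      field_simp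
    rw [this, Matrix.smul_mul, Matrix.mul_smul, smul_smul, inv_mul_cancel₀ (pow_ne_zero 2 h0),
      one_smul, Matrix.mul_nonsing_inv _ (hT.isUnit_det hx)]
  rw [invMetric, Matrix.inv_eq_right_inv h1]
  rfl

/-- The tensor `P^c_{ab}` in the chart `e`. -/
def conf (G : Gauge n ι) (e : Chart n Mbar) (ρ : Mbar → ℝ) (T : ChartTensor n Mbar 2 0) (x : V n)
    (c a b : Fin (n + 1)) : ℝ :=
  confTensor (fun i j => bar ρ T e x ![i, j] ![]) (invMetric (bar ρ T) e x)
    (fun i => pd i G.r x) c a b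

/-- The tensor is built from `ḡ`, its inverse and the smooth `dr`, without derivatives of `ḡ`, so
its own first derivatives need no weight. The curvature requires this, since `∂P` enters `curvReg`
without a factor `r`. -/
theorem creg_conf (hT : Adapted G e ρ T m) (c a b : Fin (n + 1)) :
    G.CReg m (fun _ x => conf G e ρ T x c a b) := by
  unfold conf confTensor
  exact (((Gauge.creg_pd_r b m).const_mul _).add ((Gauge.creg_pd_r a m).const_mul _)).sub
    ((hT.reg a b).mul (Gauge.CReg.sum fun d _ => (hT.creg_inv c d).mul (Gauge.creg_pd_r d m)))

theorem reg_christoffel_bar (hT : Adapted G e ρ T m) (c a b : Fin (n + 1)) :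
    G.Reg m (fun _ x => christoffel (bar ρ T) e x c a b) := by
  unfold christoffel
  refine Gauge.Reg.const_mul (Gauge.Reg.sum fun d _ => (hT.creg_inv c d).reg.of_succ.mul ?_) _
  exact (((hT.reg b d).pd a).add ((hT.reg a d).pd b)).sub ((hT.reg a b).pd d)

theorem dMetric_eq (hT : Adapted G e ρ T m) {s : ι} {x : V n} (hx : x ∈ G.W s)
    (a b c : Fin (n + 1)) :
    G.r x ^ 2 * dMetric T e x a b c = dMetric (bar ρ T) e x a b c
      - 2 * ((G.r x)⁻¹ * pd a G.r x * bar ρ T e x ![b, c] ![]) := by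
  have h0 := hT.r_ne hx
  have hd := r_diff hx
  have h1 : dMetric T e x a b c
      = pd a (fun y => ((G.r y)⁻¹ * (G.r y)⁻¹) * bar ρ T e y ![b, c] ![]) x :=
    pd_congr (G.isOpen s) (fun y hy => hT.eq_bar hy _ _) a x hx
  have hi : DifferentiableAt ℝ (fun y => (G.r y)⁻¹) x := hd.inv h0
  have h2 : dMetric (bar ρ T) e x a b c = pd a (fun y => bar ρ T e y ![b, c] ![]) x := rfl
  rw [h1, h2, pd_mul (f := fun y => (G.r y)⁻¹ * (G.r y)⁻¹) (hi.mul hi) ((hT.reg b c).diffAt s hx),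
    pd_mul hi hi, pd_inv hd h0]
  field_simp
  ring

theorem christoffel_eq (hT : Adapted G e ρ T m) {s : ι} {x : V n} (hx : x ∈ G.W s)
    (c a b : Fin (n + 1)) :
    christoffel T e x c a b
      = christoffel (bar ρ T) e x c a b - (G.r x)⁻¹ * conf G e ρ T x c a b := by
  have h0 := hT.r_ne hx
  have h1 : ∀ d, invMetric T e x c d * (dMetric T e x a b d + dMetric T e x b a d
      - dMetric T e x d a b)
      = invMetric (bar ρ T) e x c d * (dMetric (bar ρ T) e x a b d + dMetric (bar ρ T) e x b a d
        - dMetric (bar ρ T) e x d a b)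
      - 2 * (G.r x)⁻¹ * (pd a G.r x * (invMetric (bar ρ T) e x c d * bar ρ T e x ![d, b] ![])
        + pd b G.r x * (invMetric (bar ρ T) e x c d * bar ρ T e x ![d, a] ![])
        - bar ρ T e x ![a, b] ![] * (invMetric (bar ρ T) e x c d * pd d G.r x)) := by
    intro d
    rw [hT.invMetric_eq hx, hT.bar_symm hx d b, hT.bar_symm hx d a]
    calc _ = invMetric (bar ρ T) e x c d * (G.r x ^ 2 * dMetric T e x a b d
          + G.r x ^ 2 * dMetric T e x b a d - G.r x ^ 2 * dMetric T e x d a b) := by ring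
      _ = _ := by rw [hT.dMetric_eq hx, hT.dMetric_eq hx, hT.dMetric_eq hx]; ring
  unfold christoffel
  simp_rw [h1, Finset.sum_sub_distrib, ← Finset.mul_sum, Finset.sum_sub_distrib,
    Finset.sum_add_distrib, ← Finset.mul_sum, hT.inv_mul hx]
  simp only [conf, confTensor]
  ring

/-- The Christoffel symbols of the metric have a pole of first order only, so a covariant derivative
costs one factor `r`, like a partial derivative. -/
theorem reg_r_mul_christoffel (hT : Adapted G e ρ T m) (c a b : Fin (n + 1)) :
    G.Reg m (fun _ x => G.r x * christoffel T e x c a b) := by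
  refine (((Gauge.reg_r m).mul (hT.reg_christoffel_bar c a b)).sub
    (hT.creg_conf c a b).reg.of_succ).congr fun s x hx => ?_
  have h0 := hT.r_ne hx
  rw [hT.christoffel_eq hx]
  field_simp

/-- The regular part of the curvature. -/
def curvReg (G : Gauge n ι) (e : Chart n Mbar) (ρ : Mbar → ℝ) (T : ChartTensor n Mbar 2 0) (x : V n)
    (i j m k : Fin (n + 1)) : ℝ :=
  (G.r x * pd i (fun y => christoffel (bar ρ T) e y k j m) x
    - G.r x * pd j (fun y => christoffel (bar ρ T) e y k i m) x)
  + G.r x * (∑ a, (christoffel (bar ρ T) e x k i a * christoffel (bar ρ T) e x a j m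
      - christoffel (bar ρ T) e x k j a * christoffel (bar ρ T) e x a i m))
  - (pd i (fun y => conf G e ρ T y k j m) x - pd j (fun y => conf G e ρ T y k i m) x)
  - ∑ a, ((christoffel (bar ρ T) e x k i a * conf G e ρ T x a j m
      + conf G e ρ T x k i a * christoffel (bar ρ T) e x a j m)
      - (christoffel (bar ρ T) e x k j a * conf G e ρ T x a i m
      + conf G e ρ T x k j a * christoffel (bar ρ T) e x a i m))

/-- Second derivatives of `ḡ` occur only in `r ∂Γ̄`, which costs one order; all other terms have at
least order `m`. -/
theorem reg_curvReg (hT : Adapted G e ρ T (m + 1)) (i j l k : Fin (n + 1)) :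
    G.Reg m (fun _ x => curvReg G e ρ T x i j l k) := by
  have hC := fun c a b => (hT.reg_christoffel_bar c a b).of_succ
  have hP := fun c a b => (hT.creg_conf c a b).reg.of_succ.of_succ
  unfold curvReg
  refine (((((hT.reg_christoffel_bar k j l).2.2 i).sub ((hT.reg_christoffel_bar k i l).2.2 j)).add
    ((Gauge.reg_r m).mul (Gauge.Reg.sum fun a _ => ?_))).sub
    (((hT.creg_conf k j l).pd i).of_succ.sub ((hT.creg_conf k i l).pd j).of_succ)).sub
    (Gauge.Reg.sum fun a _ => ?_)
  · exact ((hC k i a).mul (hC a j l)).sub ((hC k j a).mul (hC a i l))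
  · exact (((hC k i a).mul (hP a j l)).add ((hP k i a).mul (hC a j l))).sub
      (((hC k j a).mul (hP a i l)).add ((hP k j a).mul (hC a i l)))

/-- Insert `Γ = Γ̄ - r⁻¹ P` and sort by powers of `r`: the terms in `r⁻²` form the bracket of
`confTensor_bracket`, and what is left has a pole of order at most one. -/
theorem curvComp_eq (hT : Adapted G e ρ T (m + 1)) {s : ι} {x : V n} (hx : x ∈ G.W s)
    (i j l k : Fin (n + 1)) :
    G.r x ^ 2 * curvComp T e x i j l k
      = (pd i G.r x * conf G e ρ T x k j l - pd j G.r x * conf G e ρ T x k i l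
        + ∑ a, (conf G e ρ T x k i a * conf G e ρ T x a j l
          - conf G e ρ T x k j a * conf G e ρ T x a i l))
        + G.r x * curvReg G e ρ T x i j l k := by
  have h0 := hT.r_ne hx
  have hd := r_diff hx
  have hi : DifferentiableAt ℝ (fun y => (G.r y)⁻¹) x := hd.inv h0
  have hpd : ∀ i c a b, G.r x ^ 2 * pd i (fun y => christoffel T e y c a b) x
      = G.r x ^ 2 * pd i (fun y => christoffel (bar ρ T) e y c a b) x
        + pd i G.r x * conf G e ρ T x c a b
        - G.r x * pd i (fun y => conf G e ρ T y c a b) x := by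
    intro i c a b
    have hP := (hT.creg_conf c a b).diffAt s hx
    rw [pd_congr (G.isOpen s) (fun y hy => hT.christoffel_eq hy c a b) i x hx,
      pd_sub (g := fun y => (G.r y)⁻¹ * conf G e ρ T y c a b)
        ((hT.reg_christoffel_bar c a b).diff s hx) (hi.mul hP), pd_mul hi hP, pd_inv hd h0]
    field_simp
    ring
  have hsum : ∀ a, G.r x ^ 2 * (christoffel T e x k i a * christoffel T e x a j l
        - christoffel T e x k j a * christoffel T e x a i l)
      = G.r x ^ 2 * (christoffel (bar ρ T) e x k i a * christoffel (bar ρ T) e x a j l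
      - christoffel (bar ρ T) e x k j a * christoffel (bar ρ T) e x a i l)
      - G.r x * ((christoffel (bar ρ T) e x k i a * conf G e ρ T x a j l
      + conf G e ρ T x k i a * christoffel (bar ρ T) e x a j l)
      - (christoffel (bar ρ T) e x k j a * conf G e ρ T x a i l
      + conf G e ρ T x k j a * christoffel (bar ρ T) e x a i l))
      + (conf G e ρ T x k i a * conf G e ρ T x a j l
          - conf G e ρ T x k j a * conf G e ρ T x a i l) := by
    intro a
    simp only [hT.christoffel_eq hx]
    field_simp
    ring
  have e1 : curvComp T e x i j l k = pd i (fun y => christoffel T e y k j l) x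
    - pd j (fun y => christoffel T e y k i l) x
    + ∑ a, (christoffel T e x k i a * christoffel T e x a j l
        - christoffel T e x k j a * christoffel T e x a i l) := rfl
  rw [e1, mul_add, mul_sub, Finset.mul_sum, hpd, hpd]
  simp_rw [hsum, Finset.sum_add_distrib, Finset.sum_sub_distrib (fun a => G.r x ^ 2 * _),
    ← Finset.mul_sum]
  unfold curvReg
  ring

theorem gradNormSq_eq (hT : Adapted G e ρ T m) {s : ι} {x : V n} (hx : x ∈ G.W s) (I J) :
    gradNormSq (bar ρ T) ρ e x I J
      = ∑ i, ∑ j, invMetric (bar ρ T) e x i j * pd i G.r x * pd j G.r x := by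
  have : ∀ i, pd i G.r x = pd i (fun y => ρ (pt e y)) x := fun i =>
    pd_congr (G.isOpen s) (hT.r_eq s) i x hx
  simp_rw [this]
  rfl

theorem creg_gradNormSq (hT : Adapted G e ρ T m) (I J) :
    G.CReg m (fun _ x => gradNormSq (bar ρ T) ρ e x I J) := by
  refine Gauge.CReg.congr (Gauge.CReg.sum fun i _ => Gauge.CReg.sum fun j _ =>
    ((hT.creg_inv i j).mul (Gauge.creg_pd_r i m)).mul (Gauge.creg_pd_r j m))
    fun s x hx => (hT.gradNormSq_eq hx I J).symm

/-- The regular part of the curvature operator. -/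
def riemReg (G : Gauge n ι) (e : Chart n Mbar) (ρ : Mbar → ℝ) (T : ChartTensor n Mbar 2 0) (x : V n)
    (I J : Fin 2 → Fin (n + 1)) : ℝ :=
  ∑ l, invMetric (bar ρ T) e x (J 1) l * curvReg G e ρ T x (I 0) (I 1) l (J 0)

theorem reg_riemReg (hT : Adapted G e ρ T (m + 1)) (I J) :
    G.Reg m (fun _ x => riemReg G e ρ T x I J) :=
  Gauge.Reg.sum fun l _ => (hT.creg_inv (J 1) l).reg.of_succ.of_succ.mul (hT.reg_curvReg _ _ _ _)

/-- The factor `r²` of the inverse metric absorbs the double pole of the curvature. Up to a regular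
term times `r`, the deviation from curvature `-1` is the deviation of `|dρ|²` from `1`. -/
theorem riem_add_id_eq (hT : Adapted G e ρ T (m + 1)) {s : ι} {x : V n} (hx : x ∈ G.W s) (I J) :
    (riem T + idTensor : ChartTensor n Mbar 2 2) e x I J
      = (1 - gradNormSq (bar ρ T) ρ e x ![] ![]) * idTensor e x I J
        + G.r x * riemReg G e ρ T x I J := by
  have h1 : riem T e x I J
      = ∑ l, invMetric (bar ρ T) e x (J 1) l * (G.r x ^ 2 * curvComp T e x (I 0) (I 1) l (J 0)) := by
    unfold riem
    refine Finset.sum_congr rfl fun l _ => ?_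
    rw [hT.invMetric_eq hx]
    ring
  have h2 := contract_bracket (h := fun i j => bar ρ T e x ![i, j] ![])
    (H := invMetric (bar ρ T) e x) (v := fun i => pd i G.r x) (hT.bar_symm hx) (hT.inv_mul hx)
    (hT.mul_inv hx) (I 0) (I 1) (J 1) (J 0)
  change riem T e x I J + idTensor e x I J = _
  rw [h1]
  simp_rw [hT.curvComp_eq hx, hT.gradNormSq_eq hx]
  have h3 : ∑ l, invMetric (bar ρ T) e x (J 1) l * (G.r x * curvReg G e ρ T x (I 0) (I 1) l (J 0))
      = G.r x * riemReg G e ρ T x I J := by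
    unfold riemReg
    rw [Finset.mul_sum]
    exact Finset.sum_congr rfl fun l _ => by ring
  have h4 : ∑ l, invMetric (bar ρ T) e x (J 1) l *
      (pd (I 0) G.r x * conf G e ρ T x (J 0) (I 1) l - pd (I 1) G.r x * conf G e ρ T x (J 0) (I 0) l
        + ∑ a, (conf G e ρ T x (J 0) (I 0) a * conf G e ρ T x a (I 1) l
          - conf G e ρ T x (J 0) (I 1) a * conf G e ρ T x a (I 0) l)) = _ := h2
  rw [Finset.sum_congr rfl fun l _ => mul_add (invMetric (bar ρ T) e x (J 1) l) _ _,
    Finset.sum_add_distrib, h4, h3]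
  simp only [idTensor]
  ring

/-- The quotient `(1 - |dρ|²) / r` is regular by `CReg.div_r`; the other summand is divisible by `r`
as it stands. -/
theorem reg_riem_add_id (hT : Adapted G e ρ T (m + 1))
    (hN : ∃ C, ∀ a, ∀ x ∈ G.W a, |gradNormSq (bar ρ T) ρ e x ![] ![] - 1| ≤ C * G.r x) (I J) :
    G.Reg m (fun _ x => (G.r x)⁻¹ * (riem T + idTensor : ChartTensor n Mbar 2 2) e x I J) := by
  have h1 := (Gauge.CReg.div_r ((hT.creg_gradNormSq ![] ![]).sub (Gauge.creg_const 1 _)) hN)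
  have h2 : G.Reg m (fun _ x => idTensor e x I J) := Gauge.reg_const _ m
  refine ((h1.of_succ.of_succ.mul h2).neg.add (hT.reg_riemReg I J)).congr fun s x hx => ?_
  have h0 := hT.r_ne hx
  rw [hT.riem_add_id_eq hx]
  field_simp
  ring

end Adapted

end Conformal

/-! ### Covariant derivatives of the curvature -/

section CovariantDerivatives

variable {n : ℕ} {Mbar : Type*} [TopologicalSpace Mbar] {ι : Type}

/-- The identity tensor is parallel: its components are constant, and the Christoffel terms of its
lower indices cancel those of its upper indices. -/
theorem covDeriv_add_id (T : ChartTensor n Mbar 2 0) (S : ChartTensor n Mbar 2 2) :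
    covDeriv T (S + idTensor) = covDeriv T S := by
  funext e x I J
  have hd : fderiv ℝ (fun y => (S + idTensor : ChartTensor n Mbar 2 2) e y (Fin.tail I) J) x
      = fderiv ℝ (fun y => S e y (Fin.tail I) J) x := fderiv_add_const _
  have hz : -(∑ m : Fin 2, ∑ b, christoffel T e x b (I 0) (I m.succ) *
        (idTensor : ChartTensor n Mbar 2 2) e x (Function.update (Fin.tail I) m b) J)
      + (∑ m : Fin 2, ∑ b, christoffel T e x (J m) (I 0) b *
        (idTensor : ChartTensor n Mbar 2 2) e x (Fin.tail I) (Function.update J m b)) = 0 := by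
    simp only [idTensor, Fin.sum_univ_two, Function.update_self, Fin.tail, kron,
      Function.update_of_ne (show (1 : Fin 2) ≠ 0 by decide),
      Function.update_of_ne (show (0 : Fin 2) ≠ 1 by decide), mul_sub, Finset.sum_sub_distrib]
    simp only [mul_ite, mul_one, mul_zero, Finset.sum_ite_eq, Finset.sum_ite_eq', Finset.mem_univ, if_true,
      Finset.sum_ite_irrel, Finset.sum_const_zero]
    ring
  unfold covDeriv
  rw [hd]
  simp only [Pi.add_apply, mul_add, Finset.sum_add_distrib]
  linarith

theorem covDerivIter_add_id (T : ChartTensor n Mbar 2 0) (S : ChartTensor n Mbar 2 2) (j : ℕ) :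
    covDerivIter T (S + idTensor) (j + 1) = covDerivIter T S (j + 1) := by
  induction j with
  | zero => exact covDeriv_add_id T S
  | succ j ih =>
    change covDeriv T (covDerivIter T (S + idTensor) (j + 1))
      = covDeriv T (covDerivIter T S (j + 1))
    rw [ih]

/-- The extra factor `f` restores the exponent `j` and so avoids the truncated difference `j - 1`.
-/
theorem mul_pd_pow {f : V n → ℝ} {x : V n} (hf : DifferentiableAt ℝ f x) (i : Fin (n + 1))
    (j : ℕ) : f x * pd i (fun y => f y ^ j) x = j * f x ^ j * pd i f x := by
  simp only [pd, fderiv_fun_pow j hf]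
  cases j with
  | zero => simp
  | succ j => simp; ring

namespace Adapted

variable {G : Gauge n ι} {e : Chart n Mbar} {ρ : Mbar → ℝ} {T : ChartTensor n Mbar 2 0} {m : ℕ}

/-- The coefficients of `r∇` are `r∂` and `rΓ`, and both act on weighted regularity at the cost of
one order. The weight is written `r^j · r⁻¹` because its exponent `j - 1` is negative for `j = 0`.
-/
theorem reg_covDeriv {r s l j : ℕ} {S : ChartTensor n Mbar r s}
    (hΓ : ∀ c a b, G.Reg l (fun _ x => G.r x * christoffel T e x c a b))
    (hS : ∀ I J, G.Reg (l + 1) (fun _ x => G.r x ^ j * ((G.r x)⁻¹ * S e x I J))) (I J) :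
    G.Reg l (fun _ x => G.r x ^ (j + 1) * ((G.r x)⁻¹ * covDeriv T S e x I J)) := by
  have h0 : ∀ a, ∀ x ∈ G.W a, G.r x ≠ 0 := fun a x hx => (G.r_pos a x hx).ne'
  have hSd : ∀ a, ∀ x ∈ G.W a, ∀ I J, DifferentiableAt ℝ (fun y => S e y I J) x := by
    intro a x hx I J
    have h1 : (fun y => S e y I J)
        =ᶠ[𝓝 x] fun y => G.r y * ((G.r y ^ j)⁻¹ * (G.r y ^ j * ((G.r y)⁻¹ * S e y I J))) := by
      filter_upwards [(G.isOpen a).mem_nhds hx] with y hy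
      have := h0 a y hy
      field_simp
    refine DifferentiableAt.congr_of_eventuallyEq ?_ h1
    exact (r_diff hx).mul ((((r_diff hx).pow j).inv (pow_ne_zero j (h0 a x hx))).mul
      ((hS I J).diff a hx))
  have hder : G.Reg l (fun _ x => G.r x ^ j * pd (I 0) (fun y => S e y (Fin.tail I) J) x) := by
    -- The product rule also differentiates the weight `r^j r⁻¹`. The term subtracted here
    -- compensates for this, with the real exponent `j - 1` as coefficient.
    refine (((hS (Fin.tail I) J).2.2 (I 0)).sub (((Gauge.reg_pd_r (I 0) l).mul
      (hS (Fin.tail I) J).of_succ).const_mul ((j : ℝ) - 1))).congr fun a x hx => ?_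
    have h0x := h0 a x hx
    have hd := r_diff hx
    have hi : DifferentiableAt ℝ (fun y => (G.r y)⁻¹) x := hd.inv h0x
    have hp : DifferentiableAt ℝ (fun y => G.r y ^ j) x := hd.pow j
    rw [pd_mul (g := fun y => (G.r y)⁻¹ * S e y (Fin.tail I) J) hp (hi.mul (hSd a x hx _ _)),
      pd_mul hi (hSd a x hx _ _), pd_inv hd h0x, mul_add, mul_left_comm (G.r x) _ (pd _ _ x),
      mul_pd_pow hd]
    field_simp
    ring
  have hcov : ∀ (y : ι) x, x ∈ G.W y →
      G.r x ^ j * pd (I 0) (fun y => S e y (Fin.tail I) J) x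
      - (∑ m : Fin r, ∑ b, (G.r x * christoffel T e x b (I 0) (I m.succ)) *
        (G.r x ^ j * ((G.r x)⁻¹ * S e x (Function.update (Fin.tail I) m b) J)))
      + (∑ m : Fin s, ∑ b, (G.r x * christoffel T e x (J m) (I 0) b) *
        (G.r x ^ j * ((G.r x)⁻¹ * S e x (Fin.tail I) (Function.update J m b))))
      = G.r x ^ (j + 1) * ((G.r x)⁻¹ * covDeriv T S e x I J) := by
    intro a x hx
    have h0x := h0 a x hx
    have hmul : ∀ A B : ℝ, (G.r x * A) * (G.r x ^ j * ((G.r x)⁻¹ * B)) = G.r x ^ j * (A * B) := by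
      intro A B
      field_simp
    have hpow : ∀ A : ℝ, G.r x ^ (j + 1) * ((G.r x)⁻¹ * A) = G.r x ^ j * A := by
      intro A
      field_simp
      ring
    simp_rw [hmul, ← Finset.mul_sum, hpow, covDeriv, pd]
    ring
  refine Gauge.Reg.congr ((hder.sub (Gauge.Reg.sum fun m _ => Gauge.Reg.sum fun b _ =>
    (hΓ b (I 0) (I m.succ)).mul (hS _ _).of_succ)).add
    (Gauge.Reg.sum fun m _ => Gauge.Reg.sum fun b _ =>
    (hΓ (J m) (I 0) b).mul (hS _ _).of_succ)) hcov

/-- Each covariant derivative uses up one order of regularity. The induction starts from `Riem +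
Id`, which by `reg_riem_add_id` is `r` times a regular tensor. -/
theorem reg_covDerivIter (hT : Adapted G e ρ T (m + 1))
    (hN : ∃ C, ∀ a, ∀ x ∈ G.W a, |gradNormSq (bar ρ T) ρ e x ![] ![] - 1| ≤ C * G.r x) (j : ℕ) :
    ∀ l, l + j = m → ∀ I J, G.Reg l (fun _ x => G.r x ^ j *
      ((G.r x)⁻¹ * covDerivIter T (riem T + idTensor) j e x I J)) := by
  induction j with
  | zero =>
    intro l hl I J
    obtain rfl : l = m := by omega
    exact (hT.reg_riem_add_id hN I J).congr fun a x _ => (one_mul _).symm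
  | succ j ih =>
    intro l hl I J
    exact reg_covDeriv (fun c a b => (hT.reg_r_mul_christoffel c a b).mono (by omega))
      (ih (l + 1) (by omega)) I J

theorem reg_covDerivIter_riem (hT : Adapted G e ρ T (m + 1))
    (hN : ∃ C, ∀ a, ∀ x ∈ G.W a, |gradNormSq (bar ρ T) ρ e x ![] ![] - 1| ≤ C * G.r x) {j : ℕ}
    (hj : 1 ≤ j) (hjm : j ≤ m) (I J) :
    G.Reg 0 (fun _ x => G.r x ^ j * ((G.r x)⁻¹ * covDerivIter T (riem T) j e x I J)) := by
  obtain ⟨j, rfl⟩ : ∃ i, j = i + 1 := ⟨j - 1, by omega⟩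
  rw [← covDerivIter_add_id]
  exact (hT.reg_covDerivIter hN (j + 1) (m - (j + 1)) (by omega) I J).reg0

end Adapted

/-- In dimension `n + 1` the trace of `Id` is `(n + 1) δ - δ = n δ`. -/
theorem ric_add_eq (T : ChartTensor n Mbar 2 0) (e x I J) :
    (ric T + (n : ℝ) • deltaTensor : ChartTensor n Mbar 1 1) e x I J
      = ∑ j, (riem T + idTensor : ChartTensor n Mbar 2 2) e x ![I 0, j] ![J 0, j] := by
  have : ∑ j, (idTensor : ChartTensor n Mbar 2 2) e x ![I 0, j] ![J 0, j]
      = n * kron (I 0) (J 0) := by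
    simp only [idTensor, Matrix.cons_val_zero, Matrix.cons_val_one, Finset.sum_sub_distrib]
    rw [sum_kron_mul (I 0) (fun j => kron j (J 0)), ← Finset.mul_sum]
    simp [kron]
    split_ifs <;> ring
  change ric T e x I J + n * kron (I 0) (J 0) = _
  rw [← this, ric, ← Finset.sum_add_distrib]
  rfl

theorem scal_add_eq (T : ChartTensor n Mbar 2 0) (e x I J) :
    (scal T + constTensor ((n : ℝ) * (n + 1)) : ChartTensor n Mbar 0 0) e x I J
      = ∑ i, (ric T + (n : ℝ) • deltaTensor : ChartTensor n Mbar 1 1) e x ![i] ![i] := by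
  have : ∑ i : Fin (n + 1), ((n : ℝ) • deltaTensor : ChartTensor n Mbar 1 1) e x ![i] ![i]
      = n * (n + 1) := by
    have h : ∀ i : Fin (n + 1), ((n : ℝ) • deltaTensor : ChartTensor n Mbar 1 1) e x ![i] ![i] = n :=
      fun i => by
        change (n : ℝ) * kron i i = n
        simp [kron]
    simp_rw [h]
    simp
    ring
  change scal T e x I J + n * (n + 1) = _
  rw [← this, scal, ← Finset.sum_add_distrib]
  rfl

end CovariantDerivatives

/-! ### Charts -/

section ChartBasics

variable {n : ℕ} {Mbar : Type*} [TopologicalSpace Mbar] {e : Chart n Mbar} {x : V n}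

theorem range_model : range (𝓡∂ (n + 1)) = {y : V n | 0 ≤ y 0} := range_euclideanHalfSpace _

theorem exists_open_domBar (e : Chart n Mbar) :
    ∃ O : Set (V n), IsOpen O ∧ domBar e = O ∩ {y | 0 ≤ y 0} := by
  refine ⟨(𝓡∂ (n + 1)).symm ⁻¹' e.target,
    e.open_target.preimage (𝓡∂ (n + 1)).continuous_symm, ?_⟩
  rw [domBar, OpenPartialHomeomorph.extend_target, range_model]

theorem pt_mem_source (hx : x ∈ domBar e) : pt e x ∈ e.source := by
  rw [← e.extend_source (I := 𝓡∂ (n + 1))]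
  exact (e.extend (𝓡∂ (n + 1))).map_target hx

theorem extend_pt (hx : x ∈ domBar e) : e.extend (𝓡∂ (n + 1)) (pt e x) = x :=
  (e.extend (𝓡∂ (n + 1))).right_inv hx

theorem pt_extend {p : Mbar} (hp : p ∈ e.source) : pt e (e.extend (𝓡∂ (n + 1)) p) = p :=
  e.extend_left_inv hp

theorem extend_mem_domBar {p : Mbar} (hp : p ∈ e.source) : e.extend (𝓡∂ (n + 1)) p ∈ domBar e :=
  (e.extend (𝓡∂ (n + 1))).map_source (by rwa [e.extend_source])

theorem continuousOn_pt (e : Chart n Mbar) : ContinuousOn (pt e) (domBar e) :=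
  e.continuousOn_extend_symm

theorem convex_halfSpace : Convex ℝ {y : V n | 0 ≤ y 0} := EuclideanHalfSpace.convex

theorem uniqueDiffOn_inter_halfSpace {O : Set (V n)} (hO : IsOpen O) :
    UniqueDiffOn ℝ (O ∩ {y : V n | 0 ≤ y 0}) := by
  have := (𝓡∂ (n + 1)).uniqueDiffOn
  rw [range_model] at this
  rw [inter_comm]
  exact this.inter hO

theorem uniqueDiffOn_domBar (e : Chart n Mbar) : UniqueDiffOn ℝ (domBar e) := by
  obtain ⟨O, hO, h⟩ := exists_open_domBar e
  rw [h]
  exact uniqueDiffOn_inter_halfSpace hO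

theorem nonneg_of_mem_domBar (hx : x ∈ domBar e) : 0 ≤ x 0 := by
  obtain ⟨O, hO, h⟩ := exists_open_domBar e
  rw [h] at hx
  exact hx.2

/-- The change of coordinates from the chart `e` to the chart `c`. -/
def trans (e c : Chart n Mbar) (x : V n) : V n := c.extend (𝓡∂ (n + 1)) (pt e x)

theorem pt_trans {c : Chart n Mbar} (h : pt e x ∈ c.source) : pt c (trans e c x) = pt e x :=
  pt_extend h

theorem trans_mem_domBar {c : Chart n Mbar} (h : pt e x ∈ c.source) : trans e c x ∈ domBar c :=
  extend_mem_domBar h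

variable [ChartedSpace (EuclideanHalfSpace (n + 1)) Mbar]

theorem mdifferentiable_chart (he : e ∈ IsManifold.maximalAtlas (𝓡∂ (n + 1)) ∞ Mbar) :
    e.MDifferentiable (𝓡∂ (n + 1)) (𝓡∂ (n + 1)) :=
  ⟨(contMDiffOn_of_mem_maximalAtlas he).mdifferentiableOn (by simp),
    (contMDiffOn_symm_of_mem_maximalAtlas he).mdifferentiableOn (by simp)⟩

theorem isInteriorPoint_model (z : EuclideanHalfSpace (n + 1)) :
    (𝓡∂ (n + 1)).IsInteriorPoint z ↔ 0 < z.1 0 := by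
  change (𝓡∂ (n + 1)) z ∈ interior (range (𝓡∂ (n + 1))) ↔ _
  rw [range_model, interior_halfSpace]
  rfl

theorem contMDiffOn_pt (he : e ∈ IsManifold.maximalAtlas (𝓡∂ (n + 1)) ∞ Mbar) :
    ContMDiffOn 𝓘(ℝ, V n) (𝓡∂ (n + 1)) ∞ (pt e) (domBar e) := by
  have := contMDiffOn_extend_symm he
  rwa [← e.extend_target'] at this

theorem contDiffOn_comp_pt (he : e ∈ IsManifold.maximalAtlas (𝓡∂ (n + 1)) ∞ Mbar)
    {F : Type*} [NormedAddCommGroup F] [NormedSpace ℝ F] {f : Mbar → F}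
    (hf : ContMDiff (𝓡∂ (n + 1)) 𝓘(ℝ, F) ∞ f) :
    ContDiffOn ℝ ∞ (fun x => f (pt e x)) (domBar e) :=
  contMDiffOn_iff_contDiffOn.1 (hf.comp_contMDiffOn (contMDiffOn_pt he))

theorem contDiffOn_trans {c : Chart n Mbar}
    (he : e ∈ IsManifold.maximalAtlas (𝓡∂ (n + 1)) ∞ Mbar)
    (hc : c ∈ IsManifold.maximalAtlas (𝓡∂ (n + 1)) ∞ Mbar) :
    ContDiffOn ℝ ∞ (trans e c) (domBar e ∩ pt e ⁻¹' c.source) := by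
  rw [← contMDiffOn_iff_contDiffOn]
  exact (c.contMDiffOn_extend hc).comp ((contMDiffOn_pt he).mono inter_subset_left)
    fun x hx => hx.2

section DefiningFunction

variable {ρ : Mbar → ℝ}

theorem IsDefiningFunction.contDiffOn (hρ : IsDefiningFunction n ρ)
    (he : e ∈ IsManifold.maximalAtlas (𝓡∂ (n + 1)) ∞ Mbar) :
    ContDiffOn ℝ ∞ (fun x => ρ (pt e x)) (domBar e) := contDiffOn_comp_pt he hρ.smooth

theorem IsDefiningFunction.pos (hρ : IsDefiningFunction n ρ) (hx : x ∈ dom e) :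
    0 < ρ (pt e x) := by
  refine lt_of_le_of_ne (hρ.nonneg _) fun h => ?_
  have := (hρ.zero_iff _).1 h.symm
  rw [← ModelWithCorners.compl_interior] at this
  exact this hx.2

end DefiningFunction

theorem trans_mem_dom {c : Chart n Mbar} (hx : x ∈ dom e) (h : pt e x ∈ c.source) :
    trans e c x ∈ dom c :=
  ⟨trans_mem_domBar h, by rw [pt_trans h]; exact hx.2⟩

variable [IsManifold (𝓡∂ (n + 1)) ∞ Mbar]

/-- The interior is defined by preferred charts, while `e` is any chart of the maximal atlas.
Differentiable maps with surjective differential send interior points to interior points; this is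
applied to the chart and to its inverse. -/
theorem pt_mem_interior_iff (he : e ∈ IsManifold.maximalAtlas (𝓡∂ (n + 1)) ∞ Mbar)
    (hx : x ∈ domBar e) : pt e x ∈ (𝓡∂ (n + 1)).interior Mbar ↔ 0 < x 0 := by
  have : IsManifold (𝓡∂ (n + 1)) 1 Mbar := IsManifold.of_le (n := ∞) (by simp)
  have hs := pt_mem_source hx
  have hx' : (e (pt e x)).1 0 = x 0 := congrFun (congrArg _ (extend_pt hx)) 0
  have hm := mdifferentiable_chart he
  rw [← hx', ← isInteriorPoint_model]
  constructor
  · intro h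
    exact (hm.mdifferentiableAt hs).isInteriorPoint_of_surjective_mfderiv
      (hm.mfderiv_surjective hs) h
  · intro h
    have ht := e.map_source hs
    have := (hm.symm.mdifferentiableAt (x := e (pt e x)) ht).isInteriorPoint_of_surjective_mfderiv
      (hm.symm.mfderiv_surjective ht) h
    rwa [e.left_inv hs] at this

theorem dom_eq (he : e ∈ IsManifold.maximalAtlas (𝓡∂ (n + 1)) ∞ Mbar) :
    dom e = {x ∈ domBar e | 0 < x 0} := by
  ext x
  exact and_congr_right fun hx => pt_mem_interior_iff he hx

theorem domBdry_eq (he : e ∈ IsManifold.maximalAtlas (𝓡∂ (n + 1)) ∞ Mbar) :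
    domBdry e = {x ∈ domBar e | x 0 = 0} := by
  ext x
  refine and_congr_right fun hx => ?_
  rw [← ModelWithCorners.compl_interior, mem_compl_iff, pt_mem_interior_iff he hx, not_lt]
  exact ⟨fun h => le_antisymm h (nonneg_of_mem_domBar hx), fun h => h.le⟩

theorem isOpen_dom (he : e ∈ IsManifold.maximalAtlas (𝓡∂ (n + 1)) ∞ Mbar) : IsOpen (dom e) := by
  obtain ⟨O, hO, h⟩ := exists_open_domBar e
  have : dom e = O ∩ {x | 0 < x 0} := by
    rw [dom_eq he, h]
    ext x
    exact ⟨fun hx => ⟨hx.1.1, hx.2⟩, fun hx => ⟨⟨hx.1, (show 0 < x 0 from hx.2).le⟩, hx.2⟩⟩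
  rw [this]
  exact hO.inter (isOpen_lt continuous_const (by fun_prop))

end ChartBasics

/-! ### Frames, the components of metrics, and coordinate vector fields -/

section Frames

variable {n : ℕ} {Mbar : Type*} [TopologicalSpace Mbar] {e : Chart n Mbar} {x : V n}

theorem domBar_eventuallyEq (hx : x ∈ domBar e) :
    (range (𝓡∂ (n + 1)) : Set (V n)) =ᶠ[𝓝 x] domBar e := by
  obtain ⟨O, hO, h⟩ := exists_open_domBar e
  rw [range_model, h]
  have hxO : x ∈ O := (h ▸ hx).1
  filter_upwards [hO.mem_nhds hxO] with y hy
  exact propext ⟨fun h' => ⟨hy, h'⟩, fun h' => h'.2⟩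

theorem uniqueMDiffOn_domBar (e : Chart n Mbar) : UniqueMDiffOn 𝓘(ℝ, V n) (domBar e) :=
  (uniqueDiffOn_domBar e).uniqueMDiffOn

theorem fderiv_coord {ψ : V n → V n} (hψ : DifferentiableAt ℝ ψ x) (v : V n) (a : Fin (n + 1)) :
    (fderiv ℝ ψ x v) a = fderiv ℝ (fun y => ψ y a) x v := by
  have := ((EuclideanSpace.proj (𝕜 := ℝ) a).hasFDerivAt (x := ψ x)).comp x hψ.hasFDerivAt
  have h2 : fderiv ℝ (fun y => ψ y a) x = _ := this.fderiv
  rw [h2]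
  rfl

theorem bilin_sum (B : V n →L[ℝ] V n →L[ℝ] ℝ) (c d : Fin (n + 1) → ℝ) (f : Fin (n + 1) → V n) :
    B (∑ a, c a • f a) (∑ b, d b • f b) = ∑ a, ∑ b, c a * (d b * B (f a) (f b)) := by
  rw [map_sum B, sum_apply]
  refine Finset.sum_congr rfl fun a _ => ?_
  rw [map_smul, smul_apply, map_sum, smul_eq_mul, Finset.mul_sum]
  simp

variable [ChartedSpace (EuclideanHalfSpace (n + 1)) Mbar]

theorem totalSpace_ext {p q : Mbar} (h : p = q) (v : V n) :
    (⟨p, v⟩ : TangentBundle (𝓡∂ (n + 1)) Mbar) = ⟨q, v⟩ := by subst h; rfl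

/-- The differential of the inverse of the chart `e`. -/
def dpt (e : Chart n Mbar) (x : V n) : V n →L[ℝ] V n :=
  mfderivWithin 𝓘(ℝ, V n) (𝓡∂ (n + 1)) (pt e) (domBar e) x

/-- Near `x` the range of the model and `domBar e` coincide, so the two derivatives within these
sets agree. -/
theorem frame_eq (hx : x ∈ domBar e) (i : Fin (n + 1)) :
    frame e x i = dpt e x (coordVec n i) := by
  unfold frame dpt
  rw [mfderivWithin_congr_set (domBar_eventuallyEq hx)]
  rfl

theorem mdifferentiableWithinAt_pt (he : e ∈ IsManifold.maximalAtlas (𝓡∂ (n + 1)) ∞ Mbar)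
    (hx : x ∈ domBar e) :
    MDifferentiableWithinAt 𝓘(ℝ, V n) (𝓡∂ (n + 1)) (pt e) (domBar e) x :=
  (contMDiffOn_pt he).mdifferentiableOn (by simp) x hx

theorem mfderiv_extend_dpt (he : e ∈ IsManifold.maximalAtlas (𝓡∂ (n + 1)) ∞ Mbar)
    (hx : x ∈ domBar e) (v : V n) :
    (mfderiv (𝓡∂ (n + 1)) 𝓘(ℝ, V n) (e.extend (𝓡∂ (n + 1))) (pt e x) (dpt e x v) : V n) = v := by
  have h1 := mfderiv_comp_mfderivWithin x
    ((e.contMDiffAt_extend he (pt_mem_source hx)).mdifferentiableAt (by simp))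
    (mdifferentiableWithinAt_pt he hx) (uniqueMDiffOn_domBar e x hx)
  have h2 : mfderivWithin 𝓘(ℝ, V n) 𝓘(ℝ, V n) (e.extend (𝓡∂ (n + 1)) ∘ pt e) (domBar e) x
      = ContinuousLinearMap.id ℝ (V n) := by
    have h3 : mfderivWithin 𝓘(ℝ, V n) 𝓘(ℝ, V n) (e.extend (𝓡∂ (n + 1)) ∘ pt e) (domBar e) x
        = mfderivWithin 𝓘(ℝ, V n) 𝓘(ℝ, V n) id (domBar e) x :=
      mfderivWithin_congr (fun y hy => extend_pt hy) (extend_pt hx)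
    exact h3.trans (mfderivWithin_id (uniqueMDiffOn_domBar e x hx))
  have h3 := congrArg (fun L : V n →L[ℝ] V n => L v) (h1.symm.trans h2)
  exact h3

theorem dpt_injective (he : e ∈ IsManifold.maximalAtlas (𝓡∂ (n + 1)) ∞ Mbar)
    (hx : x ∈ domBar e) {v : V n} (h : dpt e x v = 0) : v = 0 := by
  rw [← mfderiv_extend_dpt he hx v, h]
  exact map_zero (mfderiv (𝓡∂ (n + 1)) 𝓘(ℝ, V n) (e.extend (𝓡∂ (n + 1))) (pt e x))

/-- The metric components in terms of the differential of the inverse chart. -/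
theorem metricTensor_eq (g : BilinField n Mbar) (hx : x ∈ domBar e) (I J) :
    metricTensor g e x I J
      = (g (pt e x) : V n →L[ℝ] V n →L[ℝ] ℝ) (dpt e x (coordVec n (I 0)))
        (dpt e x (coordVec n (I 1))) := by
  unfold metricTensor
  rw [frame_eq hx, frame_eq hx]

theorem differentiableAt_trans {c : Chart n Mbar}
    (he : e ∈ IsManifold.maximalAtlas (𝓡∂ (n + 1)) ∞ Mbar)
    (hc : c ∈ IsManifold.maximalAtlas (𝓡∂ (n + 1)) ∞ Mbar) [IsManifold (𝓡∂ (n + 1)) ∞ Mbar]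
    (hx : x ∈ dom e) (h : pt e x ∈ c.source) : DifferentiableAt ℝ (trans e c) x := by
  have h1 := (contDiffOn_trans he hc).differentiableOn (by simp) x ⟨hx.1, h⟩
  refine h1.differentiableAt ?_
  have h2 : dom e ∩ pt e ⁻¹' c.source ∈ 𝓝 x := by
    refine ((((continuousOn_pt e).mono fun y hy => hy.1).isOpen_inter_preimage
      (isOpen_dom he) c.open_source)).mem_nhds ⟨hx, h⟩
  exact mem_of_superset h2 fun y hy => ⟨hy.1.1, hy.2⟩

theorem dpt_trans {c : Chart n Mbar}
    (he : e ∈ IsManifold.maximalAtlas (𝓡∂ (n + 1)) ∞ Mbar)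
    (hc : c ∈ IsManifold.maximalAtlas (𝓡∂ (n + 1)) ∞ Mbar) [IsManifold (𝓡∂ (n + 1)) ∞ Mbar]
    (hx : x ∈ dom e) (h : pt e x ∈ c.source) (v : V n) :
    dpt e x v = dpt c (trans e c x) (fderiv ℝ (trans e c) x v) := by
  have ho : dom e ∩ pt e ⁻¹' c.source ∈ 𝓝 x :=
    (((continuousOn_pt e).mono fun y hy => hy.1).isOpen_inter_preimage
      (isOpen_dom he) c.open_source).mem_nhds ⟨hx, h⟩
  have hy := trans_mem_dom hx h
  have n1 : domBar e ∈ 𝓝 x := mem_of_superset ((isOpen_dom he).mem_nhds hx) fun y hy => hy.1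
  have n2 : domBar c ∈ 𝓝 (trans e c x) :=
    mem_of_superset ((isOpen_dom hc).mem_nhds hy) fun y hy => hy.1
  have h1 : mfderiv 𝓘(ℝ, V n) (𝓡∂ (n + 1)) (pt e) x
      = mfderiv 𝓘(ℝ, V n) (𝓡∂ (n + 1)) (pt c ∘ trans e c) x := by
    refine EventuallyEq.mfderiv_eq ?_
    filter_upwards [ho] with y hy using (pt_trans hy.2).symm
  have h2 := mfderiv_comp (I := 𝓘(ℝ, V n)) (I' := 𝓘(ℝ, V n)) (I'' := 𝓡∂ (n + 1)) x
    ((mdifferentiableWithinAt_pt hc hy.1).mdifferentiableAt n2)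
    (differentiableAt_trans he hc hx h).mdifferentiableAt
  unfold dpt
  rw [mfderivWithin_of_mem_nhds n1, mfderivWithin_of_mem_nhds n2]
  rw [mfderiv_eq_fderiv] at h2
  exact congrArg (fun L : V n →L[ℝ] V n => L v) (h1.trans h2)

/-- The transformation law of the metric components. -/
theorem metricTensor_trans {c : Chart n Mbar} (g : BilinField n Mbar)
    (he : e ∈ IsManifold.maximalAtlas (𝓡∂ (n + 1)) ∞ Mbar)
    (hc : c ∈ IsManifold.maximalAtlas (𝓡∂ (n + 1)) ∞ Mbar) [IsManifold (𝓡∂ (n + 1)) ∞ Mbar]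
    (hx : x ∈ dom e) (h : pt e x ∈ c.source) (i j : Fin (n + 1)) :
    metricTensor g e x ![i, j] ![] = ∑ a, ∑ b, pd i (fun y => trans e c y a) x *
      (pd j (fun y => trans e c y b) x * metricTensor g c (trans e c x) ![a, b] ![]) := by
  have hd := differentiableAt_trans he hc hx h
  have hfr : ∀ i, dpt e x (coordVec n i)
      = ∑ a, pd i (fun y => trans e c y a) x • dpt c (trans e c x) (coordVec n a) := by
    intro i
    rw [dpt_trans he hc hx h]
    conv_lhs => rw [eq_sum_coordVec (fderiv ℝ (trans e c) x (coordVec n i))]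
    rw [map_sum]
    refine Finset.sum_congr rfl fun a _ => ?_
    rw [map_smul, fderiv_coord hd]
    rfl
  rw [metricTensor_eq g hx.1]
  have hg : (g (pt e x) : V n →L[ℝ] V n →L[ℝ] ℝ) = g (pt c (trans e c x)) := by
    rw [pt_trans h]
  simp_rw [metricTensor_eq g (trans_mem_domBar h), hg]
  simp only [Matrix.cons_val_zero, Matrix.cons_val_one]
  rw [hfr i, hfr j]
  exact bilin_sum _ _ _ _

variable [IsManifold (𝓡∂ (n + 1)) ∞ Mbar]

theorem contMDiffOn_dpt (he : e ∈ IsManifold.maximalAtlas (𝓡∂ (n + 1)) ∞ Mbar) (v : V n) :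
    ContMDiffOn 𝓘(ℝ, V n) (𝓡∂ (n + 1)).tangent ∞
      (fun x => (⟨pt e x, dpt e x v⟩ : TangentBundle (𝓡∂ (n + 1)) Mbar)) (domBar e) := by
  have : IsManifold (𝓡∂ (n + 1)) 1 Mbar := IsManifold.of_le (n := ∞) (by simp)
  have h1 := (contMDiffOn_pt he).contMDiffOn_tangentMapWithin (m := ∞) (by simp)
    (uniqueMDiffOn_domBar e)
  have h2 : ContMDiffOn 𝓘(ℝ, V n) 𝓘(ℝ, V n).tangent ∞
      (fun x : V n => (⟨x, v⟩ : TangentBundle 𝓘(ℝ, V n) (V n))) (domBar e) := by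
    intro x hx
    rw [Bundle.contMDiffWithinAt_totalSpace]
    refine ⟨contMDiffWithinAt_id, ?_⟩
    simp only [trivializationAt_model_space_apply]
    exact contMDiffWithinAt_const
  exact h1.comp h2 fun x hx => hx

/-- The components of a continuous Riemannian metric are continuous up to the boundary. -/
theorem continuousOn_inner
    (gbar : Bundle.ContinuousRiemannianMetric (V n)
      (fun p : Mbar => TangentSpace (𝓡∂ (n + 1)) p))
    (he : e ∈ IsManifold.maximalAtlas (𝓡∂ (n + 1)) ∞ Mbar) (v w : V n) :
    ContinuousOn (fun x => (gbar.inner (pt e x) : V n →L[ℝ] V n →L[ℝ] ℝ) (dpt e x v) (dpt e x w))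
      (domBar e) := by
  intro x hx
  have hf := continuousOn_pt e x hx
  have h1 : ContinuousWithinAt
      (fun m => Bundle.TotalSpace.mk' ℝ (E := Bundle.Trivial Mbar ℝ) (pt e m)
        ((gbar.inner (pt e m) : V n →L[ℝ] V n →L[ℝ] ℝ) (dpt e m v) (dpt e m w))) (domBar e) x :=
    (gbar.continuous.continuousAt.comp_continuousWithinAt hf).clm_bundle_apply₂
      (F₁ := V n) (F₂ := V n) (E₁ := fun p : Mbar => TangentSpace (𝓡∂ (n + 1)) p)
      (E₂ := fun p : Mbar => TangentSpace (𝓡∂ (n + 1)) p)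
      (v := fun m => (dpt e m v : V n)) (w := fun m => (dpt e m w : V n))
      ((contMDiffOn_dpt he v).continuousOn x hx) ((contMDiffOn_dpt he w).continuousOn x hx)
  simp only [FiberBundle.continuousWithinAt_totalSpace] at h1
  exact h1.2

/-- The matrix of the components of a Riemannian metric is nondegenerate. -/
theorem det_inner_ne_zero
    (gbar : Bundle.ContinuousRiemannianMetric (V n)
      (fun p : Mbar => TangentSpace (𝓡∂ (n + 1)) p))
    (he : e ∈ IsManifold.maximalAtlas (𝓡∂ (n + 1)) ∞ Mbar) (hx : x ∈ domBar e) :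
    (Matrix.of fun i j => (gbar.inner (pt e x) : V n →L[ℝ] V n →L[ℝ] ℝ)
      (dpt e x (coordVec n i)) (dpt e x (coordVec n j))).det ≠ 0 := by
  intro h0
  -- A kernel vector of the Gram matrix would give a nonzero tangent vector of length zero.
  obtain ⟨v, hv, hMv⟩ := Matrix.exists_mulVec_eq_zero_iff.2 h0
  set B : V n →L[ℝ] V n →L[ℝ] ℝ := gbar.inner (pt e x)
  set w : V n := ∑ i, v i • coordVec n i with hw
  have hwv : ∀ i, w i = v i := fun i => by
    simp [hw, coordVec, Pi.single_apply]
  have hB : B (dpt e x w) (dpt e x w) = ∑ i, v i * (∑ j, B (dpt e x (coordVec n i))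
      (dpt e x (coordVec n j)) * v j) := by
    have hd : dpt e x w = ∑ i, v i • dpt e x (coordVec n i) := by rw [hw]; simp
    rw [hd, bilin_sum]
    simp_rw [Finset.mul_sum]
    exact Finset.sum_congr rfl fun i _ => Finset.sum_congr rfl fun j _ => by ring
  have hzero : B (dpt e x w) (dpt e x w) = 0 := by
    rw [hB]
    refine Finset.sum_eq_zero fun i _ => ?_
    have := congrFun hMv i
    simp only [Matrix.mulVec, dotProduct, Matrix.of_apply, Pi.zero_apply] at this
    exact mul_eq_zero_of_right _ this
  have hwne : dpt e x w ≠ 0 := by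
    intro h
    apply hv
    have := dpt_injective he hx h
    funext i
    rw [← hwv i, this]
    rfl
  exact (gbar.pos (pt e x) (dpt e x w) hwne).ne' hzero

/-- On a compact set of coordinate values, a coordinate vector field extends to a smooth vector
field on the manifold. -/
theorem exists_vectorField [T2Space Mbar] [CompactSpace Mbar]
    (he : e ∈ IsManifold.maximalAtlas (𝓡∂ (n + 1)) ∞ Mbar) {K : Set (V n)} (hK : IsCompact K)
    (hKe : K ⊆ domBar e) (l : Fin (n + 1)) :
    ∃ X : Cₛ^∞⟮𝓡∂ (n + 1); V n, (fun p : Mbar => TangentSpace (𝓡∂ (n + 1)) p)⟯,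
      ∀ x ∈ K, x ∈ dom e → ∀ᶠ y in 𝓝 x, ∀ b, vecComp (fun p => X p) e y b = coordVec n l b := by
  have hC : IsClosed (pt e '' K) := (hK.image_of_continuousOn ((continuousOn_pt e).mono hKe)).isClosed
  have hCs : pt e '' K ⊆ e.source := by
    rintro _ ⟨x, hx, rfl⟩
    exact pt_mem_source (hKe hx)
  obtain ⟨u, hu, hCu, hus⟩ := normal_exists_closure_subset hC e.open_source hCs
  -- The field is a cutoff times the coordinate field. The cutoff equals `1` on a neighbourhood of
  -- the image of `K`, not only on it, because the Lie derivative also differentiates the components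
  -- of the field.
  obtain ⟨χ, h1, h0, -⟩ := exists_contMDiffMap_one_nhds_of_subset_interior (𝓡∂ (n + 1)) (n := ⊤) hC
    (hCu.trans (interior_maximal subset_closure hu))
  have hsupp : tsupport χ ⊆ e.source := by
    refine (closure_minimal ?_ isClosed_closure).trans hus
    intro p hp
    by_contra hpu
    exact hp (h0 p hpu)
  let Y : (p : Mbar) → TangentSpace (𝓡∂ (n + 1)) p :=
    fun p => (dpt e (e.extend (𝓡∂ (n + 1)) p) (coordVec n l) : V n)
  have hY : ContMDiffOn (𝓡∂ (n + 1)) (𝓡∂ (n + 1)).tangent ∞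
      (fun p => (⟨p, Y p⟩ : TangentBundle (𝓡∂ (n + 1)) Mbar)) e.source := by
    refine ((contMDiffOn_dpt he (coordVec n l)).comp (e.contMDiffOn_extend he)
      fun p hp => extend_mem_domBar hp).congr fun p hp => ?_
    exact (totalSpace_ext (pt_extend hp) _).symm
  have hX := ContMDiffOn.smul_section_of_tsupport (n := ∞) (ψ := χ) (s := Y)
    χ.contMDiff.contMDiffOn e.open_source hsupp hY
  refine ⟨⟨(χ : Mbar → ℝ) • Y, hX⟩, fun x hxK hx => ?_⟩
  have hev : ∀ᶠ p in 𝓝 (pt e x), χ p = 1 := by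
    exact h1.filter_mono (nhds_le_nhdsSet (mem_image_of_mem _ hxK))
  have hcont : ContinuousAt (pt e) x := (continuousOn_pt e).continuousAt
    (mem_of_superset ((isOpen_dom he).mem_nhds hx) fun y hy => hy.1)
  filter_upwards [hcont.eventually hev, (isOpen_dom he).mem_nhds hx] with y hy hyd b
  have e1 : ((χ : Mbar → ℝ) • Y) (pt e y) = (dpt e y (coordVec n l) : V n) := by
    change χ (pt e y) • (dpt e (e.extend (𝓡∂ (n + 1)) (pt e y)) (coordVec n l) : V n) = _
    rw [hy, one_smul, extend_pt hyd.1]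
  have e2 := mfderiv_extend_dpt he hyd.1 (coordVec n l)
  exact congrArg (fun v : V n => v b) ((congrArg (fun v : V n => (mfderiv (𝓡∂ (n + 1)) 𝓘(ℝ, V n)
    (e.extend (𝓡∂ (n + 1))) (pt e y) v : V n)) e1).trans e2)

end Frames

/-! ### Hölder bounds and partial derivatives -/

section HolderBounds

variable {n : ℕ} {F : Type*} [NormedAddCommGroup F] [NormedSpace ℝ F]
  {G : Type*} [NormedAddCommGroup G] [NormedSpace ℝ G]

/-- The condition `HolderBoundOn` for maps with values in a normed space. -/
def VHolderBoundOn (k : ℕ) (α : ℝ) (U : Set (V n)) (C : ℝ) (f : V n → F) : Prop :=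
  ContDiffOn ℝ k f U ∧
  (∀ m ≤ k, ∀ x ∈ U, ‖iteratedFDeriv ℝ m f x‖ ≤ C) ∧
  ∀ x ∈ U, ∀ y ∈ U, ‖iteratedFDeriv ℝ k f x - iteratedFDeriv ℝ k f y‖ ≤ C * dist x y ^ α

variable {k : ℕ} {α C : ℝ} {U : Set (V n)} {f g : V n → F}

theorem VHolderBoundOn.mono (h : VHolderBoundOn k α U C f) {C' : ℝ} (hC : C ≤ C') :
    VHolderBoundOn k α U C' f :=
  ⟨h.1, fun m hm x hx => (h.2.1 m hm x hx).trans hC, fun x hx y hy => (h.2.2 x hx y hy).trans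
    (mul_le_mul_of_nonneg_right hC (Real.rpow_nonneg dist_nonneg α))⟩

theorem VHolderBoundOn.add (hU : IsOpen U) {C' : ℝ} (hf : VHolderBoundOn k α U C f)
    (hg : VHolderBoundOn k α U C' g) : VHolderBoundOn k α U (C + C') (f + g) := by
  have key : ∀ m ≤ k, ∀ x ∈ U, iteratedFDeriv ℝ m (f + g) x
      = iteratedFDeriv ℝ m f x + iteratedFDeriv ℝ m g x := by
    intro m hm x hx
    have h1 : (m : WithTop ℕ∞) ≤ k := by exact_mod_cast hm
    exact iteratedFDeriv_add_apply (((hf.1 x hx).contDiffAt (hU.mem_nhds hx)).of_le h1)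
      (((hg.1 x hx).contDiffAt (hU.mem_nhds hx)).of_le h1)
  refine ⟨hf.1.add hg.1, fun m hm x hx => ?_, fun x hx y hy => ?_⟩
  · rw [key m hm x hx]
    exact (norm_add_le _ _).trans (add_le_add (hf.2.1 m hm x hx) (hg.2.1 m hm x hx))
  · rw [key k le_rfl x hx, key k le_rfl y hy, add_sub_add_comm, add_mul]
    exact (norm_add_le _ _).trans (add_le_add (hf.2.2 x hx y hy) (hg.2.2 x hx y hy))

theorem VHolderBoundOn.clm_comp (hU : IsOpen U) (L : F →L[ℝ] G) (hf : VHolderBoundOn k α U C f) :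
    VHolderBoundOn k α U (‖L‖ * C) (fun x => L (f x)) := by
  have key : ∀ m ≤ k, ∀ x ∈ U, iteratedFDeriv ℝ m (fun x => L (f x)) x
      = L.compContinuousMultilinearMap (iteratedFDeriv ℝ m f x) := by
    intro m hm x hx
    exact L.iteratedFDeriv_comp_left ((hf.1 x hx).contDiffAt (hU.mem_nhds hx))
      (by exact_mod_cast hm)
  refine ⟨L.contDiff.comp_contDiffOn hf.1, fun m hm x hx => ?_, fun x hx y hy => ?_⟩
  · rw [key m hm x hx]
    exact (L.norm_compContinuousMultilinearMap_le _).trans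
      (mul_le_mul_of_nonneg_left (hf.2.1 m hm x hx) (norm_nonneg L))
  · have h1 : L.compContinuousMultilinearMap (iteratedFDeriv ℝ k f x)
        - L.compContinuousMultilinearMap (iteratedFDeriv ℝ k f y)
        = L.compContinuousMultilinearMap (iteratedFDeriv ℝ k f x - iteratedFDeriv ℝ k f y) := by
      ext v
      simp
    rw [key k le_rfl x hx, key k le_rfl y hy, h1, mul_assoc]
    exact (L.norm_compContinuousMultilinearMap_le _).trans
      (mul_le_mul_of_nonneg_left (hf.2.2 x hx y hy) (norm_nonneg L))

theorem vholderBoundOn_zero_iff :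
    VHolderBoundOn 0 α U C f ↔ ContinuousOn f U ∧ (∀ x ∈ U, ‖f x‖ ≤ C) ∧
      ∀ x ∈ U, ∀ y ∈ U, ‖f x - f y‖ ≤ C * dist x y ^ α := by
  have key : ∀ x y, ‖iteratedFDeriv ℝ 0 f x - iteratedFDeriv ℝ 0 f y‖ = ‖f x - f y‖ := by
    intro x y
    rw [iteratedFDeriv_zero_eq_comp]
    simp only [Function.comp_apply]
    rw [← map_sub, LinearIsometryEquiv.norm_map]
  unfold VHolderBoundOn
  simp_rw [key]
  simp [contDiffOn_zero]

/-- Currying is an isometry, so the derivative of order `k + 1` of `f` may be replaced by that of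
order `k` of `fderiv ℝ f`. The latter takes values in a dual space, whence the vector-valued form of
the condition. -/
theorem vholderBoundOn_succ_iff (hU : IsOpen U) :
    VHolderBoundOn (k + 1) α U C f ↔ DifferentiableOn ℝ f U ∧ (∀ x ∈ U, ‖f x‖ ≤ C) ∧
      VHolderBoundOn k α U C (fderiv ℝ f) := by
  have key : ∀ x y, ‖iteratedFDeriv ℝ (k + 1) f x - iteratedFDeriv ℝ (k + 1) f y‖
      = ‖iteratedFDeriv ℝ k (fderiv ℝ f) x - iteratedFDeriv ℝ k (fderiv ℝ f) y‖ := by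
    intro x y
    rw [iteratedFDeriv_succ_eq_comp_right, iteratedFDeriv_succ_eq_comp_right]
    have h := ((continuousMultilinearCurryRightEquiv' ℝ k (V n) F).symm).dist_map
      (iteratedFDeriv ℝ k (fderiv ℝ f) x) (iteratedFDeriv ℝ k (fderiv ℝ f) y)
    rw [dist_eq_norm, dist_eq_norm] at h
    exact h
  have hc : ContDiffOn ℝ ((k + 1 : ℕ) : WithTop ℕ∞) f U ↔
      DifferentiableOn ℝ f U ∧ ContDiffOn ℝ k (fderiv ℝ f) U := by
    rw [Nat.cast_succ, contDiffOn_succ_iff_fderiv_of_isOpen hU]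
    simp
  unfold VHolderBoundOn
  simp_rw [key]
  rw [hc]
  constructor
  · rintro ⟨⟨h1, h2⟩, h3, h4⟩
    refine ⟨h1, fun x hx => ?_, h2, fun m hm x hx => ?_, h4⟩
    · simpa using h3 0 (by omega) x hx
    · rw [norm_iteratedFDeriv_fderiv]
      exact h3 (m + 1) (by omega) x hx
  · rintro ⟨h1, h2, h3, h4, h5⟩
    refine ⟨⟨h1, h3⟩, fun m hm x hx => ?_, h5⟩
    cases m with
    | zero => simpa using h2 x hx
    | succ m =>
      rw [← norm_iteratedFDeriv_fderiv]
      exact h4 m (by omega) x hx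

theorem holderBoundOn_iff {f : V n → ℝ} : HolderBoundOn k α U C f ↔ VHolderBoundOn k α U C f :=
  Iff.rfl

theorem HolderBoundOn.mono {f : V n → ℝ} (h : HolderBoundOn k α U C f) {C' : ℝ} (hC : C ≤ C') :
    HolderBoundOn k α U C' f := VHolderBoundOn.mono h hC

theorem HolderBoundOn.congr {f g : V n → ℝ} (hU : IsOpen U) (h : HolderBoundOn k α U C f)
    (hfg : ∀ x ∈ U, f x = g x) : HolderBoundOn k α U C g := by
  have key : ∀ m, ∀ x ∈ U, iteratedFDeriv ℝ m g x = iteratedFDeriv ℝ m f x := by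
    intro m x hx
    refine (EventuallyEq.iteratedFDeriv ℝ ?_ m).eq_of_nhds
    filter_upwards [hU.mem_nhds hx] with y hy using (hfg y hy).symm
  refine ⟨h.1.congr fun x hx => (hfg x hx).symm, fun m hm x hx => ?_, fun x hx y hy => ?_⟩
  · rw [key m x hx]
    exact h.2.1 m hm x hx
  · rw [key k x hx, key k y hy]
    exact h.2.2 x hx y hy

/-- The partial derivatives of a function in `C^{k+1,α}` are in `C^{k,α}`. -/
theorem HolderBoundOn.pd {f : V n → ℝ} (hU : IsOpen U) (h : HolderBoundOn (k + 1) α U C f)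
    (i : Fin (n + 1)) :
    HolderBoundOn k α U (‖ContinuousLinearMap.apply ℝ ℝ (coordVec n i)‖ * C) (pd i f) :=
  ((vholderBoundOn_succ_iff hU).1 h).2.2.clm_comp hU (ContinuousLinearMap.apply ℝ ℝ (coordVec n i))

/-- A bounded differentiable function with partial derivatives in `C^{k,α}` is in `C^{k+1,α}`. -/
theorem exists_holderBoundOn_succ (hU : IsOpen U) {ι : Type*} {f : ι → V n → ℝ}
    (hd : ∀ a, DifferentiableOn ℝ (f a) U) (hb : ∃ C, ∀ a, ∀ x ∈ U, |f a x| ≤ C)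
    (h : ∀ i, ∃ C, ∀ a, HolderBoundOn k α U C (pd i (f a))) :
    ∃ C, ∀ a, HolderBoundOn (k + 1) α U C (f a) := by
  obtain ⟨C0, hC0⟩ := hb
  -- The differential is the sum of the partial derivatives times the coordinate functionals; the
  -- constants add up over this finite sum, uniformly in `a`.
  have hsum : ∀ s : Finset (Fin (n + 1)), ∃ C, ∀ a, VHolderBoundOn k α U C
      (fun x => ∑ i ∈ s, (pd i (f a) x) • (EuclideanSpace.proj (𝕜 := ℝ) i : V n →L[ℝ] ℝ)) := by
    intro s
    classical
    induction s using Finset.induction_on with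
    | empty =>
      refine ⟨0, fun a => ?_⟩
      simp only [Finset.sum_empty]
      refine ⟨contDiffOn_const, fun m _ x _ => ?_, fun x _ y _ => ?_⟩
      · simp [show (fun _ : V n => (0 : V n →L[ℝ] ℝ)) = 0 from rfl]
      · simp [show (fun _ : V n => (0 : V n →L[ℝ] ℝ)) = 0 from rfl]
    | insert j s hj ih =>
      obtain ⟨A, hA⟩ := ih
      obtain ⟨B, hB⟩ := h j
      refine ⟨‖ContinuousLinearMap.smulRight (ContinuousLinearMap.id ℝ ℝ)
        (EuclideanSpace.proj (𝕜 := ℝ) j : V n →L[ℝ] ℝ)‖ * B + A, fun a => ?_⟩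
      have h1 := (VHolderBoundOn.clm_comp hU (ContinuousLinearMap.smulRight
        (ContinuousLinearMap.id ℝ ℝ) (EuclideanSpace.proj (𝕜 := ℝ) j : V n →L[ℝ] ℝ))
        (hB a)).add hU (hA a)
      simp only [Finset.sum_insert hj]
      exact h1
  obtain ⟨A, hA⟩ := hsum Finset.univ
  refine ⟨max C0 A, fun a => (vholderBoundOn_succ_iff hU).2 ⟨hd a, fun x hx =>
    (hC0 a x hx).trans (le_max_left _ _), ?_⟩⟩
  have : fderiv ℝ (f a)
      = fun x => ∑ i, (pd i (f a) x) • (EuclideanSpace.proj (𝕜 := ℝ) i : V n →L[ℝ] ℝ) := by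
    funext x
    ext v
    rw [clm_eq_sum]
    simp [pd, mul_comm]
  rw [this]
  exact (hA a).mono (le_max_right _ _)

end HolderBounds

/-! ### Hyperbolic balls -/

section HyperbolicBalls

variable {n : ℕ}

theorem hypDist_coordVec (x : V n) :
    hypDist x (coordVec n 0) = 2 * Real.arsinh (dist x (coordVec n 0) / (2 * √(x 0))) := by
  simp [hypDist, coordVec]

/-- Squaring turns hyperbolic balls into sets `|x - e₀|² < σ x₀` with `σ = 4 sinh²(R/2)`. Their
topology, convexity and size can be read off from this quadratic inequality. -/
theorem arsinh_div_lt_iff {d t R : ℝ} (hd : 0 ≤ d) (ht : 0 < t) (hR : 0 < R) :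
    2 * Real.arsinh (d / (2 * √t)) < R ↔ d ^ 2 < 4 * Real.sinh (R / 2) ^ 2 * t := by
  have hs : 0 < √t := Real.sqrt_pos.2 ht
  have hsh : 0 < Real.sinh (R / 2) := Real.sinh_pos_iff.2 (by linarith)
  have h1 : 2 * Real.arsinh (d / (2 * √t)) < R ↔ d / (2 * √t) < Real.sinh (R / 2) := by
    rw [← Real.arsinh_lt_arsinh (x := d / (2 * √t)), Real.arsinh_sinh]
    constructor <;> intro h <;> linarith
  rw [h1, div_lt_iff₀ (by positivity), ← pow_lt_pow_iff_left₀ hd (by positivity) two_ne_zero]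
  have : (Real.sinh (R / 2) * (2 * √t)) ^ 2 = 4 * Real.sinh (R / 2) ^ 2 * t := by
    rw [mul_pow, mul_pow, Real.sq_sqrt ht.le]
    ring
  rw [this]

theorem arsinh_div_le_iff {d t R : ℝ} (hd : 0 ≤ d) (ht : 0 < t) (hR : 0 < R) :
    2 * Real.arsinh (d / (2 * √t)) ≤ R ↔ d ^ 2 ≤ 4 * Real.sinh (R / 2) ^ 2 * t := by
  have hs : 0 < √t := Real.sqrt_pos.2 ht
  have hsh : 0 < Real.sinh (R / 2) := Real.sinh_pos_iff.2 (by linarith)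
  have h1 : 2 * Real.arsinh (d / (2 * √t)) ≤ R ↔ d / (2 * √t) ≤ Real.sinh (R / 2) := by
    rw [← Real.arsinh_le_arsinh (x := d / (2 * √t)), Real.arsinh_sinh]
    constructor <;> intro h <;> linarith
  rw [h1, div_le_iff₀ (by positivity), ← pow_le_pow_iff_left₀ hd (by positivity) two_ne_zero]
  have : (Real.sinh (R / 2) * (2 * √t)) ^ 2 = 4 * Real.sinh (R / 2) ^ 2 * t := by
    rw [mul_pow, mul_pow, Real.sq_sqrt ht.le]
    ring
  rw [this]

theorem sq_sub_one_le (x : V n) : (x 0 - 1) ^ 2 ≤ dist x (coordVec n 0) ^ 2 := by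
  have := PiLp.norm_apply_le (x - coordVec n 0) 0
  rw [← dist_eq_norm] at this
  have h2 : (x - coordVec n 0) 0 = x 0 - 1 := by simp [coordVec]
  rw [h2] at this
  rw [← sq_abs (x 0 - 1)]
  exact pow_le_pow_left₀ (abs_nonneg _) this 2

theorem hypBall_eq {R : ℝ} (hR : 0 < R) :
    hypBall n R = {x | dist x (coordVec n 0) ^ 2 < 4 * Real.sinh (R / 2) ^ 2 * x 0} := by
  have hsh : 0 < Real.sinh (R / 2) := Real.sinh_pos_iff.2 (by linarith)
  ext x
  change 0 < x 0 ∧ hypDist x (coordVec n 0) < R ↔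
    dist x (coordVec n 0) ^ 2 < 4 * Real.sinh (R / 2) ^ 2 * x 0
  rw [hypDist_coordVec]
  constructor
  · rintro ⟨h0, h⟩
    exact (arsinh_div_lt_iff dist_nonneg h0 hR).1 h
  · intro h
    have h0 : 0 < x 0 := by
      have h1 : 0 < 4 * Real.sinh (R / 2) ^ 2 * x 0 := (sq_nonneg _).trans_lt h
      exact pos_of_mul_pos_right h1 (by positivity)
    exact ⟨h0, (arsinh_div_lt_iff dist_nonneg h0 hR).2 h⟩

theorem hypClosedBall_eq {R : ℝ} (hR : 0 < R) :
    hypClosedBall n R = {x | dist x (coordVec n 0) ^ 2 ≤ 4 * Real.sinh (R / 2) ^ 2 * x 0} := by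
  have hsh : 0 < Real.sinh (R / 2) := Real.sinh_pos_iff.2 (by linarith)
  ext x
  change 0 < x 0 ∧ hypDist x (coordVec n 0) ≤ R ↔
    dist x (coordVec n 0) ^ 2 ≤ 4 * Real.sinh (R / 2) ^ 2 * x 0
  rw [hypDist_coordVec]
  constructor
  · rintro ⟨h0, h⟩
    exact (arsinh_div_le_iff dist_nonneg h0 hR).1 h
  · intro h
    have h0 : 0 < x 0 := by
      by_contra hneg
      push Not at hneg
      -- At height `≤ 0` the right side is at most zero, while the left side is at least `(x 0 - 1)²
      -- ≥ 1`.
      have h1 := sq_sub_one_le x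
      have h2 : 4 * Real.sinh (R / 2) ^ 2 * x 0 ≤ 0 :=
        mul_nonpos_of_nonneg_of_nonpos (by positivity) hneg
      nlinarith
    exact ⟨h0, (arsinh_div_le_iff dist_nonneg h0 hR).2 h⟩

theorem isOpen_hypBall {R : ℝ} (hR : 0 < R) : IsOpen (hypBall n R) := by
  rw [hypBall_eq hR]
  exact isOpen_lt (by fun_prop) (by fun_prop)

theorem hypBall_subset_closed (R : ℝ) : hypBall n R ⊆ hypClosedBall n R :=
  fun _ hx => ⟨hx.1, hx.2.le⟩

theorem hypBall_mono {R S : ℝ} (h : R ≤ S) : hypBall n R ⊆ hypBall n S :=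
  fun _ hx => ⟨hx.1, hx.2.trans_le h⟩

/-- The height of the points of a hyperbolic ball is bounded from above and below. -/
theorem height_bounds {R : ℝ} (hR : 0 < R) : ∃ c, 0 < c ∧ ∃ C, ∀ x ∈ hypClosedBall n R,
    c ≤ x 0 ∧ x 0 ≤ C := by
  set σ := 4 * Real.sinh (R / 2) ^ 2 with hσ
  have hσ0 : 0 ≤ σ := by positivity
  -- For the height `t`, the inequality `(t - 1)² ≤ σ t` reads `t² + 1 ≤ (σ + 2) t`, which gives
  -- both bounds.
  refine ⟨1 / (σ + 2), by positivity, σ + 2, fun x hx => ?_⟩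
  have h0 := hx.1
  rw [hypClosedBall_eq hR] at hx
  have h1 : (x 0 - 1) ^ 2 ≤ σ * x 0 := (sq_sub_one_le x).trans hx
  constructor
  · rw [div_le_iff₀ (by positivity)]
    nlinarith
  · nlinarith

theorem exists_dist_bound {R : ℝ} (hR : 0 < R) : ∃ C, 0 < C ∧ ∀ x ∈ hypClosedBall n R,
    ∀ y ∈ hypClosedBall n R, dist x y ≤ C := by
  obtain ⟨c, hc, B, hB⟩ := height_bounds (n := n) hR
  set σ := 4 * Real.sinh (R / 2) ^ 2 with hσ
  have hσ0 : 0 ≤ σ := by positivity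
  have key : ∀ x ∈ hypClosedBall n R, dist x (coordVec n 0) ≤ √(σ * |B|) := by
    intro x hx
    apply Real.le_sqrt_of_sq_le
    have h1 := (hB x hx).2
    rw [hypClosedBall_eq hR] at hx
    exact (show _ ≤ _ from hx).trans (mul_le_mul_of_nonneg_left (h1.trans (le_abs_self B)) hσ0)
  refine ⟨2 * √(σ * |B|) + 1, by positivity, fun x hx y hy => ?_⟩
  have := dist_triangle_right x y (coordVec n 0)
  linarith [key x hx, key y hy]

theorem isCompact_hypClosedBall {R : ℝ} (hR : 0 < R) : IsCompact (hypClosedBall n R) := by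
  obtain ⟨C, -, hC⟩ := exists_dist_bound (n := n) hR
  refine Metric.isCompact_of_isClosed_isBounded ?_ (Metric.isBounded_iff.2 ⟨C, fun x hx y hy =>
    hC x hx y hy⟩)
  rw [hypClosedBall_eq hR]
  exact isClosed_le (by fun_prop) (by fun_prop)

/-- The ball is a strict sublevel set of the convex function `|x - e₀|² - σ x₀`. Convexity is needed
for the segments in the gauge of a system of parametrizations. -/
theorem convex_hypBall {R : ℝ} (hR : 0 < R) : Convex ℝ (hypBall n R) := by
  rw [hypBall_eq hR]
  set σ := 4 * Real.sinh (R / 2) ^ 2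
  intro x hx y hy a b ha hb hab
  change dist _ _ ^ 2 < σ * (a * x 0 + b * y 0)
  have hx' : dist x (coordVec n 0) ^ 2 < σ * x 0 := hx
  have hy' : dist y (coordVec n 0) ^ 2 < σ * y 0 := hy
  have h1 : dist (a • x + b • y) (coordVec n 0)
      ≤ a * dist x (coordVec n 0) + b * dist y (coordVec n 0) := by
    have : a • x + b • y - coordVec n 0 = a • (x - coordVec n 0) + b • (y - coordVec n 0) := by
      rw [smul_sub, smul_sub, sub_add_sub_comm, ← add_smul, hab, one_smul]
    rw [dist_eq_norm, this, dist_eq_norm, dist_eq_norm]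
    refine (norm_add_le _ _).trans ?_
    rw [norm_smul, norm_smul, Real.norm_of_nonneg ha, Real.norm_of_nonneg hb]
  set p := dist x (coordVec n 0)
  set q := dist y (coordVec n 0)
  have h2 : (a * p + b * q) ^ 2 ≤ a * p ^ 2 + b * q ^ 2 := by
    have : a * p ^ 2 + b * q ^ 2 - (a * p + b * q) ^ 2 = a * b * (p - q) ^ 2 := by
      obtain rfl : b = 1 - a := by linarith
      ring
    have h3 : 0 ≤ a * b * (p - q) ^ 2 := by positivity
    linarith
  have h3 : a * p ^ 2 + b * q ^ 2 < σ * (a * x 0 + b * y 0) := by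
    rcases ha.eq_or_lt with rfl | ha'
    · have : b = 1 := by linarith
      subst this
      linarith
    · nlinarith [mul_lt_mul_of_pos_left hx' ha', mul_le_mul_of_nonneg_left hy'.le hb]
  exact (pow_le_pow_left₀ dist_nonneg h1 2).trans_lt (h2.trans_lt h3)

end HyperbolicBalls

/-! ### Systems of affine parametrizations in a chart -/

section AffineMaps

variable {n : ℕ} (lam : ℝ) (v : V n)

theorem isOpen_image_affine {lam : ℝ} (h : lam ≠ 0) (v : V n) {U : Set (V n)} (hU : IsOpen U) :
    IsOpen ((fun x => lam • x + v) '' U) :=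
  ((Homeomorph.smulOfNeZero lam h).trans (Homeomorph.addRight v)).isOpenMap U hU

theorem pd_comp_affine (f : V n → ℝ) (i : Fin (n + 1)) (x : V n) :
    pd i (fun y => f (lam • y + v)) x = lam * pd i f (lam • x + v) := by
  have h1 : fderiv ℝ (fun y => f (lam • y + v)) x
      = lam • fderiv ℝ (fun z => f (z + v)) (lam • x) :=
    fderiv_comp_smul (f := fun z => f (z + v)) lam
  simp only [pd, h1, fderiv_comp_add_right]
  rfl

theorem dist_affine {lam : ℝ} (h : 0 < lam) (v x y : V n) :
    dist (lam • x + v) (lam • y + v) = lam * dist x y := by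
  rw [dist_add_right, dist_smul₀, Real.norm_of_nonneg h.le]

theorem affine_inv {lam : ℝ} (h : lam ≠ 0) (v x : V n) :
    lam⁻¹ • ((lam • x + v) - v) = x := by
  rw [add_sub_cancel_right, inv_smul_smul₀ h]

theorem affine_inv' {lam : ℝ} (h : lam ≠ 0) (v x : V n) :
    lam • (lam⁻¹ • (x - v)) + v = x := by
  rw [smul_inv_smul₀ h, sub_add_cancel]

end AffineMaps

variable {n : ℕ} {Mbar : Type*} [TopologicalSpace Mbar] {ι : Type}

/-- A family of parametrizations `x ↦ e⁻¹(lam a · x + shift a)` of parts of a compact subset of the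
chart `e`, whose scales are comparable to `ρ`. -/
structure ParamSystem (ρ : Mbar → ℝ) (e : Chart n Mbar) (ι : Type) where
  lam : ι → ℝ
  lam_pos : ∀ a, 0 < lam a
  shift : ι → V n
  K : Set (V n)
  compact : IsCompact K
  K_sub : K ⊆ domBar e
  mem : ∀ a, ∀ x ∈ hypBall n 2, lam a • x + shift a ∈ K
  smooth : ContDiffOn ℝ ∞ (fun x => ρ (pt e x)) (domBar e)
  lower : ∃ c, 0 < c ∧ ∀ a, ∀ x ∈ hypBall n 2, c * lam a ≤ ρ (pt e (lam a • x + shift a))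
  upper : ∃ C, ∀ a, ∀ x ∈ hypBall n 2, ρ (pt e (lam a • x + shift a)) ≤ C * lam a

namespace ParamSystem

variable {ρ : Mbar → ℝ} {e : Chart n Mbar} (S : ParamSystem ρ e ι)

/-- The affine map `x ↦ lam a · x + shift a`. -/
def map (a : ι) (x : V n) : V n := S.lam a • x + S.shift a

theorem rho_pos (a : ι) {x : V n} (hx : x ∈ hypBall n 2) : 0 < ρ (pt e (S.map a x)) := by
  obtain ⟨c, hc, h⟩ := S.lower
  exact (mul_pos hc (S.lam_pos a)).trans_le (h a x hx)

/-- The weighted Hölder gauge of a system of parametrizations. -/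
def gauge {α : ℝ} (hα : α ≤ 1) : Gauge n ι where
  D := domBar e
  uniq := uniqueDiffOn_domBar e
  K := S.K
  compact := S.compact
  K_sub := S.K_sub
  W a := S.map a '' hypBall n 2
  isOpen a := isOpen_image_affine (S.lam_pos a).ne' _ (isOpen_hypBall two_pos)
  W_sub a := by
    rintro _ ⟨x, hx, rfl⟩
    exact S.mem a x hx
  r x := ρ (pt e x)
  r_smooth := S.smooth
  r_pos a := by
    rintro _ ⟨x, hx, rfl⟩
    exact S.rho_pos a hx
  -- The Hölder gauge is the distance of the parameters in the fixed ball, not that of the points in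
  -- the chart.
  P a p q d := ∃ x ∈ hypBall n 2, ∃ y ∈ hypBall n 2,
    p = S.map a x ∧ q = S.map a y ∧ d = dist x y ^ α
  lip := by
    obtain ⟨c, hc, hlow⟩ := S.lower
    obtain ⟨B, hB, hdist⟩ := exists_dist_bound (n := n) two_pos
    -- The factor `c⁻¹` comes from `lam ≤ c⁻¹ ρ`. The factor `B ^ (1 - α)` comes from `dist x y ≤ B
    -- ^ (1 - α) * dist x y ^ α`, which holds because the distances are at most `B` and `α ≤ 1`.
    refine ⟨B ^ (1 - α) * c⁻¹, by positivity, ?_⟩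
    rintro a _ _ _ ⟨x, hx, y, hy, rfl, rfl, rfl⟩
    have hconv : Convex ℝ (S.map a '' hypBall n 2) := by
      have h := (convex_hypBall (n := n) two_pos).affinity (S.shift a) (S.lam a)
      have h2 : (fun x => S.shift a + S.lam a • x) = S.map a := funext fun x => add_comm _ _
      rwa [h2] at h
    have hseg := hconv.segment_subset (mem_image_of_mem _ hx) (mem_image_of_mem _ hy)
    refine ⟨by positivity, hseg, fun z hz => ?_⟩
    obtain ⟨w, hw, rfl⟩ := hseg hz
    have h1 : S.lam a ≤ c⁻¹ * ρ (pt e (S.map a w)) := by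
      rw [le_inv_mul_iff₀ hc]
      exact hlow a w hw
    have h2 : dist x y ≤ B ^ (1 - α) * dist x y ^ α := by
      rcases dist_nonneg.eq_or_lt (a := (0 : ℝ)) (b := dist x y) with h | h
      · rw [← h]; positivity
      · calc dist x y = dist x y ^ (1 - α) * dist x y ^ α := by
              rw [← Real.rpow_add h, sub_add_cancel, Real.rpow_one]
          _ ≤ _ := mul_le_mul_of_nonneg_right (Real.rpow_le_rpow dist_nonneg
              (hdist x (hypBall_subset_closed 2 hx) y (hypBall_subset_closed 2 hy))
              (by linarith)) (by positivity)
    have h3 : dist (S.map a x) (S.map a y) = S.lam a * dist x y := dist_affine (S.lam_pos a) _ _ _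
    rw [h3]
    calc S.lam a * dist x y
        ≤ (c⁻¹ * ρ (pt e (S.map a w))) * (B ^ (1 - α) * dist x y ^ α) :=
          mul_le_mul h1 h2 dist_nonneg ((S.lam_pos a).le.trans h1)
      _ = _ := by ring

variable {α : ℝ} (hα : α ≤ 1)

theorem pd_rho (a : ι) {x : V n} (hx : x ∈ (S.gauge hα).W a) (i : Fin (n + 1)) :
    pd i (fun y => (S.lam a)⁻¹ * (S.gauge hα).r y) x
      = (S.lam a)⁻¹ * pd i (S.gauge hα).r x := by
  rw [pd_mul (f := fun _ => (S.lam a)⁻¹) (differentiableAt_const _)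
    ((Gauge.reg_r (G := S.gauge hα) 1).diff a hx)]
  simp

/-- The quotient of the weight by the scale of the parametrization. -/
theorem reg_ratio (m : ℕ) : (S.gauge hα).Reg m (fun a x => (S.lam a)⁻¹ * (S.gauge hα).r x) := by
  have hd : ∀ a, DifferentiableOn ℝ (fun x => (S.lam a)⁻¹ * (S.gauge hα).r x)
      ((S.gauge hα).W a) := fun a =>
    ((Gauge.reg_r (G := S.gauge hα) 1).2.1 a).const_mul _
  have hb : (S.gauge hα).Bdd (fun a x => (S.lam a)⁻¹ * (S.gauge hα).r x) := by
    obtain ⟨C, hC⟩ := S.upper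
    refine ⟨C, ?_⟩
    rintro a _ ⟨x, hx, rfl⟩
    have h1 := S.rho_pos a hx
    have h2 := S.lam_pos a
    change |(S.lam a)⁻¹ * ρ (pt e (S.map a x))| ≤ C
    rw [abs_of_pos (by positivity), inv_mul_le_iff₀ h2, mul_comm]
    exact hC a x hx
  -- The ratio reproduces itself under weighted differentiation: `r ∂(r / lam) = (r / lam) ∂r`, with
  -- `∂r` smooth up to the boundary.
  have hp : ∀ i a, ∀ x ∈ (S.gauge hα).W a,
      (S.lam a)⁻¹ * (S.gauge hα).r x * pd i (S.gauge hα).r x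
        = (S.gauge hα).r x * pd i (fun y => (S.lam a)⁻¹ * (S.gauge hα).r y) x := by
    intro i a x hx
    rw [S.pd_rho hα a hx]
    ring
  induction m with
  | zero =>
    refine Gauge.reg0_of_bdd hd hb fun i => ?_
    obtain ⟨B, hB⟩ := hb.mul (Gauge.reg_pd_r (G := S.gauge hα) i 0).bdd
    exact ⟨B, fun a x hx => (congrArg abs (hp i a x hx)).ge.trans (hB a x hx)⟩
  | succ m ih =>
    exact Gauge.reg_succ_of_bdd hb hd fun i => (ih.mul (Gauge.reg_pd_r i m)).congr (hp i)

theorem reg_ratio_inv (m : ℕ) :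
    (S.gauge hα).Reg m (fun a x => ((S.lam a)⁻¹ * (S.gauge hα).r x)⁻¹) := by
  obtain ⟨c, hc, h⟩ := S.lower
  refine (S.reg_ratio hα m).inv hc ?_
  rintro a _ ⟨x, hx, rfl⟩
  have h1 := S.rho_pos a hx
  have h2 := S.lam_pos a
  change c ≤ |(S.lam a)⁻¹ * ρ (pt e (S.map a x))|
  rw [abs_of_pos (by positivity), le_inv_mul_iff₀ h2, mul_comm]
  exact h a x hx

/-- Functions of weighted regularity are in the intrinsic Hölder spaces. -/
theorem holderBoundOn_of_reg {m : ℕ} {f : ι → V n → ℝ} (hf : (S.gauge hα).Reg m f) :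
    ∃ C, ∀ a, HolderBoundOn m α (hypBall n 2) C (fun x => f a (S.map a x)) := by
  have hmaps : ∀ a, MapsTo (S.map a) (hypBall n 2) ((S.gauge hα).W a) := fun a x hx =>
    mem_image_of_mem _ hx
  have hm : ∀ a, Differentiable ℝ (S.map a) := fun a => by unfold map; fun_prop
  induction m generalizing f with
  | zero =>
    obtain ⟨hc, ⟨C, hC⟩, ⟨B, hB⟩⟩ := hf
    refine ⟨max C B, fun a => ?_⟩
    rw [holderBoundOn_iff, vholderBoundOn_zero_iff]
    refine ⟨(hc a).comp (hm a).continuous.continuousOn (hmaps a),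
      fun x hx => (hC a _ (hmaps a hx)).trans (le_max_left _ _), fun x hx y hy => ?_⟩
    exact (hB a _ _ _ ⟨x, hx, y, hy, rfl, rfl, rfl⟩).trans
      (mul_le_mul_of_nonneg_right (le_max_right _ _) (by positivity))
  | succ m ih =>
    refine exists_holderBoundOn_succ (isOpen_hypBall two_pos)
      (fun a => (hf.2.1 a).comp (hm a).differentiableOn (hmaps a)) ?_ fun i => ?_
    · obtain ⟨C, hC⟩ := hf.bdd
      exact ⟨C, fun a x hx => hC a _ (hmaps a hx)⟩
    -- In the ball the partial derivative is `lam ∂f = (r / lam)⁻¹ (r ∂f)`, and the inverse ratio is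
    -- regular of every order.
    · obtain ⟨C, hC⟩ := ih ((S.reg_ratio_inv hα m).mul (hf.2.2 i))
      refine ⟨C, fun a => (hC a).congr (isOpen_hypBall two_pos) fun x hx => ?_⟩
      have h1 := (S.rho_pos a hx).ne'
      have h2 := (S.lam_pos a).ne'
      have h3 : pd i (fun x => f a (S.map a x)) x = S.lam a * pd i (f a) (S.map a x) :=
        pd_comp_affine _ _ _ _ _
      rw [h3]
      change ((S.lam a)⁻¹ * ρ (pt e (S.map a x)))⁻¹ * (ρ (pt e (S.map a x)) * _) = _
      field_simp

/-- Functions in the intrinsic Hölder spaces have weighted regularity. -/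
theorem reg_of_holderBoundOn {m : ℕ} {f : ι → V n → ℝ}
    (hf : ∃ C, ∀ a, HolderBoundOn m α (hypBall n 2) C (fun x => f a (S.map a x))) :
    (S.gauge hα).Reg m f := by
  have hinv : ∀ a x, (S.lam a)⁻¹ • (S.map a x - S.shift a) = x := fun a x =>
    affine_inv (S.lam_pos a).ne' _ _
  have hinv' : ∀ a p, S.map a ((S.lam a)⁻¹ • (p - S.shift a)) = p := fun a p =>
    affine_inv' (S.lam_pos a).ne' _ _
  have hmaps : ∀ a, MapsTo (fun p => (S.lam a)⁻¹ • (p - S.shift a)) ((S.gauge hα).W a)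
      (hypBall n 2) := by
    rintro a _ ⟨x, hx, rfl⟩
    simpa only [hinv] using hx
  have hm : ∀ a, Differentiable ℝ (fun p => (S.lam a)⁻¹ • (p - S.shift a)) := fun a => by
    fun_prop
  have hcomp : ∀ (f : ι → V n → ℝ) a,
      (fun x => f a (S.map a x)) ∘ (fun p => (S.lam a)⁻¹ • (p - S.shift a)) = f a := by
    intro f a
    funext p
    simp only [Function.comp_apply, hinv']
  obtain ⟨C, hC⟩ := hf
  induction m generalizing f C with
  | zero =>
    simp only [holderBoundOn_iff, vholderBoundOn_zero_iff] at hC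
    refine ⟨fun a => ?_, ⟨C, ?_⟩, ⟨C, ?_⟩⟩
    · have := (hC a).1.comp (hm a).continuous.continuousOn (hmaps a)
      rwa [hcomp] at this
    · rintro a _ ⟨x, hx, rfl⟩
      exact (hC a).2.1 x hx
    · rintro a _ _ _ ⟨x, hx, y, hy, rfl, rfl, rfl⟩
      exact (hC a).2.2 x hx y hy
  | succ m ih =>
    refine Gauge.reg_succ_of_bdd ⟨C, ?_⟩ (fun a => ?_) fun i => ?_
    · rintro a _ ⟨x, hx, rfl⟩
      simpa using (hC a).2.1 0 (by omega) x hx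
    · have := ((hC a).1.differentiableOn (by simp)).comp (hm a).differentiableOn (hmaps a)
      rwa [hcomp] at this
    · have h1 := ih (f := fun a x => S.lam a * pd i (f a) x) _ fun a =>
        ((hC a).pd (isOpen_hypBall two_pos) i).congr (isOpen_hypBall two_pos) fun x _ =>
          pd_comp_affine _ _ _ _ _
      -- Conversely, `r ∂f = (r / lam) (lam ∂f)`.
      refine ((S.reg_ratio hα m).mul h1).congr fun a x _ => ?_
      have h2 := (S.lam_pos a).ne'
      field_simp

end ParamSystem

/-! ### The systems of parametrizations of a Möbius family -/

section Pieces

variable {n : ℕ} {Mbar : Type*} [TopologicalSpace Mbar]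
  [ChartedSpace (EuclideanHalfSpace (n + 1)) Mbar] {ρ : Mbar → ℝ}

/-- The components of `X` are constant near the point, so the terms that contain their derivatives
vanish. -/
theorem lieDeriv_eq_pd {e : Chart n Mbar} {X : (p : Mbar) → TangentSpace (𝓡∂ (n + 1)) p} {T : ChartTensor n Mbar 2 0}
    {x : V n} {l : Fin (n + 1)} (h : ∀ᶠ y in 𝓝 x, ∀ b, vecComp X e y b = coordVec n l b) (I J) :
    lieDeriv X T e x I J = pd l (fun y => T e y I J) x := by
  have h1 : ∀ b v, fderiv ℝ (fun y => vecComp X e y b) x v = 0 := by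
    intro b v
    have : (fun y => vecComp X e y b) =ᶠ[𝓝 x] fun _ => coordVec n l b := h.mono fun y hy => hy b
    rw [this.fderiv_eq]
    simp
  simp only [lieDeriv, h1, h.self_of_nhds, mul_zero, Finset.sum_const_zero, add_zero, sub_zero, pd]
  rw [Finset.sum_eq_single l]
  · simp [coordVec]
  · intro b _ hb
    simp [coordVec, hb]
  · simp

/-- The background charts and the interior charts of a Möbius family. -/
def pieceChart (𝒜 : MobiusFamily n ρ) : 𝒜.bgIdx ⊕ 𝒜.intIdx → Chart n Mbar
  | .inl i => 𝒜.bgChart i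
  | .inr i => 𝒜.intChart i

/-- The index set of the parametrizations by way of a given chart of the family. -/
def pieceIdx (𝒜 : MobiusFamily n ρ) : 𝒜.bgIdx ⊕ 𝒜.intIdx → Type
  | .inl i => {a // 𝒜.mobBg a = i}
  | .inr _ => Unit

/-- The parametrizations by way of a given chart of the family. -/
def pieceParam (𝒜 : MobiusFamily n ρ) :
    (b : 𝒜.bgIdx ⊕ 𝒜.intIdx) → pieceIdx 𝒜 b → 𝒜.mobIdx ⊕ 𝒜.intIdx
  | .inl _, a => .inl a.1
  | .inr i, _ => .inr i

theorem pieceParam_surj (𝒜 : MobiusFamily n ρ) (c : 𝒜.mobIdx ⊕ 𝒜.intIdx) :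
    ∃ b a, pieceParam 𝒜 b a = c := by
  rcases c with c | c
  · exact ⟨.inl (𝒜.mobBg c), ⟨c, rfl⟩, rfl⟩
  · exact ⟨.inr c, (), rfl⟩

theorem pieceChart_mem (𝒜 : MobiusFamily n ρ) (b : 𝒜.bgIdx ⊕ 𝒜.intIdx) :
    pieceChart 𝒜 b ∈ IsManifold.maximalAtlas (𝓡∂ (n + 1)) ∞ Mbar := by
  rcases b with b | b
  · exact 𝒜.bgChart_mem b
  · exact 𝒜.intChart_mem b

theorem bgChart_height (𝒜 : MobiusFamily n ρ) (i : 𝒜.bgIdx) {y : V n}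
    (hy : y ∈ domBar (𝒜.bgChart i)) : ρ (pt (𝒜.bgChart i) y) = y 0 := by
  rw [← 𝒜.bgChart_coord i _ (pt_mem_source hy), extend_pt hy]

theorem mobius_height (c x : V n) : (c 0 • x + (c - c 0 • coordVec n 0)) 0 = x 0 * c 0 := by
  simp [coordVec, mul_comm]

theorem bgChart_mobius_height (𝒜 : MobiusFamily n ρ) (a : 𝒜.mobIdx) {x : V n}
    (hx : x ∈ hypBall n 2) : ρ (pt (𝒜.bgChart (𝒜.mobBg a))
      (𝒜.mobCentre a 0 • x + (𝒜.mobCentre a - 𝒜.mobCentre a 0 • coordVec n 0)))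
        = x 0 * 𝒜.mobCentre a 0 := by
  rw [bgChart_height 𝒜 _ (𝒜.bgCore_subset _ (𝒜.mob_ball a x hx)), mobius_height]

theorem mem_interior_iff_pos (hρ : IsDefiningFunction n ρ) (p : Mbar) :
    p ∈ (𝓡∂ (n + 1)).interior Mbar ↔ 0 < ρ p := by
  rw [← ModelWithCorners.compl_boundary, mem_compl_iff, ← hρ.zero_iff]
  exact ⟨fun h => lt_of_le_of_ne (hρ.nonneg p) (Ne.symm h), fun h => h.ne'⟩

variable [IsManifold (𝓡∂ (n + 1)) ∞ Mbar]

/-- The parametrizations by way of a given background chart. -/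
def bgSystem (𝒜 : MobiusFamily n ρ) (hρ : IsDefiningFunction n ρ) (i : 𝒜.bgIdx) :
    ParamSystem ρ (𝒜.bgChart i) {a // 𝒜.mobBg a = i} where
  lam a := 𝒜.mobCentre a 0
  lam_pos a := 𝒜.mobCentre_pos a
  shift a := 𝒜.mobCentre a - 𝒜.mobCentre a 0 • coordVec n 0
  K := 𝒜.bgCore i
  compact := 𝒜.bgCore_compact i
  K_sub := 𝒜.bgCore_subset i
  mem := by
    rintro ⟨a, rfl⟩ x hx
    exact 𝒜.mob_ball a x hx
  smooth := hρ.contDiffOn (𝒜.bgChart_mem i)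
  lower := by
    obtain ⟨c, hc, C, hC⟩ := height_bounds (n := n) two_pos
    refine ⟨c, hc, ?_⟩
    rintro ⟨a, rfl⟩ x hx
    rw [bgChart_mobius_height 𝒜 a hx]
    exact mul_le_mul_of_nonneg_right (hC x (hypBall_subset_closed 2 hx)).1 (𝒜.mobCentre_pos a).le
  upper := by
    obtain ⟨c, hc, C, hC⟩ := height_bounds (n := n) two_pos
    refine ⟨C, ?_⟩
    rintro ⟨a, rfl⟩ x hx
    rw [bgChart_mobius_height 𝒜 a hx]
    exact mul_le_mul_of_nonneg_right (hC x (hypBall_subset_closed 2 hx)).2 (𝒜.mobCentre_pos a).le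

theorem hypClosedBall_subset_dom (𝒜 : MobiusFamily n ρ) (i : 𝒜.intIdx) :
    hypClosedBall n 2 ⊆ dom (𝒜.intChart i) := by
  intro x hx
  rw [dom_eq (𝒜.intChart_mem i)]
  exact ⟨𝒜.intChart_ball i hx, hx.1⟩

theorem exists_pos_lower {K : Set (V n)} (hK : IsCompact K) {f : V n → ℝ} (hf : ContinuousOn f K)
    (h0 : ∀ x ∈ K, f x ≠ 0) : ∃ c, 0 < c ∧ ∀ x ∈ K, c ≤ |f x| := by
  obtain ⟨C, hC⟩ := hK.exists_bound_of_continuousOn (hf.inv₀ h0)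
  -- For empty `K` the bound `C` need not be positive; the maximum with `1` is.
  have h1 : (0 : ℝ) < max C 1 := lt_max_of_lt_right one_pos
  refine ⟨(max C 1)⁻¹, by positivity, fun x hx => ?_⟩
  refine inv_le_of_inv_le₀ (abs_pos.2 (h0 x hx)) ?_
  rw [← abs_inv]
  exact (hC x hx).trans (le_max_left _ _)

/-- The parametrization by way of a given interior chart. -/
def intSystem (𝒜 : MobiusFamily n ρ) (hρ : IsDefiningFunction n ρ) (i : 𝒜.intIdx) :
    ParamSystem ρ (𝒜.intChart i) Unit where
  lam _ := 1
  lam_pos _ := one_pos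
  shift _ := 0
  K := hypClosedBall n 2
  compact := isCompact_hypClosedBall two_pos
  K_sub := 𝒜.intChart_ball i
  mem _ x hx := by
    rw [one_smul, add_zero]
    exact hypBall_subset_closed 2 hx
  smooth := hρ.contDiffOn (𝒜.intChart_mem i)
  lower := by
    obtain ⟨c, hc, h⟩ := exists_pos_lower (isCompact_hypClosedBall (n := n) two_pos)
      ((hρ.contDiffOn (𝒜.intChart_mem i)).continuousOn.mono (𝒜.intChart_ball i))
      fun x hx => (hρ.pos (hypClosedBall_subset_dom 𝒜 i hx)).ne'
    refine ⟨c, hc, fun a x hx => ?_⟩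
    rw [mul_one, one_smul, add_zero, ← abs_of_nonneg (hρ.nonneg _)]
    exact h x (hypBall_subset_closed 2 hx)
  upper := by
    obtain ⟨C, h⟩ := (isCompact_hypClosedBall (n := n) two_pos).exists_bound_of_continuousOn
      ((hρ.contDiffOn (𝒜.intChart_mem i)).continuousOn.mono (𝒜.intChart_ball i))
    refine ⟨C, fun a x hx => ?_⟩
    rw [mul_one, one_smul, add_zero]
    exact (le_abs_self _).trans (h x (hypBall_subset_closed 2 hx))

/-- The parametrizations by way of a given chart of the family, as a system. -/
def pieceSystem (𝒜 : MobiusFamily n ρ) (hρ : IsDefiningFunction n ρ) :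
    (b : 𝒜.bgIdx ⊕ 𝒜.intIdx) → ParamSystem ρ (pieceChart 𝒜 b) (pieceIdx 𝒜 b)
  | .inl i => bgSystem 𝒜 hρ i
  | .inr i => intSystem 𝒜 hρ i

theorem pullback_pieceParam (𝒜 : MobiusFamily n ρ) (hρ : IsDefiningFunction n ρ)
    (b : 𝒜.bgIdx ⊕ 𝒜.intIdx) (a : pieceIdx 𝒜 b) {r s : ℕ} (T : ChartTensor n Mbar r s) (x I J) :
    (𝒜.param (pieceParam 𝒜 b a)).pullback T x I J
      = (pieceSystem 𝒜 hρ b).lam a ^ r * ((pieceSystem 𝒜 hρ b).lam a)⁻¹ ^ s *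
        T (pieceChart 𝒜 b) ((pieceSystem 𝒜 hρ b).map a x) I J := by
  rcases b with b | b
  · obtain ⟨a, rfl⟩ := a
    rfl
  · rfl

theorem param_map_pieceParam (𝒜 : MobiusFamily n ρ) (hρ : IsDefiningFunction n ρ)
    (b : 𝒜.bgIdx ⊕ 𝒜.intIdx) (a : pieceIdx 𝒜 b) (x : V n) :
    (𝒜.param (pieceParam 𝒜 b a)).map x
      = pt (pieceChart 𝒜 b) ((pieceSystem 𝒜 hρ b).map a x) := by
  rcases b with b | b
  · obtain ⟨a, rfl⟩ := a
    rfl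
  · rfl

/-- The gauge of the parametrizations by way of a given chart of the family. -/
def pieceGauge (𝒜 : MobiusFamily n ρ) (hρ : IsDefiningFunction n ρ) {α : ℝ} (hα : α ≤ 1)
    (b : 𝒜.bgIdx ⊕ 𝒜.intIdx) : Gauge n (pieceIdx 𝒜 b) := (pieceSystem 𝒜 hρ b).gauge hα

variable {𝒜 : MobiusCover n ρ} {hρ : IsDefiningFunction n ρ} {α : ℝ} {hα : α ≤ 1}

theorem pieceGauge_sub_dom {b : 𝒜.bgIdx ⊕ 𝒜.intIdx} {a : pieceIdx 𝒜.toMobiusFamily b} {x : V n}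
    (hx : x ∈ (pieceGauge 𝒜.toMobiusFamily hρ hα b).W a) :
    x ∈ dom (pieceChart 𝒜.toMobiusFamily b) :=
  ⟨(pieceSystem 𝒜.toMobiusFamily hρ b).K_sub ((pieceGauge 𝒜.toMobiusFamily hρ hα b).W_sub a hx),
    (mem_interior_iff_pos hρ _).2 ((pieceGauge 𝒜.toMobiusFamily hρ hα b).r_pos a x hx)⟩

/-- Every interior point lies in the range of one of the parametrizations. -/
theorem exists_piece (hρ : IsDefiningFunction n ρ) (hα : α ≤ 1) {p : Mbar}
    (hp : p ∈ (𝓡∂ (n + 1)).interior Mbar) : ∃ b a,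
      ∃ x ∈ (pieceGauge 𝒜.toMobiusFamily hρ hα b).W a, pt (pieceChart 𝒜.toMobiusFamily b) x = p := by
  obtain ⟨c, x, hx, rfl⟩ := 𝒜.covers p hp
  obtain ⟨b, a, rfl⟩ := pieceParam_surj 𝒜.toMobiusFamily c
  exact ⟨b, a, _, mem_image_of_mem _ (hypBall_mono one_le_two hx),
    (param_map_pieceParam 𝒜.toMobiusFamily hρ b a x).symm⟩

variable (hρ hα) in
-- The pullback of a `(2,0)` tensor carries `lam²` and the weight carries `ρ⁻²`. Multiplication by
-- the regular function `(ρ / lam)²` leaves the plain components in the chart, so weight `2` means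
-- no weight on them.
theorem reg_of_memWHolder {k : ℕ} {T : ChartTensor n Mbar 2 0} (hT : MemWHolder 𝒜 k α 2 T)
    (b : 𝒜.bgIdx ⊕ 𝒜.intIdx) (I J) : (pieceGauge 𝒜.toMobiusFamily hρ hα b).Reg k
      (fun _ x => T (pieceChart 𝒜.toMobiusFamily b) x I J) := by
  obtain ⟨C, hC⟩ := hT
  set S := pieceSystem 𝒜.toMobiusFamily hρ b
  have h1 := S.reg_of_holderBoundOn hα (m := k) (f := fun a x => S.lam a ^ 2 * (S.lam a)⁻¹ ^ 0 *
    (ρ (pt (pieceChart 𝒜.toMobiusFamily b) x) ^ (-(2 : ℝ)) *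
      T (pieceChart 𝒜.toMobiusFamily b) x I J)) ⟨C, fun a => by
    have h2 := hC (pieceParam 𝒜.toMobiusFamily b a) I J
    simp only [pullback_pieceParam 𝒜.toMobiusFamily hρ] at h2
    exact h2⟩
  refine (((S.reg_ratio hα k).mul (S.reg_ratio hα k)).mul h1).congr fun a x hx => ?_
  have h3 : (S.gauge hα).r x ≠ 0 := ((S.gauge hα).r_pos a x hx).ne'
  have h4 := (S.lam_pos a).ne'
  have h5 : ρ (pt (pieceChart 𝒜.toMobiusFamily b) x) ^ (-(2 : ℝ))
      = ((S.gauge hα).r x ^ 2)⁻¹ := by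
    rw [Real.rpow_neg (hρ.nonneg _), Real.rpow_two]
    rfl
  rw [h5]
  field_simp

variable (hρ hα) in
-- For equal covariant and contravariant rank the scale factors of the pullback cancel, and only
-- `ρ⁻¹` remains. The constants are uniform because there are finitely many charts and components.
theorem memWHolder_of_reg {k : ℕ} {r : ℕ} {T : ChartTensor n Mbar r r}
    (h : ∀ b I J, (pieceGauge 𝒜.toMobiusFamily hρ hα b).Reg k (fun _ x =>
      ((pieceGauge 𝒜.toMobiusFamily hρ hα b).r x)⁻¹ *
        T (pieceChart 𝒜.toMobiusFamily b) x I J)) : MemWHolder 𝒜 k α 1 T := by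
  have := 𝒜.bg_finite
  have := 𝒜.int_finite
  choose C hC using fun b I J =>
    (pieceSystem 𝒜.toMobiusFamily hρ b).holderBoundOn_of_reg hα (h b I J)
  obtain ⟨B, hB⟩ := (Set.finite_range fun t : (𝒜.bgIdx ⊕ 𝒜.intIdx) × (Fin r → Fin (n + 1)) ×
    (Fin r → Fin (n + 1)) => C t.1 t.2.1 t.2.2).bddAbove
  refine ⟨B, fun c I J => ?_⟩
  obtain ⟨b, a, rfl⟩ := pieceParam_surj 𝒜.toMobiusFamily c
  refine ((hC b I J a).mono (hB ⟨(b, I, J), rfl⟩)).congr (isOpen_hypBall two_pos) fun x hx => ?_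
  rw [pullback_pieceParam 𝒜.toMobiusFamily hρ, ← mul_pow,
    mul_inv_cancel₀ ((pieceSystem 𝒜.toMobiusFamily hρ b).lam_pos a).ne', one_pow, one_mul]
  simp only [fmul, Real.rpow_neg_one]
  rfl

end Pieces

/-! ### Adapted gauges for weakly asymptotically hyperbolic metrics -/

section AdaptedGauges

variable {n : ℕ} {Mbar : Type*} [TopologicalSpace Mbar]
  [ChartedSpace (EuclideanHalfSpace (n + 1)) Mbar] [IsManifold (𝓡∂ (n + 1)) ∞ Mbar]
  {ρ : Mbar → ℝ} {e : Chart n Mbar} {g : BilinField n Mbar}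

/-- In the interior `ρ² g` agrees with a metric that is continuous and nondegenerate up to the
boundary, and the determinant of the latter has no zero on the compact set. -/
theorem exists_det_lower (hc : IsConformallyCompact ρ g)
    (he : e ∈ IsManifold.maximalAtlas (𝓡∂ (n + 1)) ∞ Mbar) {K : Set (V n)} (hK : IsCompact K)
    (hKe : K ⊆ domBar e) : ∃ c, 0 < c ∧ ∀ x ∈ K, x ∈ dom e →
      c ≤ |(Matrix.of fun i j => bar ρ (metricTensor g) e x ![i, j] ![]).det| := by
  obtain ⟨gbar, hg⟩ := hc
  obtain ⟨c, hc, h⟩ := exists_pos_lower hK (f := fun x => (Matrix.of fun i j =>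
    (gbar.inner (pt e x) : V n →L[ℝ] V n →L[ℝ] ℝ)
      (dpt e x (coordVec n i)) (dpt e x (coordVec n j))).det) (ContinuousOn.mono
        (by
          simp only [Matrix.det_apply']
          exact continuousOn_finsetSum _ fun σ _ => continuousOn_const.mul
            (continuousOn_finsetProd _ fun i _ => continuousOn_inner gbar he _ _)) hKe)
    fun x hx => det_inner_ne_zero gbar he (hKe hx)
  refine ⟨c, hc, fun x hx hxd => ?_⟩
  convert h x hx using 4
  ext i j
  simp only [bar, fmul]
  rw [metricTensor_eq g hxd.1]
  exact (hg _ hxd.2 _ _).symm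

theorem adapted_of_creg {ι : Type} {G : Gauge n ι} {m : ℕ} (hm : IsMetricOnInterior g)
    (hc : IsConformallyCompact ρ g) (he : e ∈ IsManifold.maximalAtlas (𝓡∂ (n + 1)) ∞ Mbar)
    (hD : G.D ⊆ domBar e) (hW : ∀ a, G.W a ⊆ dom e)
    (hr : ∀ a, ∀ x ∈ G.W a, G.r x = ρ (pt e x))
    (h : ∀ i j, G.CReg m (fun _ x => bar ρ (metricTensor g) e x ![i, j] ![])) :
    Adapted G e ρ (metricTensor g) m where
  r_eq := hr
  symm a x hx i j := hm.symm _ (hW a hx).2 _ _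
  reg := h
  det := by
    obtain ⟨c, hc, h⟩ := exists_det_lower hc he G.compact (G.K_sub.trans hD)
    exact ⟨c, hc, fun a x hx => h x (G.W_sub a hx) (hW a hx)⟩

variable {𝒜 : MobiusCover n ρ} {k : ℕ} {α : ℝ} [T2Space Mbar] [CompactSpace Mbar]

/-- The metric is adapted to the gauges of the Möbius family. -/
theorem adapted_pieceGauge (hρ : IsDefiningFunction n ρ) (hα : α ≤ 1)
    (hg : IsWeaklyAH 𝒜 (k + 1) α g) (b : 𝒜.bgIdx ⊕ 𝒜.intIdx) :
    Adapted (pieceGauge 𝒜.toMobiusFamily hρ hα b) (pieceChart 𝒜.toMobiusFamily b) ρ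
      (metricTensor g) k := by
  set e := pieceChart 𝒜.toMobiusFamily b with he'
  have he : e ∈ IsManifold.maximalAtlas (𝓡∂ (n + 1)) ∞ Mbar := pieceChart_mem 𝒜.toMobiusFamily b
  refine adapted_of_creg hg.metric hg.conformallyCompact he Subset.rfl
    (fun a x hx => pieceGauge_sub_dom hx) (fun a x hx => rfl) fun i j => ?_
  have h1 := reg_of_memWHolder hρ hα hg.gBar_mem b ![i, j] ![]
  refine ⟨h1.bdd, h1.2.1, fun l => ?_⟩
  -- Here the hypothesis on Lie derivatives enters: for `X` extending `∂_l` it controls `∂_l ḡ_{ij}`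
  -- without a weight.
  obtain ⟨X, hX⟩ := exists_vectorField he (pieceSystem 𝒜.toMobiusFamily hρ b).compact
    (pieceSystem 𝒜.toMobiusFamily hρ b).K_sub l
  refine (reg_of_memWHolder hρ hα (hg.lie_gBar_mem X) b ![i, j] ![]).congr fun a x hx => ?_
  exact lieDeriv_eq_pd (hX x ((pieceGauge 𝒜.toMobiusFamily hρ hα b).W_sub a hx)
    (pieceGauge_sub_dom hx)) _ _

end AdaptedGauges

/-! ### Change of coordinates and covers for gauges -/

section Transfer

variable {n : ℕ} {ι κ : Type}

/-- Weighted boundedness, without a Hölder condition, on a family of smaller open sets. -/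
def Gauge.onSubsets (G : Gauge n ι) (W : κ → Set (V n)) (hW : ∀ a, IsOpen (W a))
    (hs : ∀ a, ∃ b, W a ⊆ G.W b) : Gauge n κ where
  D := G.D
  uniq := G.uniq
  K := G.K
  compact := G.compact
  K_sub := G.K_sub
  W := W
  isOpen := hW
  W_sub a := by
    obtain ⟨b, hb⟩ := hs a
    exact hb.trans (G.W_sub b)
  r := G.r
  r_smooth := G.r_smooth
  r_pos a x hx := by
    obtain ⟨b, hb⟩ := hs a
    exact G.r_pos b x (hb hx)
  P _ _ _ _ := False
  lip := ⟨0, le_rfl, fun _ _ _ _ h => h.elim⟩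

/-! ### Regularity from a finite collection of gauges -/

section Cover

variable {G : Gauge n ι} {β : Type*} [Finite β] {κ : β → Type} {G' : (b : β) → Gauge n (κ b)}

theorem Gauge.bdd_of_cover (hcov : ∀ s, ∀ x ∈ G.W s, ∃ b a, x ∈ (G' b).W a) {f : V n → ℝ}
    (h : ∀ b, (G' b).Bdd (fun _ => f)) : G.Bdd (fun _ => f) := by
  choose C hC using h
  obtain ⟨B, hB⟩ := (Set.finite_range C).bddAbove
  refine ⟨B, fun s x hx => ?_⟩
  obtain ⟨b, a, hx⟩ := hcov s x hx
  exact (hC b a x hx).trans (hB ⟨b, rfl⟩)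

/-- Without Hölder pairs, regularity consists of pointwise bounds and local differentiability, so it
may be checked on a cover. Finiteness of the number of gauges keeps the bounds uniform; each gauge
may have infinitely many sets. -/
theorem Gauge.reg_of_cover (hcov : ∀ s, ∀ x ∈ G.W s, ∃ b a, x ∈ (G' b).W a)
    (hr : ∀ b, (G' b).r = G.r) (hP : ∀ s p q d, ¬ G.P s p q d) {m : ℕ} {f : V n → ℝ}
    (h : ∀ b, (G' b).Reg m (fun _ => f)) : G.Reg m (fun _ => f) := by
  induction m generalizing f with
  | zero =>
    refine ⟨fun s x hx => ?_, Gauge.bdd_of_cover hcov fun b => (h b).bdd,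
      ⟨0, fun s p q d hd => (hP s p q d hd).elim⟩⟩
    obtain ⟨b, a, hx'⟩ := hcov s x hx
    exact (((h b).reg0.cont a).continuousAt (((G' b).isOpen a).mem_nhds hx')).continuousWithinAt
  | succ m ih =>
    have hd : ∀ s, DifferentiableOn ℝ f (G.W s) := by
      intro s x hx
      obtain ⟨b, a, hx'⟩ := hcov s x hx
      exact ((h b).diff a hx').differentiableWithinAt
    refine Gauge.reg_succ_of_bdd (Gauge.bdd_of_cover hcov fun b => (h b).bdd) (fun s => hd s)
      fun i => ih fun b => ?_
    rw [← hr b]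
    exact (h b).2.2 i

theorem Gauge.creg_of_cover (hcov : ∀ s, ∀ x ∈ G.W s, ∃ b a, x ∈ (G' b).W a)
    (hr : ∀ b, (G' b).r = G.r) (hP : ∀ s p q d, ¬ G.P s p q d) {m : ℕ} {f : V n → ℝ}
    (h : ∀ b, (G' b).CReg m (fun _ => f)) : G.CReg m (fun _ => f) where
  bdd := Gauge.bdd_of_cover hcov fun b => (h b).bdd
  diff := (Gauge.reg_of_cover hcov hr hP fun b => (h b).reg).2.1
  pd i := Gauge.reg_of_cover hcov hr hP fun b => (h b).pd i

end Cover

theorem pd_comp {f : V n → ℝ} {ψ : V n → V n} {x : V n} (hf : DifferentiableAt ℝ f (ψ x))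
    (hψ : DifferentiableAt ℝ ψ x) (j : Fin (n + 1)) :
    pd j (fun y => f (ψ y)) x = ∑ c, pd j (fun y => ψ y c) x * pd c f (ψ x) := by
  have h1 : fderiv ℝ (fun y => f (ψ y)) x = (fderiv ℝ f (ψ x)).comp (fderiv ℝ ψ x) :=
    fderiv_comp x hf hψ
  simp only [pd, h1, ContinuousLinearMap.comp_apply]
  rw [clm_eq_sum]
  exact Finset.sum_congr rfl fun c _ => by rw [fderiv_coord hψ]

/-! ### Composition with changes of coordinates -/

section Comp

variable {G G' : Gauge n ι} {ψ : V n → V n}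

theorem contDiffOn_coord {D : Set (V n)} (hψ : ContDiffOn ℝ ∞ ψ D) (c : Fin (n + 1)) :
    ContDiffOn ℝ ∞ (fun x => ψ x c) D :=
  (EuclideanSpace.proj (𝕜 := ℝ) c : V n →L[ℝ] ℝ).contDiff.comp_contDiffOn hψ

theorem Gauge.differentiableAt_of_contDiffOn (hψ : ContDiffOn ℝ ∞ ψ G.D) {a : ι} {x : V n}
    (hx : x ∈ G.W a) : DifferentiableAt ℝ ψ x :=
  (hψ.differentiableOn (by simp)).differentiableAt
    (mem_of_superset ((G.isOpen a).mem_nhds hx) ((G.W_sub a).trans G.K_sub))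

/-- Weighted regularity is preserved by changes of coordinates that preserve the weight. -/
theorem Gauge.Reg.comp (hψ : ContDiffOn ℝ ∞ ψ G.D) (hmaps : ∀ a, MapsTo ψ (G.W a) (G'.W a))
    (hr : ∀ a, ∀ x ∈ G.W a, G'.r (ψ x) = G.r x) (hP : ∀ s p q d, ¬ G.P s p q d) {m : ℕ}
    {f : ι → V n → ℝ} (h : G'.Reg m f) : G.Reg m (fun a x => f a (ψ x)) := by
  have hb : ∀ {f : ι → V n → ℝ}, G'.Bdd f → G.Bdd (fun a x => f a (ψ x)) := fun ⟨C, hC⟩ =>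
    ⟨C, fun a x hx => hC a _ (hmaps a hx)⟩
  induction m generalizing f with
  | zero =>
    refine ⟨fun a => ?_, hb h.bdd, ⟨0, fun s p q d hd => (hP s p q d hd).elim⟩⟩
    exact (h.cont a).comp (fun x hx => (G.differentiableAt_of_contDiffOn hψ
      hx).continuousAt.continuousWithinAt) (hmaps a)
  | succ m ih =>
    refine Gauge.reg_succ_of_bdd (hb h.bdd) (fun a x hx => ?_) fun j => ?_
    · exact (DifferentiableAt.comp x (h.diff a (hmaps a hx))
        (G.differentiableAt_of_contDiffOn hψ hx)).differentiableWithinAt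
    -- As the weight is preserved, `r ∂_j (f ∘ ψ) = ∑ ∂_j ψ^c · (r ∂_c f) ∘ ψ`, and the Jacobian is
    -- smooth up to the boundary.
    · refine (Gauge.Reg.sum (s := Finset.univ) fun c _ =>
        (Gauge.reg_pd_of_contDiffOn (contDiffOn_coord hψ c) j m).mul
          (ih (h.2.2 c))).congr fun a x hx => ?_
      rw [pd_comp (h.diff a (hmaps a hx)) (G.differentiableAt_of_contDiffOn hψ hx),
        Finset.mul_sum]
      refine Finset.sum_congr rfl fun c _ => ?_
      rw [hr a x hx]
      ring

theorem Gauge.CReg.comp (hψ : ContDiffOn ℝ ∞ ψ G.D) (hmaps : ∀ a, MapsTo ψ (G.W a) (G'.W a))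
    (hr : ∀ a, ∀ x ∈ G.W a, G'.r (ψ x) = G.r x) (hP : ∀ s p q d, ¬ G.P s p q d) {m : ℕ}
    {f : ι → V n → ℝ} (h : G'.CReg m f) : G.CReg m (fun a x => f a (ψ x)) where
  bdd := (h.reg.comp hψ hmaps hr hP).bdd
  diff := (h.reg.comp hψ hmaps hr hP).2.1
  pd j := by
    refine (Gauge.Reg.sum (s := Finset.univ) fun c _ =>
      (Gauge.reg_pd_of_contDiffOn (contDiffOn_coord hψ c) j m).mul
        ((h.pd c).comp hψ hmaps hr hP)).congr fun a x hx => ?_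
    rw [pd_comp (h.diffAt a (hmaps a hx)) (G.differentiableAt_of_contDiffOn hψ hx)]

end Comp

end Transfer

/-! ### Local gauges in arbitrary charts -/

section LocalGauges

variable {n : ℕ} {Mbar : Type*} [TopologicalSpace Mbar]
  [ChartedSpace (EuclideanHalfSpace (n + 1)) Mbar] [IsManifold (𝓡∂ (n + 1)) ∞ Mbar]
  {ρ : Mbar → ℝ} {e : Chart n Mbar} {g : BilinField n Mbar}

/-- Small half-balls around the points of a chart, as a gauge. -/
theorem exists_ballGauge (hρ : IsDefiningFunction n ρ)
    (he : e ∈ IsManifold.maximalAtlas (𝓡∂ (n + 1)) ∞ Mbar) {x₀ : V n} (hx₀ : x₀ ∈ domBar e)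
    {N : Set Mbar} (hN : IsOpen N) (hxN : pt e x₀ ∈ N) {U : Set (V n)} (hU : U ∈ 𝓝 x₀) :
    ∃ ε, 0 < ε ∧ Metric.ball x₀ ε ⊆ U ∧ ∃ G : Gauge n Unit, G.D ⊆ domBar e ∩ pt e ⁻¹' N ∧
      (∀ a, G.W a = Metric.ball x₀ ε ∩ dom e) ∧ (G.r = fun x => ρ (pt e x)) ∧
      (∀ y ∈ Metric.ball x₀ ε, 0 ≤ y 0 → y ∈ domBar e) ∧
      ∀ s p q d, ¬ G.P s p q d := by
  obtain ⟨O, hO, hOe⟩ := exists_open_domBar e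
  obtain ⟨u, hu, hue⟩ := (continuousOn_iff'.1 (continuousOn_pt e)) N hN
  have hxu : x₀ ∈ u := (hue.subset ⟨hxN, hx₀⟩).1
  have hxO : x₀ ∈ O := (hOe ▸ hx₀ : x₀ ∈ O ∩ {y | 0 ≤ y 0}).1
  have hD : domBar e ∩ pt e ⁻¹' N = domBar e ∩ u := by
    rw [inter_comm, hue, inter_comm]
  obtain ⟨ε, hε, hsub⟩ := Metric.nhds_basis_closedBall.mem_iff.1
    (inter_mem (inter_mem (hO.mem_nhds hxO) (hu.mem_nhds hxu)) hU)
  have hK : Metric.closedBall x₀ ε ∩ {y : V n | 0 ≤ y 0} ⊆ domBar e ∩ pt e ⁻¹' N := by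
    rintro y ⟨hy, hy0⟩
    rw [hD, hOe]
    exact ⟨⟨(hsub hy).1.1, hy0⟩, (hsub hy).1.2⟩
  refine ⟨ε, hε, fun y hy => (hsub (Metric.ball_subset_closedBall hy)).2,
    { D := domBar e ∩ pt e ⁻¹' N
      uniq := by
        rw [hD]
        exact (uniqueDiffOn_domBar e).inter hu
      K := Metric.closedBall x₀ ε ∩ {y | 0 ≤ y 0}
      compact := (isCompact_closedBall x₀ ε).inter_right
        (isClosed_le continuous_const (by fun_prop))
      K_sub := hK
      W := fun _ => Metric.ball x₀ ε ∩ dom e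
      isOpen := fun _ => Metric.isOpen_ball.inter (isOpen_dom he)
      W_sub := fun _ y hy => ⟨Metric.ball_subset_closedBall hy.1, nonneg_of_mem_domBar hy.2.1⟩
      r := fun x => ρ (pt e x)
      r_smooth := (hρ.contDiffOn he).mono inter_subset_left
      r_pos := fun _ y hy => hρ.pos hy.2
      P := fun _ _ _ _ => False
      lip := ⟨0, le_rfl, fun _ _ _ _ h => h.elim⟩ }, Subset.rfl, fun _ => rfl, rfl,
    fun y hy hy0 => (hK ⟨Metric.ball_subset_closedBall hy, hy0⟩).1, fun _ _ _ _ h => h⟩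

/-- Regularity of the rescaled metric is preserved by changes of charts. -/
theorem creg_bar_of_trans {ι : Type} {G G' : Gauge n ι} {c : Chart n Mbar} {k : ℕ}
    (he : e ∈ IsManifold.maximalAtlas (𝓡∂ (n + 1)) ∞ Mbar)
    (hc : c ∈ IsManifold.maximalAtlas (𝓡∂ (n + 1)) ∞ Mbar)
    (hψ : ContDiffOn ℝ ∞ (trans e c) G.D) (hsrc : ∀ x ∈ G.D, pt e x ∈ c.source)
    (hd : ∀ a, G.W a ⊆ dom e) (hmaps : ∀ a, MapsTo (trans e c) (G.W a) (G'.W a))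
    (hr : ∀ a, ∀ x ∈ G.W a, G'.r (trans e c x) = G.r x) (hP : ∀ s p q d, ¬ G.P s p q d)
    (h : ∀ p q, G'.CReg k (fun _ x => bar ρ (metricTensor g) c x ![p, q] ![])) (i j) :
    G.CReg k (fun _ x => bar ρ (metricTensor g) e x ![i, j] ![]) := by
  refine (Gauge.CReg.sum (s := Finset.univ) fun p _ => Gauge.CReg.sum (s := Finset.univ)
    fun q _ => (Gauge.creg_pd_of_contDiffOn (contDiffOn_coord hψ p) i k).mul
      ((Gauge.creg_pd_of_contDiffOn (contDiffOn_coord hψ q) j k).mul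
        ((h p q).comp hψ hmaps hr hP))).congr fun a x hx => ?_
  have hs := hsrc x (G.K_sub (G.W_sub a hx))
  simp only [bar, fmul]
  rw [metricTensor_trans g he hc (hd a hx) hs i j, Finset.mul_sum]
  refine Finset.sum_congr rfl fun p _ => ?_
  rw [Finset.mul_sum]
  refine Finset.sum_congr rfl fun q _ => ?_
  rw [pt_trans hs]
  ring

variable {𝒜 : MobiusCover n ρ} {k : ℕ} {α : ℝ} [T2Space Mbar]

theorem isClosed_pieceCore (𝒜 : MobiusFamily n ρ) (hρ : IsDefiningFunction n ρ)
    (b : 𝒜.bgIdx ⊕ 𝒜.intIdx) : IsClosed (pt (pieceChart 𝒜 b) '' (pieceSystem 𝒜 hρ b).K) :=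
  ((pieceSystem 𝒜 hρ b).compact.image_of_continuousOn
    ((continuousOn_pt _).mono (pieceSystem 𝒜 hρ b).K_sub)).isClosed

/-- A neighbourhood that meets only those members of a finite closed cover that contain the
point. -/
theorem exists_nhd_of_closed_cover {X β : Type*} [TopologicalSpace X] [Finite β] {F s : β → Set X}
    (hF : ∀ b, IsClosed (F b)) (hs : ∀ b, IsOpen (s b)) (hFs : ∀ b, F b ⊆ s b) (p : X) :
    ∃ N, IsOpen N ∧ p ∈ N ∧ ∃ B : Set β, (∀ b ∈ B, N ⊆ s b) ∧
      ∀ q ∈ N, ∀ b, q ∈ F b → b ∈ B := by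
  refine ⟨(⋂ b : {b // p ∈ F b}, s b) ∩ ⋂ b : {b // p ∉ F b}, (F b)ᶜ,
    (isOpen_iInter_of_finite fun b : {b // p ∈ F b} => hs b).inter
      (isOpen_iInter_of_finite fun b : {b // p ∉ F b} => (hF b).isOpen_compl),
    ⟨mem_iInter.2 fun b => hFs b b.2, mem_iInter.2 fun b => b.2⟩, {b | p ∈ F b},
    fun b hb q hq => mem_iInter.1 hq.1 ⟨b, hb⟩, fun q hq b hqb => ?_⟩
  by_contra h
  exact mem_iInter.1 hq.2 ⟨b, h⟩ hqb

/-- Near a given point, only those charts of the family matter that are defined at the point. -/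
theorem exists_nhd_pieces (𝒜 : MobiusCover n ρ) (hρ : IsDefiningFunction n ρ) (hα : α ≤ 1)
    (p : Mbar) : ∃ N, IsOpen N ∧ p ∈ N ∧ ∃ B : Set (𝒜.bgIdx ⊕ 𝒜.intIdx),
      (∀ b ∈ B, N ⊆ (pieceChart 𝒜.toMobiusFamily b).source) ∧
      ∀ q ∈ N, q ∈ (𝓡∂ (n + 1)).interior Mbar → ∃ b ∈ B, ∃ a,
        ∃ x ∈ (pieceGauge 𝒜.toMobiusFamily hρ hα b).W a,
          pt (pieceChart 𝒜.toMobiusFamily b) x = q := by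
  have := 𝒜.bg_finite
  have := 𝒜.int_finite
  obtain ⟨N, hN, hpN, B, hB, hq⟩ := exists_nhd_of_closed_cover
    (isClosed_pieceCore 𝒜.toMobiusFamily hρ)
    (fun b => (pieceChart 𝒜.toMobiusFamily b).open_source) (fun b => by
      rintro _ ⟨y, hy, rfl⟩
      exact pt_mem_source ((pieceSystem 𝒜.toMobiusFamily hρ b).K_sub hy)) p
  refine ⟨N, hN, hpN, B, hB, fun q hqN hqi => ?_⟩
  obtain ⟨b, a, x, hx, hxq⟩ := exists_piece (𝒜 := 𝒜) hρ hα hqi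
  exact ⟨b, hq q hqN b ⟨x, (pieceGauge 𝒜.toMobiusFamily hρ hα b).W_sub a hx, hxq⟩, a, x, hx, hxq⟩

variable [CompactSpace Mbar]

/-- The metric is adapted to gauges of small half-balls in arbitrary charts. -/
theorem exists_adapted_ballGauge (hρ : IsDefiningFunction n ρ) (hα : α ≤ 1)
    (hg : IsWeaklyAH 𝒜 (k + 1) α g) (he : e ∈ IsManifold.maximalAtlas (𝓡∂ (n + 1)) ∞ Mbar)
    {x₀ : V n} (hx₀ : x₀ ∈ domBar e) {U : Set (V n)} (hU : U ∈ 𝓝 x₀) :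
    ∃ ε, 0 < ε ∧ Metric.ball x₀ ε ⊆ U ∧
      (∀ y ∈ Metric.ball x₀ ε, 0 ≤ y 0 → y ∈ domBar e) ∧ ∃ G : Gauge n Unit,
        (∀ a, G.W a = Metric.ball x₀ ε ∩ dom e) ∧ (G.r = fun x => ρ (pt e x)) ∧
        Adapted G e ρ (metricTensor g) k := by
  have := 𝒜.bg_finite
  have := 𝒜.int_finite
  obtain ⟨N, hN, hxN, B, hBs, hBc⟩ := exists_nhd_pieces 𝒜 hρ hα (pt e x₀)
  obtain ⟨ε, hε, hεU, G, hGD, hGW, hGr, hball, hGP⟩ := exists_ballGauge hρ he hx₀ hN hxN hU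
  refine ⟨ε, hε, hεU, hball, G, hGW, hGr, ?_⟩
  refine adapted_of_creg hg.metric hg.conformallyCompact he (hGD.trans inter_subset_left)
    (fun a => hGW a ▸ inter_subset_right) (fun a x _ => congrFun hGr x) fun i j => ?_
  have hWd : ∀ a, G.W a ⊆ dom e := fun a => hGW a ▸ inter_subset_right
  have hsrc : ∀ b : B, ∀ x ∈ G.D, pt e x ∈ (pieceChart 𝒜.toMobiusFamily b.1).source :=
    fun b x hx => hBs b b.2 (hGD hx).2
  have hWD : ∀ a, G.W a ⊆ G.D := fun a => (G.W_sub a).trans G.K_sub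
  have hψ : ∀ b : B, ContDiffOn ℝ ∞ (trans e (pieceChart 𝒜.toMobiusFamily b.1)) G.D := fun b =>
    (contDiffOn_trans he (pieceChart_mem 𝒜.toMobiusFamily b.1)).mono
      fun x hx => ⟨(hGD hx).1, hsrc b x hx⟩
  -- The half-ball is covered by the preimages of the ranges of the parametrizations by way of the
  -- charts in `B`. The neighbourhood `N` lies in the source of each of these charts, so every
  -- coordinate change is smooth on the whole of `G.D`.
  refine Gauge.creg_of_cover (G' := fun b : B =>
    G.onSubsets (fun a => G.W () ∩ trans e (pieceChart 𝒜.toMobiusFamily b.1) ⁻¹'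
        (pieceGauge 𝒜.toMobiusFamily hρ hα b.1).W a)
      (fun a => ((hψ b).continuousOn.mono (hWD ())).isOpen_inter_preimage (G.isOpen ())
        ((pieceGauge 𝒜.toMobiusFamily hρ hα b.1).isOpen a))
      (fun a => ⟨(), inter_subset_left⟩)) ?_ (fun b => rfl) hGP fun b => ?_
  · intro s x hx
    obtain ⟨b, hb, a, y, hy, hyx⟩ := hBc _ (hGD (hWD s hx)).2 (hWd s hx).2
    have h1 : trans e (pieceChart 𝒜.toMobiusFamily b) x = y := by
      rw [trans, ← hyx]
      exact extend_pt (pieceGauge_sub_dom hy).1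
    exact ⟨⟨b, hb⟩, a, hx, (congrArg (· ∈ _) h1).mpr hy⟩
  · refine creg_bar_of_trans (G' := pieceGauge 𝒜.toMobiusFamily hρ hα b.1) he
      (pieceChart_mem 𝒜.toMobiusFamily b.1) (hψ b) (hsrc b)
      (fun a => (inter_subset_left : G.W () ∩ _ ⊆ G.W ()).trans (hWd ()))
      (fun a => (inter_subset_right : G.W () ∩ _ ⊆ _)) ?_ (fun _ _ _ _ h => h)
      (adapted_pieceGauge hρ hα hg b.1).reg i j
    rintro a x ⟨hx, -⟩
    change ρ (pt _ _) = G.r x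
    rw [pt_trans (hsrc b x (hWD () hx)), hGr]

end LocalGauges

/-! ### The defining function and the height of a chart -/

section Height

variable {n : ℕ}

/-- The projection onto the boundary hyperplane. -/
def projBdry (y : V n) : V n := y - y 0 • coordVec n 0

@[simp] theorem projBdry_zero (y : V n) : projBdry y 0 = 0 := by simp [projBdry, coordVec]

theorem projBdry_of_eq_zero {y : V n} (h : y 0 = 0) : projBdry y = y := by simp [projBdry, h]

theorem continuous_projBdry : Continuous (projBdry : V n → V n) := by
  unfold projBdry
  fun_prop

theorem norm_coordVec (i : Fin (n + 1)) : ‖coordVec n i‖ = 1 := by simp [coordVec]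

theorem dist_projBdry (y : V n) : dist y (projBdry y) = |y 0| := by
  rw [dist_eq_norm, projBdry, sub_sub_cancel, norm_smul, norm_coordVec, mul_one, Real.norm_eq_abs]

theorem dist_projBdry_le {x₀ : V n} (h : x₀ 0 = 0) (y : V n) :
    dist (projBdry y) x₀ ≤ dist y x₀ := by
  rw [EuclideanSpace.dist_eq, EuclideanSpace.dist_eq]
  refine Real.sqrt_le_sqrt (Finset.sum_le_sum fun i _ => ?_)
  rcases eq_or_ne i 0 with rfl | hi
  · simpa [h] using sq_nonneg (y 0)
  · have : projBdry y i = y i := by simp [projBdry, coordVec, hi]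
    rw [this]

variable {Mbar : Type*} [TopologicalSpace Mbar] {e : Chart n Mbar} {x₀ : V n}

theorem nhdsWithin_domBar (hx : x₀ ∈ domBar e) :
    𝓝[domBar e] x₀ = 𝓝[{y : V n | 0 ≤ y 0}] x₀ := by
  rw [← range_model, nhdsWithin_eq_iff_eventuallyEq]
  exact (domBar_eventuallyEq hx).symm

variable [ChartedSpace (EuclideanHalfSpace (n + 1)) Mbar]

theorem tendsto_rho_boundary {ρ : Mbar → ℝ} (hρ : IsDefiningFunction n ρ)
    (he : e ∈ IsManifold.maximalAtlas (𝓡∂ (n + 1)) ∞ Mbar) (hx : x₀ ∈ domBdry e) :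
    Tendsto (fun y => ρ (pt e y)) (𝓝[domBar e] x₀) (𝓝 0) := by
  have h1 := (hρ.contDiffOn he).continuousOn x₀ hx.1
  have h2 : ρ (pt e x₀) = 0 := (hρ.zero_iff _).2 hx.2
  rw [ContinuousWithinAt, h2] at h1
  exact h1

variable [IsManifold (𝓡∂ (n + 1)) ∞ Mbar]

theorem mem_closure_dom (he : e ∈ IsManifold.maximalAtlas (𝓡∂ (n + 1)) ∞ Mbar)
    (hx : x₀ ∈ domBar e) : x₀ ∈ closure (dom e) := by
  obtain ⟨O, hO, h⟩ := exists_open_domBar e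
  have hd : dom e = O ∩ {x | 0 < x 0} := by
    rw [dom_eq he, h]
    ext x
    exact ⟨fun hx => ⟨hx.1.1, hx.2⟩, fun hx => ⟨⟨hx.1, (show 0 < x 0 from hx.2).le⟩, hx.2⟩⟩
  rw [hd]
  rw [h] at hx
  refine hO.inter_closure ⟨hx.1, ?_⟩
  have h1 : Tendsto (fun t : ℝ => x₀ + t • coordVec n 0) (𝓝[>] 0) (𝓝 x₀) := by
    have : Continuous fun t : ℝ => x₀ + t • coordVec n 0 := by fun_prop
    simpa using (this.tendsto 0).mono_left nhdsWithin_le_nhds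
  refine mem_closure_of_tendsto h1 ?_
  filter_upwards [self_mem_nhdsWithin] with t ht
  have h2 : (x₀ + t • coordVec n 0) 0 = x₀ 0 + t := by simp [coordVec]
  change 0 < (x₀ + t • coordVec n 0) 0
  rw [h2]
  exact add_pos_of_nonneg_of_pos hx.2 ht

variable {ρ : Mbar → ℝ} [T2Space Mbar]

/-- Boundary points lie in the background charts. -/
theorem exists_bgChart_of_boundary (𝒜 : MobiusCover n ρ) (hρ : IsDefiningFunction n ρ)
    (he : e ∈ IsManifold.maximalAtlas (𝓡∂ (n + 1)) ∞ Mbar) (hx : x₀ ∈ domBdry e) :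
    ∃ i, pt e x₀ ∈ (𝒜.bgChart i).source := by
  have := 𝒜.bg_finite
  have := 𝒜.int_finite
  -- A finite union of compact cores is closed and contains the interior, hence also its limit
  -- points on the boundary. The cores of the interior charts contain no boundary points.
  have h1 : IsClosed (⋃ b, pt (pieceChart 𝒜.toMobiusFamily b) ''
      (pieceSystem 𝒜.toMobiusFamily hρ b).K) :=
    isClosed_iUnion_of_finite (isClosed_pieceCore 𝒜.toMobiusFamily hρ)
  have h2 : ∀ q ∈ (𝓡∂ (n + 1)).interior Mbar, q ∈ ⋃ b, pt (pieceChart 𝒜.toMobiusFamily b) ''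
      (pieceSystem 𝒜.toMobiusFamily hρ b).K := by
    intro q hq
    obtain ⟨b, a, x, hx, rfl⟩ := exists_piece (𝒜 := 𝒜) hρ zero_le_one hq
    exact mem_iUnion.2 ⟨b, mem_image_of_mem _
      ((pieceGauge 𝒜.toMobiusFamily hρ zero_le_one b).W_sub a hx)⟩
  have h3 : pt e x₀ ∈ ⋃ b, pt (pieceChart 𝒜.toMobiusFamily b) ''
      (pieceSystem 𝒜.toMobiusFamily hρ b).K := by
    have := mem_closure_iff_nhdsWithin_neBot.1 (mem_closure_dom he hx.1)
    refine h1.mem_of_tendsto ((continuousOn_pt e x₀ hx.1).mono_left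
      (nhdsWithin_mono x₀ fun y (hy : y ∈ dom e) => hy.1)) ?_
    filter_upwards [self_mem_nhdsWithin] with y hy using h2 _ hy.2
  obtain ⟨b | b, y, hy, hyx⟩ := mem_iUnion.1 h3
  · refine ⟨b, hyx ▸ pt_mem_source (𝒜.bgCore_subset b hy)⟩
  · have h4 : pt e x₀ ∈ (𝓡∂ (n + 1)).interior Mbar :=
      hyx ▸ (hypClosedBall_subset_dom 𝒜.toMobiusFamily b hy).2
    rw [← ModelWithCorners.compl_boundary] at h4
    exact (h4 hx.2).elim

/-- The height of a chart is `O(ρ)` at the boundary. -/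
theorem height_le_rho (𝒜 : MobiusCover n ρ) (hρ : IsDefiningFunction n ρ)
    (he : e ∈ IsManifold.maximalAtlas (𝓡∂ (n + 1)) ∞ Mbar) (hx : x₀ ∈ domBdry e) :
    ∃ C, 0 ≤ C ∧ ∀ᶠ y in 𝓝[domBar e] x₀, y 0 ≤ C * ρ (pt e y) := by
  obtain ⟨i, hi⟩ := exists_bgChart_of_boundary 𝒜 hρ he hx
  set c := 𝒜.bgChart i with hc
  have hcm : c ∈ IsManifold.maximalAtlas (𝓡∂ (n + 1)) ∞ Mbar := 𝒜.bgChart_mem i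
  set z₀ := trans e c x₀ with hz₀
  have hz₀c : z₀ ∈ domBar c := trans_mem_domBar hi
  have hpz₀ : pt c z₀ = pt e x₀ := pt_trans hi
  have hz₀0 : z₀ 0 = 0 := by
    have : z₀ ∈ domBdry c := ⟨hz₀c, by rw [hpz₀]; exact hx.2⟩
    rw [domBdry_eq hcm] at this
    exact this.2
  have hmem : domBar c ∩ pt c ⁻¹' e.source ∈ 𝓝[{y : V n | 0 ≤ y 0}] z₀ := by
    rw [← nhdsWithin_domBar hz₀c]
    exact inter_mem self_mem_nhdsWithin ((continuousOn_pt c z₀ hz₀c).preimage_mem_nhdsWithin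
      (e.open_source.mem_nhds (by rw [hpz₀]; exact pt_mem_source hx.1)))
  have hsm : ContDiffWithinAt ℝ 1 (fun z => trans c e z 0) {y : V n | 0 ≤ y 0} z₀ := by
    have h1 := (contDiffOn_coord (contDiffOn_trans hcm he) 0) z₀
      ⟨hz₀c, by rw [mem_preimage, hpz₀]; exact pt_mem_source hx.1⟩
    exact (h1.of_le (by simp)).mono_of_mem_nhdsWithin hmem
  -- The height of `e`, as a function in the background chart, is Lipschitz near `z₀` and vanishes
  -- on the boundary hyperplane. Hence it is at most `L` times the height of the background chart,
  -- which is `ρ`.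
  obtain ⟨L, t, ht, hL⟩ := hsm.exists_lipschitzOnWith convex_halfSpace
  have hproj : Tendsto (projBdry : V n → V n) (𝓝[{y : V n | 0 ≤ y 0}] z₀)
      (𝓝[{y : V n | 0 ≤ y 0}] z₀) := by
    refine tendsto_nhdsWithin_of_tendsto_nhds_of_eventually_within _ ?_ ?_
    · have := continuous_projBdry.tendsto z₀
      rw [projBdry_of_eq_zero hz₀0] at this
      exact this.mono_left nhdsWithin_le_nhds
    · exact Eventually.of_forall fun z => (projBdry_zero z).ge
  have hev : ∀ᶠ z in 𝓝[{y : V n | 0 ≤ y 0}] z₀, trans c e z 0 ≤ L * z 0 := by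
    filter_upwards [self_mem_nhdsWithin, ht, hproj.eventually ht, hproj.eventually hmem]
      with z hz0 hz hpz hpz'
    have h1 : projBdry z ∈ domBdry c := by
      rw [domBdry_eq hcm]
      exact ⟨hpz'.1, projBdry_zero z⟩
    have h2 : trans c e (projBdry z) ∈ domBdry e :=
      ⟨trans_mem_domBar hpz'.2, by rw [pt_trans hpz'.2]; exact h1.2⟩
    rw [domBdry_eq he] at h2
    have h3 := hL.dist_le_mul z hz _ hpz
    rw [dist_projBdry, abs_of_nonneg hz0, h2.2, Real.dist_eq, sub_zero] at h3
    exact (le_abs_self _).trans h3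
  have hsrc : pt e ⁻¹' c.source ∈ 𝓝[domBar e] x₀ :=
    (continuousOn_pt e x₀ hx.1).preimage_mem_nhdsWithin (c.open_source.mem_nhds hi)
  have htr : Tendsto (trans e c) (𝓝[domBar e] x₀) (𝓝[{y : V n | 0 ≤ y 0}] z₀) := by
    refine tendsto_nhdsWithin_of_tendsto_nhds_of_eventually_within _ ?_ ?_
    · have h1 : Tendsto (trans e c) (𝓝[domBar e ∩ pt e ⁻¹' c.source] x₀) (𝓝 z₀) :=
        (contDiffOn_trans he hcm).continuousOn x₀ ⟨hx.1, hi⟩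
      rwa [nhdsWithin_inter_of_mem' hsrc] at h1
    · filter_upwards [hsrc] with y hy using nonneg_of_mem_domBar (trans_mem_domBar hy)
  refine ⟨L, L.coe_nonneg, ?_⟩
  filter_upwards [htr.eventually hev, hsrc, self_mem_nhdsWithin] with y hy hys hyd
  have h1 : trans c e (trans e c y) = y := by
    rw [trans, pt_trans hys]
    exact extend_pt hyd
  rwa [h1, trans, 𝒜.bgChart_coord i _ hys] at hy

end Height

/-! ### The gradient of the defining function -/

section Gradient

variable {n : ℕ} {Mbar : Type*} [TopologicalSpace Mbar]
  [ChartedSpace (EuclideanHalfSpace (n + 1)) Mbar] [IsManifold (𝓡∂ (n + 1)) ∞ Mbar]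
  {ρ : Mbar → ℝ} {e : Chart n Mbar} {g : BilinField n Mbar} {𝒜 : MobiusCover n ρ} {m : ℕ} {α : ℝ}
  [T2Space Mbar] [CompactSpace Mbar] {x₀ : V n}

/-- The asymptotic condition on the curvature implies `|dρ|² → 1`. -/
theorem tendsto_gradNormSq (hn : 1 ≤ n) (hρ : IsDefiningFunction n ρ) (hα : α ≤ 1)
    (hg : IsWeaklyAH 𝒜 (m + 2) α g) (he : e ∈ IsManifold.maximalAtlas (𝓡∂ (n + 1)) ∞ Mbar)
    (hx : x₀ ∈ domBdry e) :
    Tendsto (fun y => gradNormSq (bar ρ (metricTensor g)) ρ e y ![] ![]) (𝓝[dom e] x₀) (𝓝 1) := by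
  obtain ⟨ε, hε, -, -, G, hGW, hGr, hT⟩ :=
    exists_adapted_ballGauge hρ hα hg he hx.1 (U := univ) univ_mem
  -- As `n ≥ 1`, there is a second index, and the component of `Id` for the pair `(0, i)` is `1`;
  -- that component of `riem_add_id_eq` isolates `1 - |dρ|²`.
  obtain ⟨i, hi⟩ : ∃ i : Fin (n + 1), i ≠ 0 := ⟨Fin.last n, by
    intro h
    have := congrArg Fin.val h
    simp at this
    omega⟩
  obtain ⟨C, hC0, hC⟩ := (hT.reg_riemReg ![0, i] ![0, i]).bdd.exists_nonneg
  have hid : (idTensor : ChartTensor n Mbar 2 2) e x₀ ![0, i] ![0, i] = 1 := by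
    simp [idTensor, kron, hi, hi.symm]
  have h1 := hg.riem_tendsto e he x₀ hx ![0, i] ![0, i]
  have h2 : Tendsto (fun y => ρ (pt e y) * Adapted.riemReg G e ρ (metricTensor g) y ![0, i] ![0, i])
      (𝓝[dom e] x₀) (𝓝 0) := by
    have h3 : Tendsto (fun y => C * ρ (pt e y)) (𝓝[dom e] x₀) (𝓝 0) := by
      simpa using ((tendsto_rho_boundary hρ he hx).mono_left
        (nhdsWithin_mono x₀ fun y (hy : y ∈ dom e) => hy.1)).const_mul C
    refine squeeze_zero_norm' ?_ h3
    filter_upwards [inter_mem_nhdsWithin (dom e) (Metric.ball_mem_nhds x₀ hε)] with y hy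
    have hyW : y ∈ G.W () := by rw [hGW]; exact ⟨hy.2, hy.1⟩
    rw [norm_mul, Real.norm_of_nonneg (hρ.nonneg _), mul_comm]
    exact mul_le_mul_of_nonneg_right (hC () y hyW) (hρ.nonneg _)
  have h3 := (tendsto_const_nhds (x := (1 : ℝ))).sub (h1.sub h2)
  rw [sub_zero, sub_zero] at h3
  refine h3.congr' ?_
  filter_upwards [inter_mem_nhdsWithin (dom e) (Metric.ball_mem_nhds x₀ hε)] with y hy
  have hyW : y ∈ G.W () := by rw [hGW]; exact ⟨hy.2, hy.1⟩
  have hid' : (idTensor : ChartTensor n Mbar 2 2) e y ![0, i] ![0, i] = 1 := hid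
  rw [hT.riem_add_id_eq hyW, hid', hGr]
  ring

/-- Near every point of a chart, `|dρ|² - 1` is `O(ρ)`. -/
theorem gradNormSq_sub_one_le (hn : 1 ≤ n) (hρ : IsDefiningFunction n ρ) (hα : α ≤ 1)
    (hg : IsWeaklyAH 𝒜 (m + 2) α g) (he : e ∈ IsManifold.maximalAtlas (𝓡∂ (n + 1)) ∞ Mbar)
    (hx : x₀ ∈ domBar e) : ∃ C, ∀ᶠ y in 𝓝 x₀, y ∈ dom e →
      |gradNormSq (bar ρ (metricTensor g)) ρ e y ![] ![] - 1| ≤ C * ρ (pt e y) := by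
  obtain ⟨ε, hε, -, hball, G, hGW, hGr, hT⟩ :=
    exists_adapted_ballGauge hρ hα hg he hx (U := univ) univ_mem
  set N : V n → ℝ := fun y => gradNormSq (bar ρ (metricTensor g)) ρ e y ![] ![] with hN
  have hNC : G.CReg (m + 1) (fun _ => N) := hT.creg_gradNormSq ![] ![]
  by_cases hxd : x₀ ∈ dom e
  · obtain ⟨C, hC0, hC⟩ := hNC.bdd.exists_nonneg
    have h0 := hρ.pos hxd
    -- Near an interior point `ρ` exceeds half of its value there, so every bounded function is
    -- `O(ρ)`.
    refine ⟨(C + 1) * (2 / ρ (pt e x₀)), ?_⟩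
    have hcont : ContinuousAt (fun y => ρ (pt e y)) x₀ :=
      (hρ.contDiffOn he).continuousOn.continuousAt
        (mem_of_superset ((isOpen_dom he).mem_nhds hxd) fun y hy => hy.1)
    filter_upwards [Metric.ball_mem_nhds x₀ hε, hcont.eventually (lt_mem_nhds (half_lt_self h0))]
      with y hy hy2 hyd
    have h1 := hC () y (by rw [hGW]; exact ⟨hy, hyd⟩)
    have h2 : |N y - 1| ≤ C + 1 := (abs_sub _ _).trans (by simpa using h1)
    have h3 : 1 ≤ 2 / ρ (pt e x₀) * ρ (pt e y) := by
      rw [div_mul_eq_mul_div, le_div_iff₀ h0]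
      linarith
    rw [mul_assoc]
    exact h2.trans (le_mul_of_one_le_right (by positivity) h3)
  · have hxb : x₀ ∈ domBdry e := by
      refine ⟨hx, ?_⟩
      rw [← ModelWithCorners.compl_interior]
      exact fun h => hxd ⟨hx, h⟩
    have hx0 : x₀ 0 = 0 := by
      have h := hxb
      rw [domBdry_eq he] at h
      exact h.2
    obtain ⟨A, hA0, hA⟩ := height_le_rho 𝒜 hρ he hxb
    choose B hB0 hB using fun i => (hNC.pd i).bdd.exists_nonneg
    set L := (n + 1) * ∑ i, B i with hL
    have hL0 : 0 ≤ L := mul_nonneg (by positivity) (Finset.sum_nonneg fun i _ => hB0 i)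
    have hW : Metric.ball x₀ ε ∩ dom e = Metric.ball x₀ ε ∩ {y | 0 < y 0} := by
      ext y
      rw [dom_eq he]
      exact ⟨fun hy => ⟨hy.1, hy.2.2⟩, fun hy =>
        ⟨hy.1, hball y hy.1 (show 0 < y 0 from hy.2).le, hy.2⟩⟩
    have hconv : Convex ℝ (Metric.ball x₀ ε ∩ dom e) := by
      rw [hW]
      exact (convex_ball x₀ ε).inter (convex_halfSpace_gt
        (EuclideanSpace.proj (𝕜 := ℝ) (0 : Fin (n + 1)) : V n →L[ℝ] ℝ).isBoundedLinearMap.toIsLinearMap 0)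
    -- Near a boundary point the domain is a convex half-ball, and the unweighted bounds on the
    -- partial derivatives make `|dρ|²` Lipschitz there.
    have hlip : ∀ y ∈ Metric.ball x₀ ε ∩ dom e, ∀ z ∈ Metric.ball x₀ ε ∩ dom e,
        |N z - N y| ≤ L * dist z y := by
      intro y hy z hz
      rw [dist_eq_norm]
      refine hconv.norm_image_sub_le_of_norm_fderiv_le (f := N) (fun w hw =>
        hNC.diffAt () (by rw [hGW]; exact hw)) (fun w hw => norm_clm_le fun i => ?_) hy hz
      exact (hB i () w (by rw [hGW]; exact hw)).trans
        (Finset.single_le_sum (fun j _ => hB0 j) (Finset.mem_univ i))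
    have key : ∀ y ∈ Metric.ball x₀ ε ∩ dom e, |N y - 1| ≤ L * y 0 := by
      intro y hy
      have hy0 : 0 < y 0 := (hW ▸ hy : y ∈ Metric.ball x₀ ε ∩ {y | 0 < y 0}).2
      have hp : projBdry y ∈ Metric.ball x₀ ε := (dist_projBdry_le hx0 y).trans_lt hy.1
      have hpb : projBdry y ∈ domBdry e := by
        rw [domBdry_eq he]
        exact ⟨hball _ hp (projBdry_zero y).ge, projBdry_zero y⟩
      have hmem : ∀ s ∈ Ioc (0 : ℝ) 1, projBdry y + s • (y - projBdry y) ∈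
          Metric.ball x₀ ε ∩ dom e := by
        intro s hs
        rw [hW]
        refine ⟨(convex_ball x₀ ε).add_smul_sub_mem hp hy.1 ⟨hs.1.le, hs.2⟩, ?_⟩
        have : (projBdry y + s • (y - projBdry y)) 0 = s * y 0 := by simp
        change 0 < (projBdry y + s • (y - projBdry y)) 0
        rw [this]
        exact mul_pos hs.1 hy0
      have hlim : Tendsto (fun s : ℝ => projBdry y + s • (y - projBdry y)) (𝓝[>] 0)
          (𝓝[dom e] (projBdry y)) := by
        refine tendsto_nhdsWithin_of_tendsto_nhds_of_eventually_within _ ?_ ?_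
        · have : Continuous fun s : ℝ => projBdry y + s • (y - projBdry y) := by fun_prop
          simpa using (this.tendsto 0).mono_left nhdsWithin_le_nhds
        · filter_upwards [Ioc_mem_nhdsGT one_pos] with s hs using (hmem s hs).2
      -- Moving down the vertical segment to the boundary, `|dρ|²` tends to `1`, so the Lipschitz
      -- bound compares its value at `y` with `1`.
      have h1 : Tendsto (fun s : ℝ => |N y - N (projBdry y + s • (y - projBdry y))|) (𝓝[>] 0)
          (𝓝 |N y - 1|) :=
        (tendsto_const_nhds.sub ((tendsto_gradNormSq hn hρ hα hg he hpb).comp hlim)).abs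
      refine le_of_tendsto h1 ?_
      filter_upwards [Ioc_mem_nhdsGT one_pos] with s hs
      refine (hlip _ (hmem s hs) y hy).trans (mul_le_mul_of_nonneg_left ?_ hL0)
      have h2 : y - (projBdry y + s • (y - projBdry y)) = (1 - s) • (y - projBdry y) := by
        rw [sub_smul, one_smul]
        abel
      rw [dist_eq_norm, h2, norm_smul, ← dist_eq_norm y, dist_projBdry, abs_of_pos hy0,
        Real.norm_of_nonneg (by linarith [hs.2])]
      exact mul_le_of_le_one_left hy0.le (by linarith [hs.1])
    refine ⟨L * A, ?_⟩
    filter_upwards [Metric.ball_mem_nhds x₀ hε, eventually_nhdsWithin_iff.1 hA] with y hy hyA hyd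
    rw [mul_assoc]
    exact (key y ⟨hy, hyd⟩).trans (mul_le_mul_of_nonneg_left (hyA hyd.1) hL0)

/-- On compact subsets of a chart, `|dρ|² - 1` is `O(ρ)`. -/
theorem gradNormSq_sub_one_le_of_isCompact (hn : 1 ≤ n) (hρ : IsDefiningFunction n ρ) (hα : α ≤ 1)
    (hg : IsWeaklyAH 𝒜 (m + 2) α g) (he : e ∈ IsManifold.maximalAtlas (𝓡∂ (n + 1)) ∞ Mbar)
    {K : Set (V n)} (hK : IsCompact K) (hKe : K ⊆ domBar e) : ∃ C, ∀ y ∈ K, y ∈ dom e →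
      |gradNormSq (bar ρ (metricTensor g)) ρ e y ![] ![] - 1| ≤ C * ρ (pt e y) := by
  refine hK.induction_on (p := fun s => ∃ C, ∀ y ∈ s, y ∈ dom e →
    |gradNormSq (bar ρ (metricTensor g)) ρ e y ![] ![] - 1| ≤ C * ρ (pt e y)) ⟨0, by simp⟩ ?_ ?_ ?_
  · rintro s t hst ⟨C, hC⟩
    exact ⟨C, fun y hy => hC y (hst hy)⟩
  · rintro s t ⟨A, hA⟩ ⟨B, hB⟩
    refine ⟨max A B, ?_⟩
    rintro y (hy | hy) hyd
    · exact (hA y hy hyd).trans (mul_le_mul_of_nonneg_right (le_max_left _ _) (hρ.nonneg _))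
    · exact (hB y hy hyd).trans (mul_le_mul_of_nonneg_right (le_max_right _ _) (hρ.nonneg _))
  · intro x hx
    obtain ⟨C, hC⟩ := gradNormSq_sub_one_le hn hρ hα hg he (hKe hx)
    exact ⟨_, mem_nhdsWithin_of_mem_nhds hC, C, fun y hy => hy⟩

end Gradient

/-! ### Conclusion -/

section LocalBounds

variable {n : ℕ} {Mbar : Type*} [TopologicalSpace Mbar]
  [ChartedSpace (EuclideanHalfSpace (n + 1)) Mbar] {ρ : Mbar → ℝ}

theorem isBigOAtBoundary_of_local (hρ : IsDefiningFunction n ρ) {r s : ℕ}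
    {T : ChartTensor n Mbar r s}
    (h : ∀ e ∈ IsManifold.maximalAtlas (𝓡∂ (n + 1)) ∞ Mbar, ∀ x₀ ∈ domBar e, ∀ I J,
      ∃ C, ∃ O ∈ 𝓝 x₀, ContinuousOn (fun y => T e y I J) (O ∩ dom e) ∧
        ∀ y ∈ O ∩ dom e, |T e y I J| ≤ C * ρ (pt e y)) :
    IsBigOAtBoundary T ρ := by
  intro e he x hx I J
  obtain ⟨C, O, hO, -, hb⟩ := h e he x hx.1 I J
  refine Asymptotics.IsBigO.of_bound C ?_
  filter_upwards [mem_nhdsWithin_of_mem_nhds hO, self_mem_nhdsWithin] with y hy hyd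
  rw [Real.norm_of_nonneg (hρ.nonneg _)]
  exact hb y ⟨hy, hyd⟩

variable [IsManifold (𝓡∂ (n + 1)) ∞ Mbar]

/-- The bound by `ρ` forces the components to zero at the boundary, so the extension by zero is
continuous. -/
theorem extendsContinuously_of_local (hρ : IsDefiningFunction n ρ) {r s : ℕ}
    {T : ChartTensor n Mbar r s}
    (h : ∀ e ∈ IsManifold.maximalAtlas (𝓡∂ (n + 1)) ∞ Mbar, ∀ x₀ ∈ domBar e, ∀ I J,
      ∃ C, ∃ O ∈ 𝓝 x₀, ContinuousOn (fun y => T e y I J) (O ∩ dom e) ∧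
        ∀ y ∈ O ∩ dom e, |T e y I J| ≤ C * ρ (pt e y)) :
    ExtendsContinuously T := by
  classical
  intro e he I J
  refine ⟨fun y => if y ∈ dom e then T e y I J else 0, fun x hx => ?_, fun x hx => if_pos hx⟩
  obtain ⟨C, O, hO, hc, hb⟩ := h e he x hx I J
  by_cases hxd : x ∈ dom e
  · have hd := (isOpen_dom he).mem_nhds hxd
    have h1 : ContinuousAt (fun y => T e y I J) x := hc.continuousAt (inter_mem hO hd)
    refine (h1.congr ?_).continuousWithinAt
    filter_upwards [hd] with y hy using (if_pos hy).symm
  · have hxb : x ∈ domBdry e := by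
      refine ⟨hx, ?_⟩
      rw [← ModelWithCorners.compl_interior]
      exact fun h' => hxd ⟨hx, h'⟩
    rw [ContinuousWithinAt, if_neg hxd]
    have h2 : Tendsto (fun y => |C| * ρ (pt e y)) (𝓝[domBar e] x) (𝓝 0) := by
      simpa using (tendsto_rho_boundary hρ he hxb).const_mul |C|
    refine squeeze_zero_norm' ?_ h2
    filter_upwards [mem_nhdsWithin_of_mem_nhds hO] with y hy
    split_ifs with hyd
    · exact (hb y ⟨hy, hyd⟩).trans
        (mul_le_mul_of_nonneg_right (le_abs_self C) (hρ.nonneg _))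
    · rw [norm_zero]
      exact mul_nonneg (abs_nonneg C) (hρ.nonneg _)

end LocalBounds

section Conclusion

variable {n : ℕ} {Mbar : Type*} [TopologicalSpace Mbar]
  [ChartedSpace (EuclideanHalfSpace (n + 1)) Mbar] [IsManifold (𝓡∂ (n + 1)) ∞ Mbar]
  {ρ : Mbar → ℝ} {e : Chart n Mbar} {g : BilinField n Mbar} {𝒜 : MobiusCover n ρ} {m : ℕ} {α : ℝ}
  [T2Space Mbar] [CompactSpace Mbar]

theorem gradNormSq_sub_one_le_pieceGauge (hn : 1 ≤ n) (hρ : IsDefiningFunction n ρ) (hα : α ≤ 1)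
    (hg : IsWeaklyAH 𝒜 (m + 2) α g) (b : 𝒜.bgIdx ⊕ 𝒜.intIdx) :
    ∃ C, ∀ a, ∀ x ∈ (pieceGauge 𝒜.toMobiusFamily hρ hα b).W a,
      |gradNormSq (bar ρ (metricTensor g)) ρ (pieceChart 𝒜.toMobiusFamily b) x ![] ![] - 1|
        ≤ C * (pieceGauge 𝒜.toMobiusFamily hρ hα b).r x := by
  obtain ⟨C, hC⟩ := gradNormSq_sub_one_le_of_isCompact hn hρ hα hg
    (pieceChart_mem 𝒜.toMobiusFamily b) (pieceSystem 𝒜.toMobiusFamily hρ b).compact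
    (pieceSystem 𝒜.toMobiusFamily hρ b).K_sub
  exact ⟨C, fun a x hx => hC x ((pieceGauge 𝒜.toMobiusFamily hρ hα b).W_sub a hx)
    (pieceGauge_sub_dom hx)⟩

theorem reg_riem_pieceGauge (hn : 1 ≤ n) (hρ : IsDefiningFunction n ρ) (hα : α ≤ 1)
    (hg : IsWeaklyAH 𝒜 (m + 2) α g) (b : 𝒜.bgIdx ⊕ 𝒜.intIdx) (I J) :
    (pieceGauge 𝒜.toMobiusFamily hρ hα b).Reg m (fun _ x =>
      ((pieceGauge 𝒜.toMobiusFamily hρ hα b).r x)⁻¹ *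
        (riem (metricTensor g) + idTensor : ChartTensor n Mbar 2 2)
          (pieceChart 𝒜.toMobiusFamily b) x I J) :=
  (adapted_pieceGauge hρ hα hg b).reg_riem_add_id
    (gradNormSq_sub_one_le_pieceGauge hn hρ hα hg b) I J

theorem reg_ric_pieceGauge (hn : 1 ≤ n) (hρ : IsDefiningFunction n ρ) (hα : α ≤ 1)
    (hg : IsWeaklyAH 𝒜 (m + 2) α g) (b : 𝒜.bgIdx ⊕ 𝒜.intIdx) (I J) :
    (pieceGauge 𝒜.toMobiusFamily hρ hα b).Reg m (fun _ x =>
      ((pieceGauge 𝒜.toMobiusFamily hρ hα b).r x)⁻¹ *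
        (ric (metricTensor g) + (n : ℝ) • deltaTensor : ChartTensor n Mbar 1 1)
          (pieceChart 𝒜.toMobiusFamily b) x I J) := by
  simp only [ric_add_eq, Finset.mul_sum]
  exact Gauge.Reg.sum fun j _ => reg_riem_pieceGauge hn hρ hα hg b _ _

theorem reg_scal_pieceGauge (hn : 1 ≤ n) (hρ : IsDefiningFunction n ρ) (hα : α ≤ 1)
    (hg : IsWeaklyAH 𝒜 (m + 2) α g) (b : 𝒜.bgIdx ⊕ 𝒜.intIdx) (I J) :
    (pieceGauge 𝒜.toMobiusFamily hρ hα b).Reg m (fun _ x =>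
      ((pieceGauge 𝒜.toMobiusFamily hρ hα b).r x)⁻¹ *
        (scal (metricTensor g) + constTensor ((n : ℝ) * (n + 1)) : ChartTensor n Mbar 0 0)
          (pieceChart 𝒜.toMobiusFamily b) x I J) := by
  simp only [scal_add_eq, Finset.mul_sum]
  exact Gauge.Reg.sum fun j _ => reg_ric_pieceGauge hn hρ hα hg b _ _

/-- Nothing is lost here: `|dρ|²` contains no derivative of `ḡ`, its first derivatives have order `m
+ 1`, and division by the weight recovers the full order `m + 2`. -/
theorem reg_gradNormSq_pieceGauge (hn : 1 ≤ n) (hρ : IsDefiningFunction n ρ) (hα : α ≤ 1)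
    (hg : IsWeaklyAH 𝒜 (m + 2) α g) (b : 𝒜.bgIdx ⊕ 𝒜.intIdx) (I J) :
    (pieceGauge 𝒜.toMobiusFamily hρ hα b).Reg (m + 2) (fun _ x =>
      ((pieceGauge 𝒜.toMobiusFamily hρ hα b).r x)⁻¹ *
        (gradNormSq (gBar ρ g) ρ - constTensor 1 : ChartTensor n Mbar 0 0)
          (pieceChart 𝒜.toMobiusFamily b) x I J) :=
  Gauge.CReg.div_r (((adapted_pieceGauge hρ hα hg b).creg_gradNormSq I J).sub
    (Gauge.creg_const 1 _)) (gradNormSq_sub_one_le_pieceGauge hn hρ hα hg b)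

/-- The rescaled covariant derivatives of the curvature are continuous and `O(ρ)` near every point
of a chart. -/
theorem covDerivIter_riem_local (hn : 1 ≤ n) (hρ : IsDefiningFunction n ρ) (hα : α ≤ 1)
    (hg : IsWeaklyAH 𝒜 (m + 2) α g) (he : e ∈ IsManifold.maximalAtlas (𝓡∂ (n + 1)) ∞ Mbar)
    {x₀ : V n} (hx : x₀ ∈ domBar e) {j : ℕ} (hj : 1 ≤ j) (hjm : j ≤ m) (I J) :
    ∃ C, ∃ O ∈ 𝓝 x₀,
      ContinuousOn (fun y => fmul (fun p => ρ p ^ j)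
        (covDerivIter (metricTensor g) (riem (metricTensor g)) j) e y I J) (O ∩ dom e) ∧
      ∀ y ∈ O ∩ dom e, |fmul (fun p => ρ p ^ j)
        (covDerivIter (metricTensor g) (riem (metricTensor g)) j) e y I J| ≤ C * ρ (pt e y) := by
  obtain ⟨A, hA⟩ := gradNormSq_sub_one_le hn hρ hα hg he hx
  obtain ⟨ε, hε, hεA, -, G, hGW, hGr, hT⟩ := exists_adapted_ballGauge hρ hα hg he hx hA
  have hN : ∃ C, ∀ a, ∀ x ∈ G.W a,
      |gradNormSq (bar ρ (metricTensor g)) ρ e x ![] ![] - 1| ≤ C * G.r x := by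
    refine ⟨A, fun a x hx => ?_⟩
    rw [hGW] at hx
    rw [hGr]
    exact hεA hx.1 hx.2
  have h1 := hT.reg_covDerivIter_riem hN hj hjm I J
  obtain ⟨C, hC⟩ := h1.bdd
  -- One factor `r` can be split off from the regular tensor `r^j · r⁻¹ ∇^j Riem`; it provides the
  -- bound `O(ρ)`.
  have heq : ∀ y ∈ Metric.ball x₀ ε ∩ dom e, fmul (fun p => ρ p ^ j)
      (covDerivIter (metricTensor g) (riem (metricTensor g)) j) e y I J
        = G.r y * (G.r y ^ j * ((G.r y)⁻¹ *
          covDerivIter (metricTensor g) (riem (metricTensor g)) j e y I J)) := by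
    intro y hy
    have h0 : G.r y ≠ 0 := (G.r_pos () y (by rw [hGW]; exact hy)).ne'
    have h2 : ρ (pt e y) = G.r y := (congrFun hGr y).symm
    simp only [fmul, h2]
    field_simp
  refine ⟨C, Metric.ball x₀ ε, Metric.ball_mem_nhds x₀ hε, ?_, fun y hy => ?_⟩
  · refine ContinuousOn.congr ?_ heq
    rw [← hGW ()]
    exact (Gauge.reg_r (G := G) 0).reg0.cont () |>.mul (h1.reg0.cont ())
  · have hyW : y ∈ G.W () := by rw [hGW]; exact hy
    rw [heq y hy, abs_mul, abs_of_pos (G.r_pos () y hyW), mul_comm, hGr]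
    rw [hGr] at hC
    exact mul_le_mul_of_nonneg_right (hC () y hyW) (hρ.nonneg _)

end Conclusion

end WAH

end

theorem mainTheorem5 (n k : ℕ) (hn : 1 ≤ n) (hk : 2 ≤ k) (α : ℝ) (hα0 : 0 ≤ α) (hα1 : α < 1)
    (Mbar : Type*) [TopologicalSpace Mbar] [T2Space Mbar] [CompactSpace Mbar]
    [ChartedSpace (EuclideanHalfSpace (n + 1)) Mbar] [IsManifold (𝓡∂ (n + 1)) ∞ Mbar]
    (ρ : Mbar → ℝ) (hρ : WAH.IsDefiningFunction n ρ) (𝒜 : WAH.MobiusCover n ρ)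
    (g : WAH.BilinField n Mbar) (hg : WAH.IsWeaklyAH 𝒜 k α g) :
    WAH.MemWHolder 𝒜 (k - 2) α 1 (WAH.riem (WAH.metricTensor g) + WAH.idTensor) ∧
    WAH.MemWHolder 𝒜 (k - 2) α 1
      (WAH.ric (WAH.metricTensor g) + (n : ℝ) • WAH.deltaTensor) ∧
    WAH.MemWHolder 𝒜 (k - 2) α 1
      (WAH.scal (WAH.metricTensor g) + WAH.constTensor ((n : ℝ) * (n + 1))) ∧
    WAH.MemWHolder 𝒜 k α 1 (WAH.gradNormSq (WAH.gBar ρ g) ρ - WAH.constTensor 1) ∧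
    ∀ j : ℕ, 1 ≤ j → j ≤ k - 2 →
      WAH.ExtendsContinuously (WAH.fmul (fun p => ρ p ^ j)
        (WAH.covDerivIter (WAH.metricTensor g) (WAH.riem (WAH.metricTensor g)) j)) ∧
      WAH.IsBigOAtBoundary (WAH.fmul (fun p => ρ p ^ j)
        (WAH.covDerivIter (WAH.metricTensor g) (WAH.riem (WAH.metricTensor g)) j)) ρ := by
  obtain ⟨m, rfl⟩ : ∃ m, k = m + 2 := ⟨k - 2, by omega⟩
  rw [Nat.add_sub_cancel]
  refine ⟨WAH.memWHolder_of_reg hρ hα1.le (WAH.reg_riem_pieceGauge hn hρ hα1.le hg),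
    WAH.memWHolder_of_reg hρ hα1.le (WAH.reg_ric_pieceGauge hn hρ hα1.le hg),
    WAH.memWHolder_of_reg hρ hα1.le (WAH.reg_scal_pieceGauge hn hρ hα1.le hg),
    WAH.memWHolder_of_reg hρ hα1.le (WAH.reg_gradNormSq_pieceGauge hn hρ hα1.le hg),
    fun j hj hjm => ?_⟩
  have h := fun e he x₀ hx I J =>
    WAH.covDerivIter_riem_local (e := e) (x₀ := x₀) hn hρ hα1.le hg he hx hj hjm I J
  exact ⟨WAH.extendsContinuously_of_local hρ h, WAH.isBigOAtBoundary_of_local hρ h⟩
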